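/- **Theorem 3.15 (Structure theorem for $\mathcal S'_\omega(\mathbb R^N)$).** Let $\omega:[0,\infty)\to[0,\infty)$ be a non-quasianalytic weight function, i.e. a continuous increasing function such that: $(\alpha)$ there is $K\ge 1$ with $\omega(2t)\le K(1+\omega(t))$ for all $t\ge0$; $(\beta)$ $\int_1^\infty \frac{\omega(t)}{1+t^2}\,dt<\infty$; $(\gamma)$ there are $a\in\mathbb R$, $b>0$ with $\omega(t)\ge a+b\log(1+t)$ for all $t\ge 0$; $(\delta)$ $t\mapsto \varphi_\omega(t)=\omega(e^t)$ is convex. Put $\omega(x)=\omega(|x|)$ for $x\in\mathbb R^N$, and $\varphi^*_\omega(s)=\sup_{t\ge0}\{st-\varphi_\omega(t)\}\in(-\infty,\infty]$ for $s\ge0$, with the conventions $e^{-\infty}=0$, $e^{\infty}=\infty$, $0\cdot\infty=0$. All functions are complex valued, $\mathbb N=\{1,2,\dots\}$ and $\mathbb N_0=\mathbb N\cup\{0\}$. Let $\mathcal E_\omega(\mathbb R^N)$ be the space of all $f\in C^\infty(\mathbb R^N)$ such that $$p_{K,m}(f)=\sup_{x\in K}\sup_{\alpha\in\mathbb N_0^N}|\partial^\alpha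 f(x)|\exp\Bigl(-m\varphi^*_\omega\Bigl(\tfrac{|\alpha|}{m}\Bigr)\Bigr)<\infty$$ for all compact $K\subset\mathbb R^N$ and $m\in\mathbb N$. For compact $K$ let $\mathcal D_\omega(K)=\{f\in\mathcal E_\omega(\mathbb R^N):\operatorname{supp} f\subseteq K\}$, with the topology given by the norms $p_{K,m}$, $m\in\mathbb N$; let $\mathcal D_\omega(\mathbb R^N)=\bigcup_K\mathcal D_\omega(K)$ carry the locally convex inductive limit topology, and let $\mathcal D'_\omega(\mathbb R^N)$ be its dual. Let $\mathcal S_\omega(\mathbb R^N)$ be the space of all $f\in L^1(\mathbb R^N)$ such that $f$ and its Fourier transform $\hat f(\xi)=\int e^{-i\langle x,\xi\rangle}f(x)\,dx$ are in $C^\infty(\mathbb R^N)$ and $$\|\exp(\lambda\omega)\,\partial^\alpha f\|_\infty<\infty,\qquad \|\exp(\lambda\omega)\,\partial^\alpha\hat f\|_\infty<\infty\qquad(\lambda>0,\ \alpha\in\mathbb N_0^N),$$ with the topology given by these seminorms, and let $\mathcal S'_\omega(\mathbb R^N)$ be its dual. An element $T\in\mathcal D'_\omega(\mathbb R^N)$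 is said to lie in $\mathcal S'_\omega(\mathbb R^N)$ if $\mathcal D_\omega(\mathbb R^N)\subseteq\mathcal S_\omega(\mathbb R^N)$ and $T$ is the restriction to $\mathcal D_\omega(\mathbb R^N)$ of an element of $\mathcal S'_\omega(\mathbb R^N)$ (the inclusion always holds). For $m\in\mathbb N$, $n\in\mathbb Z$ and $1\le q\le\infty$ let $\bigl(\oplus L^{q}(\mathbb R^N,\exp(n\omega(x))\,dx)\bigr)_{\omega,m,q}$ be the set of all families $\{f_\alpha\}_{\alpha\in\mathbb N_0^N}$ of Lebesgue measurable functions on $\mathbb R^N$ with $$\sum_{\alpha\in\mathbb N_0^N}\|\exp(n\omega)f_\alpha\|_q^q\,\exp\Bigl(qm\varphi^*_\omega\Bigl(\tfrac{|\alpha|}{m}\Bigr)\Bigr)<\infty\quad\text{if } q<\infty,\qquad \sup_{\alpha\in\mathbb N_0^N}\|\exp(n\omega)f_\alpha\|_\infty\,\exp\Bigl(m\varphi^*_\omega\Bigl(\tfrac{|\alpha|}{m}\Bigr)\Bigr)<\infty\quad\text{if } q=\infty.$$ Let $1\le p<\infty$, let $p'$ be the conjugate exponent of $p$, and let $T\in\mathcal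 D'_\omega(\mathbb R^N)$. Then $T\in\mathcal S'_\omega(\mathbb R^N)$ if and only if there exist $m\in\mathbb N$ and $\{f_\alpha\}_{\alpha\in\mathbb N_0^N}\in\bigl(\oplus L^{p'}(\mathbb R^N,\exp(-m\omega(x))\,dx)\bigr)_{\omega,m,p'}$ such that $$T=\sum_{\alpha\in\mathbb N_0^N}\partial^\alpha f_\alpha,$$ i.e. $\langle T,\varphi\rangle=\sum_{\alpha}(-1)^{|\alpha|}\int_{\mathbb R^N}f_\alpha(x)\,\partial^\alpha\varphi(x)\,dx$, as an unconditionally convergent series, for every $\varphi\in\mathcal D_\omega(\mathbb R^N)$. -/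

import Mathlib

open MeasureTheory Topology
open scoped ENNReal

noncomputable section

namespace Ultra

/-- Euclidean space `ℝ^N`. -/
abbrev E (N : ℕ) : Type := EuclideanSpace ℝ (Fin N)

/-- Multi-indices in `ℕ₀^N`. -/
abbrev MultiIndex (N : ℕ) : Type := Fin N → ℕ

/-- The length `|α|` of a multi-index. -/
def order {N : ℕ} (α : MultiIndex N) : ℕ := ∑ i, α i

/-! ### Weight functions -/

/-- Non-quasianalytic weight functions `ω : [0,∞) → [0,∞)` (only the values of `ω` on `[0,∞)`
matter). -/
structure IsWeight (ω : ℝ → ℝ) : Prop where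
  nonneg : ∀ t, 0 ≤ t → 0 ≤ ω t
  continuousOn : ContinuousOn ω (Set.Ici 0)
  monotoneOn : MonotoneOn ω (Set.Ici 0)
  doubling : ∃ K : ℝ, 1 ≤ K ∧ ∀ t, 0 ≤ t → ω (2 * t) ≤ K * (1 + ω t)
  nonQuasianalytic : IntegrableOn (fun t : ℝ => ω t / (1 + t ^ 2)) (Set.Ioi 1)
  log_le : ∃ a b : ℝ, 0 < b ∧ ∀ t, 0 ≤ t → a + b * Real.log (1 + t) ≤ ω t
  convex : ConvexOn ℝ Set.univ (fun t : ℝ => ω (Real.exp t))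

/-- The Young conjugate `φ*(s) = sup_{t ≥ 0} (s t - ω(e^t))`. The value `+∞` does occur, for instance
for `ω(t) = log (1 + t)` and `s > 1`, so the supremum is taken in the extended reals. -/
def youngConj (ω : ℝ → ℝ) (s : ℝ) : EReal :=
  ⨆ t : Set.Ici (0 : ℝ), ((s * t - ω (Real.exp t) : ℝ) : EReal)

/-- The exponent `l φ*(k / l)`. -/
def expo (ω : ℝ → ℝ) (l : ℝ) (k : ℕ) : EReal := (l : EReal) * youngConj ω (k / l)

/-! ### Partial derivatives -/

/-- The partial derivative `∂_i f`. -/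
def pderiv {N : ℕ} (i : Fin N) (f : E N → ℂ) : E N → ℂ :=
  fun x => fderiv ℝ f x (EuclideanSpace.single i 1)

/-- The partial derivative `∂^α f`, that is `∂_0^{α_0} (∂_1^{α_1} (⋯ f))`. -/
def mderiv {N : ℕ} (α : MultiIndex N) (f : E N → ℂ) : E N → ℂ :=
  (List.finRange N).foldr (fun i g => (pderiv i)^[α i] g) f

section DerivLemmas

variable {N : ℕ}

lemma pderiv_contDiff (i : Fin N) {f : E N → ℂ} (hf : ContDiff ℝ (⊤ : ℕ∞) f) :
    ContDiff ℝ (⊤ : ℕ∞) (pderiv i f) :=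
  (hf.fderiv_right (m := (⊤ : ℕ∞)) (by simp)).clm_apply contDiff_const

lemma pderiv_add (i : Fin N) {f g : E N → ℂ} (hf : ContDiff ℝ (⊤ : ℕ∞) f) (hg : ContDiff ℝ (⊤ : ℕ∞) g) :
    pderiv i (f + g) = pderiv i f + pderiv i g := by
  funext x
  simp only [pderiv, Pi.add_apply]
  rw [fderiv_add ((hf.differentiable (by simp)) x) ((hg.differentiable (by simp)) x)]
  rfl

lemma pderiv_smul (i : Fin N) (c : ℂ) {f : E N → ℂ} (hf : ContDiff ℝ (⊤ : ℕ∞) f) :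
    pderiv i (c • f) = c • pderiv i f := by
  funext x
  simp only [pderiv, Pi.smul_apply]
  rw [fderiv_const_smul ((hf.differentiable (by simp)) x)]
  rfl

lemma pderiv_iter (i : Fin N) (k : ℕ) :
    (∀ f : E N → ℂ, ContDiff ℝ (⊤ : ℕ∞) f → ContDiff ℝ (⊤ : ℕ∞) ((pderiv i)^[k] f)) ∧
    (∀ f g : E N → ℂ, ContDiff ℝ (⊤ : ℕ∞) f → ContDiff ℝ (⊤ : ℕ∞) g →
      (pderiv i)^[k] (f + g) = (pderiv i)^[k] f + (pderiv i)^[k] g) ∧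
    (∀ (c : ℂ) (f : E N → ℂ), ContDiff ℝ (⊤ : ℕ∞) f →
      (pderiv i)^[k] (c • f) = c • (pderiv i)^[k] f) := by
  induction k with
  | zero => simp
  | succ k ih =>
    obtain ⟨h1, h2, h3⟩ := ih
    refine ⟨fun f hf => ?_, fun f g hf hg => ?_, fun c f hf => ?_⟩
    · rw [Function.iterate_succ_apply']
      exact pderiv_contDiff i (h1 f hf)
    · simp only [Function.iterate_succ_apply']
      rw [h2 f g hf hg, pderiv_add i (h1 f hf) (h1 g hg)]
    · simp only [Function.iterate_succ_apply']
      rw [h3 c f hf, pderiv_smul i c (h1 f hf)]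

lemma mderiv_aux (α : MultiIndex N) (L : List (Fin N)) :
    (∀ f : E N → ℂ, ContDiff ℝ (⊤ : ℕ∞) f →
      ContDiff ℝ (⊤ : ℕ∞) (L.foldr (fun i g => (pderiv i)^[α i] g) f)) ∧
    (∀ f g : E N → ℂ, ContDiff ℝ (⊤ : ℕ∞) f → ContDiff ℝ (⊤ : ℕ∞) g →
      L.foldr (fun i g => (pderiv i)^[α i] g) (f + g) =
        L.foldr (fun i g => (pderiv i)^[α i] g) f + L.foldr (fun i g => (pderiv i)^[α i] g) g) ∧
    (∀ (c : ℂ) (f : E N → ℂ), ContDiff ℝ (⊤ : ℕ∞) f →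
      L.foldr (fun i g => (pderiv i)^[α i] g) (c • f) =
        c • L.foldr (fun i g => (pderiv i)^[α i] g) f) := by
  induction L with
  | nil => simp
  | cons i L ih =>
    obtain ⟨h1, h2, h3⟩ := ih
    obtain ⟨k1, k2, k3⟩ := pderiv_iter i (α i)
    refine ⟨fun f hf => ?_, fun f g hf hg => ?_, fun c f hf => ?_⟩
    · exact k1 _ (h1 f hf)
    · simp only [List.foldr_cons]
      rw [h2 f g hf hg, k2 _ _ (h1 f hf) (h1 g hg)]
    · simp only [List.foldr_cons]
      rw [h3 c f hf, k3 _ _ (h1 f hf)]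

lemma mderiv_contDiff (α : MultiIndex N) {f : E N → ℂ} (hf : ContDiff ℝ (⊤ : ℕ∞) f) :
    ContDiff ℝ (⊤ : ℕ∞) (mderiv α f) :=
  (mderiv_aux α _).1 f hf

lemma mderiv_add (α : MultiIndex N) {f g : E N → ℂ} (hf : ContDiff ℝ (⊤ : ℕ∞) f)
    (hg : ContDiff ℝ (⊤ : ℕ∞) g) : mderiv α (f + g) = mderiv α f + mderiv α g :=
  (mderiv_aux α _).2.1 f g hf hg

lemma mderiv_smul (α : MultiIndex N) (c : ℂ) {f : E N → ℂ} (hf : ContDiff ℝ (⊤ : ℕ∞) f) :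
    mderiv α (c • f) = c • mderiv α f :=
  (mderiv_aux α _).2.2 c f hf

lemma mderiv_zero (α : MultiIndex N) : mderiv α (0 : E N → ℂ) = 0 := by
  have h := mderiv_smul α (0 : ℂ) (f := (0 : E N → ℂ)) contDiff_const
  simpa using h

end DerivLemmas

/-- A finite, subadditive and absolutely homogeneous `[0,∞]`-valued function is a seminorm. -/
def toSeminorm {V : Type*} [AddCommGroup V] [Module ℂ V] (q : V → ℝ≥0∞)
    (hfin : ∀ v, q v < ∞) (hadd : ∀ v w, q (v + w) ≤ q v + q w)
    (hsmul : ∀ (c : ℂ) v, q (c • v) = ‖c‖ₑ * q v) : Seminorm ℂ V :=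
  Seminorm.of (fun v => (q v).toReal)
    (fun v w => by
      rw [← ENNReal.toReal_add (hfin v).ne (hfin w).ne]
      exact ENNReal.toReal_mono (ENNReal.add_lt_top.2 ⟨hfin v, hfin w⟩).ne (hadd v w))
    (fun c v => by simp [hsmul, ENNReal.toReal_mul])

/-! ### The spaces `ℰ_ω`, `𝒟_ω(K)`, `𝒟_ω` and `𝒟'_ω` on `ℝ^N` -/

/-- `p_{K,l}(f) = sup_{x ∈ K} sup_α |∂^α f(x)| exp(-l φ*(|α|/l))`, with `exp(-∞) = 0`. -/
def pK {N : ℕ} (ω : ℝ → ℝ) (K : Set (E N)) (l : ℝ) (f : E N → ℂ) : ℝ≥0∞ :=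
  ⨆ x ∈ K, ⨆ α : MultiIndex N, ‖mderiv α f x‖ₑ * EReal.exp (-expo ω l (order α))

lemma pK_add {N : ℕ} (ω : ℝ → ℝ) (K : Set (E N)) (l : ℝ) {f g : E N → ℂ}
    (hf : ContDiff ℝ (⊤ : ℕ∞) f) (hg : ContDiff ℝ (⊤ : ℕ∞) g) :
    pK ω K l (f + g) ≤ pK ω K l f + pK ω K l g := by
  refine iSup₂_le fun x hx => iSup_le fun α => ?_
  rw [mderiv_add α hf hg, Pi.add_apply]
  calc _ ≤ (‖mderiv α f x‖ₑ + ‖mderiv α g x‖ₑ) * EReal.exp (-expo ω l (order α)) := by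
        gcongr; exact enorm_add_le _ _
    _ = ‖mderiv α f x‖ₑ * EReal.exp (-expo ω l (order α)) +
        ‖mderiv α g x‖ₑ * EReal.exp (-expo ω l (order α)) := add_mul _ _ _
    _ ≤ _ := add_le_add
        (le_iSup₂_of_le x hx (le_iSup (fun α : MultiIndex N =>
          ‖mderiv α f x‖ₑ * EReal.exp (-expo ω l (order α))) α))
        (le_iSup₂_of_le x hx (le_iSup (fun α : MultiIndex N =>
          ‖mderiv α g x‖ₑ * EReal.exp (-expo ω l (order α))) α))

lemma pK_smul {N : ℕ} (ω : ℝ → ℝ) (K : Set (E N)) (l : ℝ) (c : ℂ) {f : E N → ℂ}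
    (hf : ContDiff ℝ (⊤ : ℕ∞) f) : pK ω K l (c • f) = ‖c‖ₑ * pK ω K l f := by
  simp only [pK, mderiv_smul _ c hf, Pi.smul_apply, enorm_smul, mul_assoc, ENNReal.mul_iSup]

lemma pK_zero {N : ℕ} (ω : ℝ → ℝ) (K : Set (E N)) (l : ℝ) :
    pK ω K l (0 : E N → ℂ) = 0 := by
  simp [pK, mderiv_zero]

/-- The `ω`-ultradifferentiable functions of Beurling type on `ℝ^N`. -/
def ESub (ω : ℝ → ℝ) (N : ℕ) : Submodule ℂ (E N → ℂ) where
  carrier := {f | ContDiff ℝ (⊤ : ℕ∞) f ∧ ∀ K : Set (E N), IsCompact K → ∀ m : ℕ+, pK ω K m f < ∞}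
  zero_mem' := ⟨contDiff_const, fun K _ m => by simp [pK_zero]⟩
  add_mem' := fun hf hg => ⟨hf.1.add hg.1, fun K hK m =>
    (pK_add ω K m hf.1 hg.1).trans_lt (ENNReal.add_lt_top.2 ⟨hf.2 K hK m, hg.2 K hK m⟩)⟩
  smul_mem' := fun c f hf => ⟨hf.1.const_smul c, fun K hK m => by
    rw [pK_smul ω K m c hf.1]
    exact ENNReal.mul_lt_top enorm_lt_top (hf.2 K hK m)⟩

/-- The elements of `ℰ_ω(ℝ^N)` with support in `K`. -/
def DKSub (ω : ℝ → ℝ) {N : ℕ} (K : Set (E N)) : Submodule ℂ (E N → ℂ) where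
  carrier := {f | f ∈ ESub ω N ∧ tsupport f ⊆ K}
  zero_mem' := ⟨zero_mem _, by simp⟩
  add_mem' := fun {f g} hf hg => ⟨add_mem hf.1 hg.1,
    (tsupport_add f g).trans (Set.union_subset hf.2 hg.2)⟩
  smul_mem' := fun c f hf => ⟨Submodule.smul_mem _ c hf.1,
    (tsupport_smul_subset_right (fun _ => c) f).trans hf.2⟩

/-- The elements of `ℰ_ω(ℝ^N)` with compact support. -/
def DSub (ω : ℝ → ℝ) (N : ℕ) : Submodule ℂ (E N → ℂ) where
  carrier := {f | f ∈ ESub ω N ∧ HasCompactSupport f}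
  zero_mem' := ⟨zero_mem _, HasCompactSupport.zero⟩
  add_mem' := fun hf hg => ⟨add_mem hf.1 hg.1, hf.2.add hg.2⟩
  smul_mem' := fun c _ hf => ⟨Submodule.smul_mem _ c hf.1, hf.2.smul_left (f := fun _ => c)⟩

/-- The Fréchet space `𝒟_ω(K)` for a compact set `K`. -/
def DK (ω : ℝ → ℝ) {N : ℕ} (K : TopologicalSpace.Compacts (E N)) : Type :=
  ↥(DKSub ω (K : Set (E N)))

/-- The space `𝒟_ω(ℝ^N)` of test functions of Beurling type. -/
def D (ω : ℝ → ℝ) (N : ℕ) : Type := ↥(DSub ω N)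

section

variable (ω : ℝ → ℝ) {N : ℕ} (K : TopologicalSpace.Compacts (E N))

instance : AddCommGroup (DK ω K) := inferInstanceAs (AddCommGroup ↥(DKSub ω (K : Set (E N))))
instance : Module ℂ (DK ω K) := inferInstanceAs (Module ℂ ↥(DKSub ω (K : Set (E N))))
instance : AddCommGroup (D ω N) := inferInstanceAs (AddCommGroup ↥(DSub ω N))
instance : Module ℂ (D ω N) := inferInstanceAs (Module ℂ ↥(DSub ω N))

/-- The norms `p_{K,m}`, `m = 1, 2, …`, on `𝒟_ω(K)`. -/
def DK.seminorms : SeminormFamily ℂ (DK ω K) ℕ+ := fun m =>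
  toSeminorm (fun f => pK ω K m f.1) (fun f => f.2.1.2 K K.isCompact m)
    (fun f g => pK_add ω K m f.2.1.1 g.2.1.1) (fun c f => pK_smul ω K m c f.2.1.1)

/-- The topology of `𝒟_ω(K)`, generated by the norms `p_{K,m}`. -/
instance : TopologicalSpace (DK ω K) := (DK.seminorms ω K).moduleFilterBasis.topology

/-- The inclusion of `𝒟_ω(K)` in `𝒟_ω(ℝ^N)`. -/
def DK.incl (f : DK ω K) : D ω N := ⟨f.1, f.2.1, K.isCompact.of_isClosed_subset
  (isClosed_tsupport f.1) f.2.2⟩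

/-- The inductive limit topology of `𝒟_ω(ℝ^N)`: the finest locally convex vector space topology for
which all the inclusions of the spaces `𝒟_ω(K)` are continuous. -/
instance : TopologicalSpace (D ω N) :=
  sInf {t : TopologicalSpace (D ω N) |
    (∀ K : TopologicalSpace.Compacts (E N), Continuous[inferInstance, t] (DK.incl ω K)) ∧
    @IsTopologicalAddGroup (D ω N) t _ ∧
    @ContinuousSMul ℂ (D ω N) _ _ t ∧
    @LocallyConvexSpace ℝ (D ω N) _ _ _ (Module.complexToReal (D ω N)) t}

end

/-- The `ω`-ultradistributions of Beurling type on `ℝ^N`. -/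
abbrev DDual (ω : ℝ → ℝ) (N : ℕ) : Type := D ω N →L[ℂ] ℂ

/-! ### The spaces `𝒮_ω` and `𝒮'_ω` -/

/-- The Fourier transform `∫ e^{-i⟨x,ξ⟩} f(x) dx`. -/
def ultraFourier {N : ℕ} (f : E N → ℂ) : E N → ℂ :=
  fun ξ => ∫ x, Complex.exp (-(Complex.I * (inner ℝ x ξ : ℝ))) * f x

lemma ultraFourier_integrable {N : ℕ} {f : E N → ℂ} (hf : Integrable f) (ξ : E N) :
    Integrable fun x => Complex.exp (-(Complex.I * (inner ℝ x ξ : ℝ))) * f x := by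
  refine hf.bdd_mul (c := 1) (Continuous.aestronglyMeasurable (by fun_prop)) ?_
  refine Filter.Eventually.of_forall fun x => ?_
  simp [Complex.norm_exp]

lemma ultraFourier_add {N : ℕ} {f g : E N → ℂ} (hf : Integrable f) (hg : Integrable g) :
    ultraFourier (f + g) = ultraFourier f + ultraFourier g := by
  funext ξ
  simp only [ultraFourier, Pi.add_apply, mul_add]
  exact integral_add (ultraFourier_integrable hf ξ) (ultraFourier_integrable hg ξ)

lemma ultraFourier_smul {N : ℕ} (c : ℂ) (f : E N → ℂ) : ultraFourier (c • f) = c • ultraFourier f := by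
  funext ξ
  simp only [ultraFourier, Pi.smul_apply, smul_eq_mul]
  rw [← integral_const_mul]
  congr 1
  funext x
  ring

/-- `‖exp(l ω) ∂^α f‖_∞`, for a smooth function `f`. -/
def wsup {N : ℕ} (ω : ℝ → ℝ) (l : ℝ) (α : MultiIndex N) (f : E N → ℂ) : ℝ≥0∞ :=
  ⨆ x, ‖mderiv α f x‖ₑ * ENNReal.ofReal (Real.exp (l * ω ‖x‖))

lemma wsup_add {N : ℕ} (ω : ℝ → ℝ) (l : ℝ) (α : MultiIndex N) {f g : E N → ℂ}
    (hf : ContDiff ℝ (⊤ : ℕ∞) f) (hg : ContDiff ℝ (⊤ : ℕ∞) g) :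
    wsup ω l α (f + g) ≤ wsup ω l α f + wsup ω l α g := by
  refine iSup_le fun x => ?_
  rw [mderiv_add α hf hg, Pi.add_apply]
  calc _ ≤ (‖mderiv α f x‖ₑ + ‖mderiv α g x‖ₑ) * ENNReal.ofReal (Real.exp (l * ω ‖x‖)) := by
        gcongr; exact enorm_add_le _ _
    _ = ‖mderiv α f x‖ₑ * ENNReal.ofReal (Real.exp (l * ω ‖x‖)) +
        ‖mderiv α g x‖ₑ * ENNReal.ofReal (Real.exp (l * ω ‖x‖)) := add_mul _ _ _
    _ ≤ _ := add_le_add (le_iSup_of_le x le_rfl) (le_iSup_of_le x le_rfl)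

lemma wsup_smul {N : ℕ} (ω : ℝ → ℝ) (l : ℝ) (α : MultiIndex N) (c : ℂ) {f : E N → ℂ}
    (hf : ContDiff ℝ (⊤ : ℕ∞) f) : wsup ω l α (c • f) = ‖c‖ₑ * wsup ω l α f := by
  simp only [wsup, mderiv_smul _ c hf, Pi.smul_apply, enorm_smul, mul_assoc, ENNReal.mul_iSup]

lemma wsup_zero {N : ℕ} (ω : ℝ → ℝ) (l : ℝ) (α : MultiIndex N) :
    wsup ω l α (0 : E N → ℂ) = 0 := by
  simp [wsup, mderiv_zero]

/-- The integrable functions `f` such that `f` and its Fourier transform are smooth and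
`‖exp(l ω) ∂^α f‖_∞ < ∞`, `‖exp(l ω) ∂^α f̂‖_∞ < ∞` for all `l > 0` and all `α`. -/
def SSub (ω : ℝ → ℝ) (N : ℕ) : Submodule ℂ (E N → ℂ) where
  carrier := {f | Integrable f ∧ ContDiff ℝ (⊤ : ℕ∞) f ∧ ContDiff ℝ (⊤ : ℕ∞) (ultraFourier f) ∧
    ∀ (l : Set.Ioi (0 : ℝ)) (α : MultiIndex N),
      wsup ω l α f < ∞ ∧ wsup ω l α (ultraFourier f) < ∞}
  zero_mem' := by
    have h : ultraFourier (0 : E N → ℂ) = 0 := by funext ξ; simp [ultraFourier]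
    refine ⟨integrable_zero _ _ _, contDiff_const, ?_, fun l α => ?_⟩
    · rw [h]; exact contDiff_const
    · rw [h]; simp [wsup_zero]
  add_mem' := fun hf hg => by
    refine ⟨hf.1.add hg.1, hf.2.1.add hg.2.1, ?_, fun l α => ⟨?_, ?_⟩⟩
    · rw [ultraFourier_add hf.1 hg.1]; exact hf.2.2.1.add hg.2.2.1
    · exact (wsup_add ω l α hf.2.1 hg.2.1).trans_lt
        (ENNReal.add_lt_top.2 ⟨(hf.2.2.2 l α).1, (hg.2.2.2 l α).1⟩)
    · rw [ultraFourier_add hf.1 hg.1]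
      exact (wsup_add ω l α hf.2.2.1 hg.2.2.1).trans_lt
        (ENNReal.add_lt_top.2 ⟨(hf.2.2.2 l α).2, (hg.2.2.2 l α).2⟩)
  smul_mem' := fun c f hf => by
    refine ⟨hf.1.smul c, hf.2.1.const_smul c, ?_, fun l α => ⟨?_, ?_⟩⟩
    · rw [ultraFourier_smul]; exact hf.2.2.1.const_smul c
    · rw [wsup_smul ω l α c hf.2.1]
      exact ENNReal.mul_lt_top enorm_lt_top (hf.2.2.2 l α).1
    · rw [ultraFourier_smul, wsup_smul ω l α c hf.2.2.1]
      exact ENNReal.mul_lt_top enorm_lt_top (hf.2.2.2 l α).2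

/-- The space `𝒮_ω(ℝ^N)` of `ω`-ultradifferentiable rapidly decreasing functions of Beurling
type. -/
def S (ω : ℝ → ℝ) (N : ℕ) : Type := ↥(SSub ω N)

section

variable (ω : ℝ → ℝ) (N : ℕ)

instance : AddCommGroup (S ω N) := inferInstanceAs (AddCommGroup ↥(SSub ω N))
instance : Module ℂ (S ω N) := inferInstanceAs (Module ℂ ↥(SSub ω N))

/-- The seminorms `‖exp(l ω) ∂^α f‖_∞` and `‖exp(l ω) ∂^α f̂‖_∞`, `l > 0`, `α ∈ ℕ₀^N`. -/
def S.seminorms : SeminormFamily ℂ (S ω N)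
    ((Set.Ioi (0 : ℝ) × MultiIndex N) ⊕ (Set.Ioi (0 : ℝ) × MultiIndex N))
  | .inl i => toSeminorm (fun f => wsup ω i.1 i.2 f.1) (fun f => (f.2.2.2.2 i.1 i.2).1)
      (fun f g => wsup_add ω i.1 i.2 f.2.2.1 g.2.2.1) (fun c f => wsup_smul ω i.1 i.2 c f.2.2.1)
  | .inr i => toSeminorm (fun f => wsup ω i.1 i.2 (ultraFourier f.1))
      (fun f => (f.2.2.2.2 i.1 i.2).2)
      (fun f g => by
        have h : ultraFourier (f + g).1 = ultraFourier f.1 + ultraFourier g.1 := ultraFourier_add f.2.1 g.2.1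
        rw [h]
        exact wsup_add ω i.1 i.2 f.2.2.2.1 g.2.2.2.1)
      (fun c f => by
        have h : ultraFourier (c • f).1 = c • ultraFourier f.1 := ultraFourier_smul c f.1
        rw [h]
        exact wsup_smul ω i.1 i.2 c f.2.2.2.1)

/-- The Fréchet topology of `𝒮_ω(ℝ^N)`. -/
instance : TopologicalSpace (S ω N) := (S.seminorms ω N).moduleFilterBasis.topology

end

/-- The dual `𝒮'_ω(ℝ^N)`. -/
abbrev SDual (ω : ℝ → ℝ) (N : ℕ) : Type := S ω N →L[ℂ] ℂ

/-- `T ∈ 𝒟'_ω` lies in `𝒮'_ω`: every test function belongs to `𝒮_ω`, and `T` is the restriction to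
`𝒟_ω` of a continuous linear functional on `𝒮_ω`. -/
def MemSDual {ω : ℝ → ℝ} {N : ℕ} (T : DDual ω N) : Prop :=
  ∃ U : SDual ω N, ∀ φ : D ω N, ∃ h : φ.1 ∈ SSub ω N, U ⟨φ.1, h⟩ = T φ

/-! ### The weighted sequence spaces and the series -/

/-- The quantity that has to be finite: for `q < ∞` it is
`∑_α ‖exp(n ω) f_α‖_q^q exp(q m φ*(|α|/m))`, and for `q = ∞` it is
`sup_α ‖exp(n ω) f_α‖_∞ exp(m φ*(|α|/m))`, with the convention `0 · ∞ = 0`. -/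
def sumNorm {N : ℕ} (ω : ℝ → ℝ) (m : ℕ+) (n : ℤ) (q : ℝ≥0∞) (f : MultiIndex N → E N → ℂ) :
    ℝ≥0∞ :=
  if q = ∞ then
    ⨆ α, eLpNorm (fun x => Real.exp (n * ω ‖x‖) • f α x) ∞ volume *
      EReal.exp (expo ω m (order α))
  else
    ∑' α, eLpNorm (fun x => Real.exp (n * ω ‖x‖) • f α x) q volume ^ q.toReal *
      EReal.exp ((q.toReal : EReal) * expo ω m (order α))

/-- The space `(⊕ L^q(ℝ^N, exp(n ω(x)) dx))_{ω,m,q}`, `1 ≤ q ≤ ∞`. -/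
def MemSum {N : ℕ} (ω : ℝ → ℝ) (m : ℕ+) (n : ℤ) (q : ℝ≥0∞) (f : MultiIndex N → E N → ℂ) :
    Prop :=
  (∀ α, AEStronglyMeasurable (f α) volume) ∧ sumNorm ω m n q f < ∞

/-- `T = ∑_α ∂^α f_α`, that is `⟨T, φ⟩ = ∑_α (-1)^{|α|} ∫ f_α(x) ∂^α φ(x) dx` for every test
function `φ`. -/
def IsSumDeriv {ω : ℝ → ℝ} {N : ℕ} (T : DDual ω N) (f : MultiIndex N → E N → ℂ) : Prop :=
  ∀ φ : D ω N,
    HasSum (fun α => (-1 : ℂ) ^ order α * ∫ x, f α x * mderiv α φ.1 x) (T φ)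

end Ultra

end

/-! The topology of `S` is governed by very few quantities: the weighted `L¹` norm of `f` and the
weighted sup norm of its Fourier transform (`DecayBound`). Two estimates link these to the
derivatives weighted by `invWeight`, the number exp(-m φ*(k/m)), which is the infimum of r^{-k}
exp(m ω(r)) over r ≥ 1.

From decay to derivatives (`exists_mderiv_le`): write f(t) as f(t) w_x(t) times 1/w_x(t), with w_x a
Gaussian centred at x. Fourier inversion expands the first factor in exponentials exp(i⟨ξ,t⟩), and
1/w_x is a Gaussian average of real exponentials exp(⟨t-x,s⟩). So f is a superposition of
exponentials with exponents iξ + s (`eq_expInt_stft`), and ∂^α only inserts the monomial (iξ+s)^α.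
The Young inequality for φ* pays for this monomial, with a factor 2^{|α|} to spare. The coefficient
is a short-time Fourier transform, which decays like exp(-lω) in both variables because f and its
transform do.

From derivatives to decay (`exists_fourier_le`): pure derivatives ∂_j^k multiply the transform by
(iξ_j)^k. Choosing j with |ξ_j| comparable to |ξ| and k by a discrete biconjugate argument
(convexity of ω(e^t)) turns bounds on derivatives into the factor exp(-lω(ξ)).

If T is a series of derivatives, Hölder's inequality and the first estimate bound its terms by a
constant times 2^{-|α|}, so the series defines a continuous functional on `S`. Conversely, a
functional on `S` is bounded by a decay bound, hence on test functions by the `L¹` norm of (α,x) ↦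
exp((l+k)ω(x)) `invWeight` ∂^αφ(x) for the finite measure 2^{-|α|} ⊗ exp(-kω(x))dx. By Hahn–Banach
it has a bounded density g (`exists_bounded_density`); reading the integral slice by slice in α
gives the f_α. As g is bounded, the same family works for all exponents q ≥ 1. -/

noncomputable section

namespace Ultra

/-! ### Growth of the weight, and Young conjugates in multiplicative form -/

section

/-! ### Weight functions: elementary estimates -/

namespace IsWeight

variable {ω : ℝ → ℝ}

lemma mono (hω : IsWeight ω) {s t : ℝ} (hs : 0 ≤ s) (hst : s ≤ t) : ω s ≤ ω t :=
  hω.monotoneOn hs (hs.trans hst : (0 : ℝ) ≤ t) hst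

lemma continuous_norm (hω : IsWeight ω) (V : Type*) [NormedAddCommGroup V] :
    Continuous fun x : V => ω ‖x‖ :=
  hω.continuousOn.comp_continuous _root_.continuous_norm fun x => norm_nonneg x

/-- On (t, 2t] monotonicity bounds the integrand in condition (β) below by ω(t)/(1+4t²), so t ω(t) ≤
A(1+4t²), which is at most 5At² for t ≥ 1. Linear growth is what lets Gaussians absorb every
exp(lω). -/
lemma exists_le_linear (hω : IsWeight ω) : ∃ C : ℝ, 0 ≤ C ∧ ∀ t, 0 ≤ t → ω t ≤ C * (1 + t) := by
  set A := ∫ t in Set.Ioi (1 : ℝ), ω t / (1 + t ^ 2) with hA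
  have hpos : ∀ s ∈ Set.Ioi (1 : ℝ), 0 ≤ ω s / (1 + s ^ 2) := fun s hs => by
    have := hω.nonneg s (by have : (1 : ℝ) < s := hs; linarith)
    positivity
  have key : ∀ t, 1 ≤ t → ω t ≤ 5 * A * t := by
    intro t ht
    have hsub : Set.Ioc t (2 * t) ⊆ Set.Ioi (1 : ℝ) := fun s hs => lt_of_le_of_lt ht hs.1
    have h0 := hω.nonneg t (by linarith)
    have h1 : ∫ _ in Set.Ioc t (2 * t), ω t / (1 + (2 * t) ^ 2) ≤
        ∫ s in Set.Ioc t (2 * t), ω s / (1 + s ^ 2) := by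
      refine setIntegral_mono_on (by simp) (hω.nonQuasianalytic.mono_set hsub) measurableSet_Ioc ?_
      intro s hs
      have hs1 : t < s := hs.1
      have hs2 : s ≤ 2 * t := hs.2
      have h := hω.mono (by linarith : (0 : ℝ) ≤ t) hs1.le
      have hs0 : 0 ≤ s := by linarith
      have hωs : 0 ≤ ω s := h0.trans h
      gcongr
    have h2 : ∫ s in Set.Ioc t (2 * t), ω s / (1 + s ^ 2) ≤ A :=
      setIntegral_mono_set hω.nonQuasianalytic
        ((ae_restrict_iff' measurableSet_Ioi).2 (Filter.Eventually.of_forall hpos))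
        hsub.eventuallyLE
    have h3 : t * (ω t / (1 + (2 * t) ^ 2)) ≤ A := by
      refine le_trans (le_of_eq ?_) (h1.trans h2)
      rw [setIntegral_const]
      simp [Measure.real, Real.volume_Ioc]
      left
      rw [ENNReal.toReal_ofReal (by linarith)]
      ring
    have h4 : t * ω t ≤ A * (1 + (2 * t) ^ 2) := by
      rw [← mul_div_assoc, div_le_iff₀ (by positivity)] at h3
      exact h3
    have hA0 : 0 ≤ A := setIntegral_nonneg measurableSet_Ioi hpos
    have h5 : t * ω t ≤ t * (5 * A * t) := by
      have h6 : A * (1 + (2 * t) ^ 2) ≤ A * (5 * t ^ 2) := by gcongr; nlinarith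
      linarith
    exact le_of_mul_le_mul_left h5 (by linarith)
  have hA0 : 0 ≤ A := setIntegral_nonneg measurableSet_Ioi hpos
  have h10 := hω.nonneg 1 zero_le_one
  refine ⟨5 * A + ω 1, by positivity, fun t ht => ?_⟩
  rcases le_total 1 t with h | h
  · nlinarith [key t h]
  · nlinarith [hω.mono ht h]

lemma exists_scale_le (hω : IsWeight ω) {R : ℝ} (hR : 0 ≤ R) :
    ∃ K : ℝ, 1 ≤ K ∧ ∀ t, 0 ≤ t → ω (R * t) ≤ K * (1 + ω t) := by
  obtain ⟨K, hK, h⟩ := hω.doubling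
  have pow : ∀ n : ℕ, ∃ K' : ℝ, 1 ≤ K' ∧ ∀ t, 0 ≤ t → ω (2 ^ n * t) ≤ K' * (1 + ω t) := by
    intro n
    induction n with
    | zero => exact ⟨1, le_rfl, fun t _ => by simp⟩
    | succ n ih =>
      obtain ⟨K', hK', h'⟩ := ih
      refine ⟨K * (1 + K'), by nlinarith, fun t ht => ?_⟩
      have h1 := h (2 ^ n * t) (by positivity)
      have h2 := h' t ht
      have h3 := hω.nonneg t ht
      rw [pow_succ', mul_assoc]
      refine h1.trans ?_
      rw [mul_assoc]
      gcongr
      nlinarith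
  obtain ⟨n, hn⟩ := pow_unbounded_of_one_lt R (one_lt_two)
  obtain ⟨K', hK', h'⟩ := pow n
  refine ⟨K', hK', fun t ht => (hω.mono (by positivity) ?_).trans (h' t ht)⟩
  gcongr

/-- A substitute for subadditivity: s + t is at most twice the larger of the two, so doubling
applies. -/
lemma exists_add_le (hω : IsWeight ω) :
    ∃ K : ℝ, 1 ≤ K ∧ ∀ s t, 0 ≤ s → 0 ≤ t → ω (s + t) ≤ K * (1 + ω s + ω t) := by
  obtain ⟨K, hK, h⟩ := hω.doubling
  refine ⟨K, hK, fun s t hs ht => ?_⟩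
  have h1 := hω.nonneg s hs
  have h2 := hω.nonneg t ht
  rcases le_total s t with hst | hst
  · refine (hω.mono (by positivity) (by linarith : s + t ≤ 2 * t)).trans ((h t ht).trans ?_)
    exact mul_le_mul_of_nonneg_left (by linarith) (by linarith)
  · refine (hω.mono (by positivity) (by linarith : s + t ≤ 2 * s)).trans ((h s hs).trans ?_)
    exact mul_le_mul_of_nonneg_left (by linarith) (by linarith)

/-- Condition (γ) in multiplicative form. Through it all polynomial factors are absorbed into
exponentials of ω. -/
lemma exists_one_add_le_exp (hω : IsWeight ω) :
    ∃ c : ℝ, 0 < c ∧ ∀ t, 0 ≤ t → 1 + t ≤ Real.exp (c * (1 + ω t)) := by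
  obtain ⟨a, b, hb, h⟩ := hω.log_le
  refine ⟨(1 + |a|) / b, by positivity, fun t ht => ?_⟩
  rw [← Real.log_le_iff_le_exp (by linarith), div_mul_eq_mul_div, le_div_iff₀ hb]
  have h1 := h t ht
  have h2 := hω.nonneg t ht
  nlinarith [neg_abs_le a, abs_nonneg a]

lemma exists_integrable_exp_neg (hω : IsWeight ω) (N : ℕ) :
    ∃ k : ℝ, 0 < k ∧ ∀ l, k ≤ l → Integrable fun x : E N => Real.exp (-(l * ω ‖x‖)) := by
  obtain ⟨c, hc, h⟩ := hω.exists_one_add_le_exp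
  have hint : Integrable (fun x : E N => (1 + ‖x‖) ^ (-((N : ℝ) + 1))) :=
    integrable_one_add_norm (by simp)
  refine ⟨c * (N + 1), by positivity, fun l hl => ?_⟩
  refine (hint.const_mul (Real.exp (c * (N + 1)))).mono'
    (Continuous.aestronglyMeasurable ?_) (Filter.Eventually.of_forall fun x => ?_)
  · exact Real.continuous_exp.comp (continuous_const.mul (hω.continuous_norm (E N))).neg
  · have h1 := h ‖x‖ (norm_nonneg x)
    have h0 := hω.nonneg ‖x‖ (norm_nonneg x)
    have hx := norm_nonneg x
    rw [Real.norm_of_nonneg (Real.exp_pos _).le]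
    have h2 : (1 + ‖x‖) ^ ((N : ℝ) + 1) ≤ Real.exp (c * (1 + ω ‖x‖)) ^ ((N : ℝ) + 1) := by
      gcongr
    rw [← Real.exp_mul] at h2
    rw [Real.rpow_neg (by positivity), ← div_eq_mul_inv, le_div_iff₀ (by positivity)]
    calc _ ≤ Real.exp (-(l * ω ‖x‖)) * Real.exp (c * (1 + ω ‖x‖) * (N + 1)) := by gcongr
      _ = Real.exp (-(l * ω ‖x‖) + c * (1 + ω ‖x‖) * (N + 1)) := (Real.exp_add _ _).symm
      _ ≤ _ := by
        gcongr
        nlinarith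

/-- The weight is dominated by every Gaussian. -/
lemma exists_linear_le_sq (hω : IsWeight ω) (l : ℝ) (hl : 0 ≤ l) {ε : ℝ} (hε : 0 < ε) (A : ℝ) :
    ∃ C : ℝ, ∀ t, 0 ≤ t → l * ω t + A * t ≤ ε * t ^ 2 + C := by
  obtain ⟨c, hc, h⟩ := hω.exists_le_linear
  -- The quadratic term comes from completing the square in ε t² - (lc + A) t.
  refine ⟨l * c + (l * c + A) ^ 2 / (4 * ε), fun t ht => ?_⟩
  have h1 : l * ω t ≤ l * (c * (1 + t)) := by gcongr; exact h t ht
  have h2 : (l * c + A) * t ≤ ε * t ^ 2 + (l * c + A) ^ 2 / (4 * ε) := by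
    have : 0 ≤ (2 * ε * t - (l * c + A)) ^ 2 / (4 * ε) := by positivity
    have h3 : (2 * ε * t - (l * c + A)) ^ 2 / (4 * ε) =
        ε * t ^ 2 + (l * c + A) ^ 2 / (4 * ε) - (l * c + A) * t := by
      field_simp; ring
    linarith
  nlinarith

end IsWeight

/-! ### The inverse weights `exp (-m φ*(k / m))` -/

/-- The real number `exp (-m φ*(k / m))`, which is `0` if `φ*(k / m) = ∞`. -/
def invWeight (ω : ℝ → ℝ) (m : ℝ) (k : ℕ) : ℝ := (EReal.exp (-expo ω m k)).toReal

variable {ω : ℝ → ℝ} {m : ℝ}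

/-- Test the supremum at t = log r. With `expo_le` this trades φ* for inequalities in r = e^t, r ≥
1. -/
lemma le_expo (hm : 0 < m) (k : ℕ) {r : ℝ} (hr : 1 ≤ r) :
    ((k * Real.log r - m * ω r : ℝ) : EReal) ≤ expo ω m k := by
  have h : ((k / m * Real.log r - ω r : ℝ) : EReal) ≤ youngConj ω (k / m) := by
    refine le_trans (le_of_eq ?_) (le_iSup (fun t : Set.Ici (0 : ℝ) =>
      (((k : ℝ) / m * t - ω (Real.exp t) : ℝ) : EReal)) ⟨Real.log r, Real.log_nonneg hr⟩)
    simp only [Real.exp_log (by linarith : (0 : ℝ) < r)]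
  have h2 : ((k * Real.log r - m * ω r : ℝ) : EReal) =
      (m : EReal) * ((k / m * Real.log r - ω r : ℝ) : EReal) := by
    rw [← EReal.coe_mul]
    congr 1
    field_simp
  rw [h2, expo]
  exact mul_le_mul_of_nonneg_left h (by exact_mod_cast hm.le)

lemma expo_le (hm : 0 < m) {k : ℕ} {c : ℝ} (h : ∀ r, 1 ≤ r → k * Real.log r - m * ω r ≤ c) :
    expo ω m k ≤ c := by
  have h1 : youngConj ω (k / m) ≤ ((c / m : ℝ) : EReal) := by
    refine iSup_le fun t => ?_
    have h2 := h (Real.exp t) (Real.one_le_exp t.2)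
    rw [Real.log_exp] at h2
    rw [EReal.coe_le_coe_iff, le_div_iff₀ hm]
    refine le_trans (le_of_eq ?_) h2
    field_simp
  calc expo ω m k ≤ (m : EReal) * ((c / m : ℝ) : EReal) :=
        mul_le_mul_of_nonneg_left h1 (by exact_mod_cast hm.le)
    _ = c := by
        rw [← EReal.coe_mul]
        congr 1
        field_simp

/-- The point r = 1 gives a finite lower bound. Hence exp(-m φ*(k/m)) is never ∞, and passing to the
real number `invWeight` loses nothing. -/
lemma expo_ne_bot (hm : 0 < m) (k : ℕ) : expo ω m k ≠ ⊥ := fun h => by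
  have := le_expo (ω := ω) hm k le_rfl
  rw [h] at this
  simp only [le_bot_iff] at this
  exact EReal.coe_ne_bot _ this

lemma exp_neg_expo (hm : 0 < m) (k : ℕ) :
    EReal.exp (-expo ω m k) = ENNReal.ofReal (invWeight ω m k) := by
  rw [invWeight, ENNReal.ofReal_toReal]
  simpa [EReal.exp_eq_top_iff] using expo_ne_bot hm k

lemma invWeight_nonneg (k : ℕ) : 0 ≤ invWeight ω m k := ENNReal.toReal_nonneg

lemma exp_expo (hm : 0 < m) (k : ℕ) :
    EReal.exp (expo ω m k) = (ENNReal.ofReal (invWeight ω m k))⁻¹ := by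
  rw [← exp_neg_expo hm, EReal.exp_neg, inv_inv]

/-- Young's inequality in multiplicative form. It remains valid when φ* is infinite, since
`invWeight` is then zero. -/
lemma pow_mul_invWeight_le (hm : 0 < m) (k : ℕ) {r : ℝ} (hr : 1 ≤ r) :
    r ^ k * invWeight ω m k ≤ Real.exp (m * ω r) := by
  have hr0 : 0 < r := by linarith
  have h1 : EReal.exp (-expo ω m k) ≤
      EReal.exp ((-(k * Real.log r - m * ω r) : ℝ) : EReal) := by
    rw [EReal.exp_le_exp_iff, EReal.coe_neg]
    exact EReal.neg_le_neg_iff.2 (le_expo hm k hr)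
  rw [EReal.exp_coe] at h1
  have h2 : invWeight ω m k ≤ Real.exp (-(k * Real.log r - m * ω r)) := by
    have := ENNReal.toReal_mono ENNReal.ofReal_ne_top h1
    rwa [ENNReal.toReal_ofReal (Real.exp_pos _).le] at this
  calc _ ≤ r ^ k * Real.exp (-(k * Real.log r - m * ω r)) := by gcongr
    _ = Real.exp (m * ω r) := by
      rw [← Real.exp_log (pow_pos hr0 k), ← Real.exp_add, Real.log_pow]
      congr 1
      ring

/-- The converse of `pow_mul_invWeight_le`: any b dominating r^k exp(-m ω(r)) for all r ≥ 1
dominates its supremum, which is the inverse of `invWeight`. -/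
lemma le_mul_invWeight (hm : 0 < m) {k : ℕ} {b : ℝ} (hb : 0 < b)
    (h : ∀ r, 1 ≤ r → r ^ k ≤ b * Real.exp (m * ω r)) : 1 ≤ b * invWeight ω m k := by
  have h1 : expo ω m k ≤ (Real.log b : ℝ) := by
    refine expo_le hm fun r hr => ?_
    have hr0 : 0 < r := by linarith
    have h2 := Real.log_le_log (pow_pos hr0 k) (h r hr)
    rw [Real.log_mul hb.ne' (Real.exp_pos _).ne', Real.log_exp, Real.log_pow] at h2
    linarith
  have h2 : EReal.exp ((-(Real.log b) : ℝ) : EReal) ≤ EReal.exp (-expo ω m k) := by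
    rw [EReal.exp_le_exp_iff, EReal.coe_neg]
    exact EReal.neg_le_neg_iff.2 h1
  rw [EReal.exp_coe, exp_neg_expo hm, ENNReal.ofReal_le_ofReal_iff (invWeight_nonneg k),
    Real.exp_neg, Real.exp_log hb] at h2
  calc 1 = b * b⁻¹ := by field_simp
    _ ≤ _ := by gcongr

lemma invWeight_mono (hω : IsWeight ω) {m m' : ℝ} (hm : 0 < m) (hmm : m ≤ m') (k : ℕ) :
    invWeight ω m k ≤ invWeight ω m' k := by
  rcases (invWeight_nonneg (ω := ω) (m := m) k).eq_or_lt with h | h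
  · rw [← h]; exact invWeight_nonneg k
  have h1 : 1 ≤ (invWeight ω m k)⁻¹ * invWeight ω m' k := by
    refine le_mul_invWeight (hm.trans_le hmm) (by positivity) fun r hr => ?_
    have h2 := pow_mul_invWeight_le (ω := ω) hm k hr
    have h3 := hω.nonneg r (by linarith)
    rw [inv_mul_eq_div, le_div_iff₀ h]
    refine h2.trans ?_
    gcongr
  rwa [inv_mul_eq_div, le_div_iff₀ h, one_mul] at h1

/-- For weights of logarithmic growth φ*(k/m) may be infinite when k/m is large, so positivity
requires m large in terms of k. -/
lemma exists_invWeight_pos (hω : IsWeight ω) (k : ℕ) :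
    ∃ m₀ : ℝ, 0 < m₀ ∧ ∀ m, m₀ ≤ m → 0 < invWeight ω m k := by
  obtain ⟨c, hc, h⟩ := hω.exists_one_add_le_exp
  refine ⟨c * (k + 1), by positivity, fun m hm => ?_⟩
  have hm0 : 0 < m := lt_of_lt_of_le (by positivity) hm
  have h1 : 1 ≤ Real.exp (c * k) * invWeight ω m k := by
    refine le_mul_invWeight hm0 (Real.exp_pos _) fun r hr => ?_
    have h0 := hω.nonneg r (by linarith)
    calc r ^ k ≤ Real.exp (c * (1 + ω r)) ^ k := by
          gcongr
          exact le_trans (by linarith) (h r (by linarith))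
      _ = Real.exp (c * k + c * k * ω r) := by
          rw [← Real.exp_nat_mul]; congr 1; ring
      _ ≤ Real.exp (c * k + m * ω r) := by
          gcongr
          nlinarith
      _ = _ := Real.exp_add _ _
  by_contra hneg
  have : invWeight ω m k = 0 := le_antisymm (not_lt.1 hneg) (invWeight_nonneg k)
  rw [this] at h1
  norm_num at h1

/-- A discrete form of the biconjugate theorem for the convex function `t ↦ ω (e^t)`. -/
lemma exists_one_le_pow_mul_invWeight (hω : IsWeight ω) (hm : 0 < m) {r₀ : ℝ} (hr₀ : 1 ≤ r₀) :
    ∃ k : ℕ, 1 ≤ r₀ ^ (k + 1) * Real.exp (-(m * ω r₀)) * invWeight ω m k := by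
  set φ : ℝ → ℝ := fun t => ω (Real.exp t) with hφ
  have hr0 : 0 < r₀ := by linarith
  set t₀ := Real.log r₀ with ht₀
  have hφt : φ t₀ = ω r₀ := by simp [hφ, ht₀, Real.exp_log hr0]
  have hmono : Monotone φ := fun s t hst =>
    hω.mono (Real.exp_pos s).le (Real.exp_le_exp.2 hst)
  -- A supporting line of the convex function φ at t₀, whose slope is the right derivative.
  obtain ⟨s, hs⟩ : ∃ s : ℝ, ∀ t, φ t₀ + s * (t - t₀) ≤ φ t := by
    have hint : t₀ ∈ interior (Set.univ : Set ℝ) := by simp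
    refine ⟨derivWithin φ (Set.Ioi t₀) t₀, fun t => ?_⟩
    rcases lt_trichotomy t t₀ with h | h | h
    · have h1 := (hω.convex.slope_le_leftDeriv_of_mem_interior (Set.mem_univ t) hint h).trans
        (hω.convex.leftDeriv_le_rightDeriv_of_mem_interior hint)
      rw [slope_def_field, div_le_iff₀ (by linarith)] at h1
      change φ t₀ - φ t ≤ derivWithin φ (Set.Ioi t₀) t₀ * _ at h1
      linarith
    · simp [h]
    · have h1 := hω.convex.rightDeriv_le_slope_of_mem_interior hint (Set.mem_univ t) h
      rw [slope_def_field, le_div_iff₀ (by linarith)] at h1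
      change derivWithin φ (Set.Ioi t₀) t₀ * _ ≤ φ t - φ t₀ at h1
      linarith
  have hs0 : 0 ≤ s := by
    have h1 := hs (t₀ - 1)
    have h2 := hmono (by linarith : t₀ - 1 ≤ t₀)
    linarith
  have hk1 : (⌊m * s⌋₊ : ℝ) ≤ m * s := Nat.floor_le (by positivity)
  have hk2 : m * s < ⌊m * s⌋₊ + 1 := Nat.lt_floor_add_one _
  -- The optimal exponent m s need not be an integer. Rounding it down is harmless for the factor
  -- r^k with r ≥ 1 and costs at most one extra power of r₀, hence k + 1 in the statement.
  refine ⟨⌊m * s⌋₊, le_mul_invWeight hm (by positivity) fun r hr => ?_⟩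
  have hrp : 0 < r := by linarith
  have h1 := hs (Real.log r)
  have h2 : φ (Real.log r) = ω r := by simp [hφ, Real.exp_log hrp]
  rw [h2, hφt] at h1
  have hl := Real.log_nonneg hr
  have hl0 : 0 ≤ t₀ := Real.log_nonneg hr₀
  rw [← Real.exp_log (pow_pos hrp _), ← Real.exp_log (pow_pos hr0 _), ← Real.exp_add,
    ← Real.exp_add, Real.log_pow, Real.log_pow]
  refine Real.exp_le_exp.2 ?_
  push_cast
  have h3 : m * (ω r₀ + s * (Real.log r - t₀)) ≤ m * ω r := by gcongr
  have h4 : (⌊m * s⌋₊ : ℝ) * Real.log r ≤ m * s * Real.log r := by gcongr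
  have h5 : m * s * t₀ ≤ (⌊m * s⌋₊ + 1) * t₀ := by gcongr
  linarith

end

/-! ### Differentiating integrals of exponentials under the integral sign -/

section

/-! ### Superpositions of exponentials -/

lemma abs_apply_le_norm {N : ℕ} (t : E N) (i : Fin N) : |t i| ≤ ‖t‖ := by
  simpa using PiLp.norm_apply_le t i

/-- The real linear form `t ↦ ∑ w_i t_i`. -/
def linForm {N : ℕ} (w : Fin N → ℂ) : E N →L[ℝ] ℂ :=
  ∑ i, w i • (Complex.ofRealCLM.comp (EuclideanSpace.proj i : E N →L[ℝ] ℝ))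

lemma linForm_apply {N : ℕ} (w : Fin N → ℂ) (t : E N) : linForm w t = ∑ i, w i * (t i : ℂ) := by
  simp [linForm]

lemma norm_linForm_le {N : ℕ} (w : Fin N → ℂ) : ‖linForm w‖ ≤ ∑ i, ‖w i‖ := by
  refine ContinuousLinearMap.opNorm_le_bound _ (by positivity) fun t => ?_
  rw [linForm_apply, Finset.sum_mul]
  refine (norm_sum_le _ _).trans (Finset.sum_le_sum fun i _ => ?_)
  rw [norm_mul, Complex.norm_real, Real.norm_eq_abs]
  gcongr
  exact abs_apply_le_norm t i

lemma norm_exp_linForm_le {N : ℕ} (w : Fin N → ℂ) {t : E N} {R : ℝ} (ht : ‖t‖ ≤ R) :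
    ‖Complex.exp (linForm w t)‖ ≤ Real.exp (R * ∑ i, |(w i).re|) := by
  rw [Complex.norm_exp, linForm_apply, Complex.re_sum, Finset.mul_sum]
  gcongr with i
  rw [Complex.re_mul_ofReal]
  calc _ ≤ |(w i).re * t i| := le_abs_self _
    _ = |t i| * |(w i).re| := by rw [abs_mul, mul_comm]
    _ ≤ _ := by gcongr; exact (abs_apply_le_norm t i).trans ht

/-- Conditions under which `∫ h(z) exp (∑ c_i(z) t_i) dν(z)` may be differentiated at will. -/
structure ExpAdmissible {Z : Type*} [MeasurableSpace Z] {N : ℕ} (ν : Measure Z) (h : Z → ℂ)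
    (c : Z → Fin N → ℂ) : Prop where
  meas : AEStronglyMeasurable h ν
  meas_exponent : ∀ i, AEStronglyMeasurable (fun z => c z i) ν
  int : ∀ (R : ℝ) (n : ℕ),
    Integrable (fun z => ‖h z‖ * (∑ i, ‖c z i‖) ^ n * Real.exp (R * ∑ i, |(c z i).re|)) ν

/-- The function `t ↦ ∫ h(z) exp (∑ c_i(z) t_i) dν(z)`. -/
def expInt {Z : Type*} [MeasurableSpace Z] {N : ℕ} (ν : Measure Z) (h : Z → ℂ)
    (c : Z → Fin N → ℂ) (t : E N) : ℂ :=
  ∫ z, h z * Complex.exp (linForm (c z) t) ∂ν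

namespace ExpAdmissible

variable {Z : Type*} [MeasurableSpace Z] {N : ℕ} {ν : Measure Z} {h : Z → ℂ} {c : Z → Fin N → ℂ}

lemma mul_exponent (H : ExpAdmissible ν h c) (i : Fin N) :
    ExpAdmissible ν (fun z => h z * c z i) c := by
  refine ⟨H.meas.mul (H.meas_exponent i), H.meas_exponent, fun R n => ?_⟩
  refine (H.int R (n + 1)).mono' ?_ (Filter.Eventually.of_forall fun z => ?_)
  · have h1 := H.meas
    have h2 := H.meas_exponent
    have h3 : ∀ i, AEStronglyMeasurable (fun z => |(c z i).re|) ν := fun i =>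
      (Complex.continuous_re.abs.comp_aestronglyMeasurable (h2 i))
    refine ((h1.mul (h2 i)).norm.mul
      ((Finset.aestronglyMeasurable_fun_sum _ fun i _ => (h2 i).norm).pow n)).mul
      (Real.continuous_exp.comp_aestronglyMeasurable
        ((Finset.aestronglyMeasurable_fun_sum _ fun i _ => h3 i).const_mul R))
  · rw [Real.norm_of_nonneg (by positivity), norm_mul, pow_succ']
    have : ‖c z i‖ ≤ ∑ i, ‖c z i‖ :=
      Finset.single_le_sum (f := fun i => ‖c z i‖) (fun i _ => norm_nonneg _) (Finset.mem_univ i)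
    calc _ = ‖h z‖ * (‖c z i‖ * (∑ i, ‖c z i‖) ^ n) * Real.exp (R * ∑ i, |(c z i).re|) := by ring
      _ ≤ _ := by gcongr

lemma aestronglyMeasurable_linForm (H : ExpAdmissible ν h c) :
    AEStronglyMeasurable (fun z => linForm (c z)) ν :=
  Finset.aestronglyMeasurable_fun_sum _ fun i _ => (H.meas_exponent i).smul_const _

lemma aestronglyMeasurable_integrand (H : ExpAdmissible ν h c) (t : E N) :
    AEStronglyMeasurable (fun z => h z * Complex.exp (linForm (c z) t)) ν :=
  H.meas.mul (Complex.continuous_exp.comp_aestronglyMeasurable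
    (H.aestronglyMeasurable_linForm.apply_continuousLinearMap t))

lemma integrable_integrand (H : ExpAdmissible ν h c) (t : E N) :
    Integrable (fun z => h z * Complex.exp (linForm (c z) t)) ν := by
  refine (H.int ‖t‖ 0).mono' (H.aestronglyMeasurable_integrand t)
    (Filter.Eventually.of_forall fun z => ?_)
  rw [norm_mul, pow_zero, mul_one]
  gcongr
  exact norm_exp_linForm_le _ le_rfl

/-- The derivative is dominated on the unit ball around t₀ by one integrable function: the case R =
‖t₀‖ + 1, n = 1 of admissibility. -/
lemma hasFDerivAt (H : ExpAdmissible ν h c) (t₀ : E N) :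
    HasFDerivAt (expInt ν h c)
      (∫ z, (h z * Complex.exp (linForm (c z) t₀)) • linForm (c z) ∂ν) t₀ := by
  refine hasFDerivAt_integral_of_dominated_of_fderiv_le
    (F := fun t z => h z * Complex.exp (linForm (c z) t))
    (F' := fun t z => (h z * Complex.exp (linForm (c z) t)) • linForm (c z))
    (bound := fun z => ‖h z‖ * (∑ i, ‖c z i‖) ^ 1 *
      Real.exp ((‖t₀‖ + 1) * ∑ i, |(c z i).re|))
    (Metric.ball_mem_nhds t₀ one_pos)
    (Filter.Eventually.of_forall fun t => H.aestronglyMeasurable_integrand t)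
    (H.integrable_integrand t₀)
    ((H.aestronglyMeasurable_integrand t₀).smul H.aestronglyMeasurable_linForm)
    (Filter.Eventually.of_forall fun z t ht => ?_) (H.int _ 1)
    (Filter.Eventually.of_forall fun z t _ => ?_)
  · rw [norm_smul, norm_mul, pow_one]
    have h1 : ‖t‖ ≤ ‖t₀‖ + 1 := by
      have := norm_le_norm_add_norm_sub' t t₀
      have h2 : ‖t - t₀‖ < 1 := by simpa [dist_eq_norm] using ht
      linarith
    calc _ ≤ ‖h z‖ * Real.exp ((‖t₀‖ + 1) * ∑ i, |(c z i).re|) * ∑ i, ‖c z i‖ := by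
          gcongr
          · exact norm_exp_linForm_le _ h1
          · exact norm_linForm_le _
      _ = _ := by ring
  · have h1 := ((linForm (c z)).hasFDerivAt (x := t)).cexp.const_mul (h z)
    simpa [smul_smul] using h1

lemma pderiv_expInt (H : ExpAdmissible ν h c) (i : Fin N) :
    pderiv i (expInt ν h c) = expInt ν (fun z => h z * c z i) c := by
  funext t
  have hint : Integrable (fun z => (h z * Complex.exp (linForm (c z) t)) • linForm (c z)) ν := by
    refine (H.int ‖t‖ 1).mono'
      ((H.aestronglyMeasurable_integrand t).smul H.aestronglyMeasurable_linForm)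
      (Filter.Eventually.of_forall fun z => ?_)
    rw [norm_smul, norm_mul, pow_one]
    calc _ ≤ ‖h z‖ * Real.exp (‖t‖ * ∑ i, |(c z i).re|) * ∑ i, ‖c z i‖ := by
          gcongr
          · exact norm_exp_linForm_le _ le_rfl
          · exact norm_linForm_le _
      _ = _ := by ring
  rw [pderiv, (H.hasFDerivAt t).fderiv, ContinuousLinearMap.integral_apply hint, expInt]
  congr 1
  funext z
  have : linForm (c z) (EuclideanSpace.single i 1) = c z i := by
    simp [linForm_apply, PiLp.single_apply, apply_ite]
  simp only [_root_.smul_apply, this, smul_eq_mul]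
  ring

/-- The induction runs over all h at once, since each partial derivative is again such an integral
with h replaced by h c_i. -/
lemma contDiff_nat (n : ℕ) : ∀ {h : Z → ℂ}, ExpAdmissible ν h c → ContDiff ℝ n (expInt ν h c) := by
  induction n with
  | zero =>
    intro h H
    rw [Nat.cast_zero, contDiff_zero]
    exact continuous_iff_continuousAt.2 fun t => (H.hasFDerivAt t).continuousAt
  | succ n ih =>
    intro h H
    rw [Nat.cast_succ, contDiff_succ_iff_fderiv_apply]
    refine ⟨fun t => (H.hasFDerivAt t).differentiableAt, by simp, fun y => ?_⟩
    have h1 : (fun x => fderiv ℝ (expInt ν h c) x y) =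
        fun x => ∑ i, (y i) • expInt ν (fun z => h z * c z i) c x := by
      funext x
      have hy : y = ∑ i, (y i) • EuclideanSpace.single i (1 : ℝ) := by
        ext j
        simp [Pi.single_apply]
      conv_lhs => rw [hy]
      rw [map_sum]
      refine Finset.sum_congr rfl fun i _ => ?_
      rw [map_smul, ← H.pderiv_expInt i]
      rfl
    rw [h1]
    exact ContDiff.sum fun i _ => (ih (H.mul_exponent i)).const_smul _

lemma contDiff (H : ExpAdmissible ν h c) : ContDiff ℝ (⊤ : ℕ∞) (expInt ν h c) :=
  contDiff_infty.2 fun n => contDiff_nat n H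

lemma mul_exponent_pow (H : ExpAdmissible ν h c) (i : Fin N) (k : ℕ) :
    ExpAdmissible ν (fun z => h z * c z i ^ k) c ∧
      (pderiv i)^[k] (expInt ν h c) = expInt ν (fun z => h z * c z i ^ k) c := by
  induction k with
  | zero => simpa using H
  | succ k ih =>
    rw [Function.iterate_succ_apply', ih.2, ih.1.pderiv_expInt i]
    have h1 : (fun z => h z * c z i ^ k * c z i) = fun z => h z * c z i ^ (k + 1) := by
      funext z; ring
    rw [← h1]
    exact ⟨ih.1.mul_exponent i, rfl⟩

/-- Differentiation inserts a monomial in the exponents and nothing else: the estimates of all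
orders come from one formula, with no Leibniz sums. -/
lemma mderiv_expInt (H : ExpAdmissible ν h c) (α : MultiIndex N) :
    mderiv α (expInt ν h c) = expInt ν (fun z => h z * ∏ i, c z i ^ α i) c := by
  have key : ∀ L : List (Fin N),
      ExpAdmissible ν (fun z => h z * (L.map fun i => c z i ^ α i).prod) c ∧
      L.foldr (fun i g => (pderiv i)^[α i] g) (expInt ν h c) =
        expInt ν (fun z => h z * (L.map fun i => c z i ^ α i).prod) c := by
    intro L
    induction L with
    | nil => simpa using H
    | cons i L ih =>
      have h1 := ih.1.mul_exponent_pow i (α i)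
      have h2 : (fun z => h z * (L.map fun i => c z i ^ α i).prod * c z i ^ α i) =
          fun z => h z * ((i :: L).map fun i => c z i ^ α i).prod := by
        funext z
        rw [List.map_cons, List.prod_cons]
        ring
      rw [h2] at h1
      rw [List.foldr_cons, ih.2]
      exact h1
  rw [mderiv, (key _).2]
  simp only [Fin.prod_univ_def]

end ExpAdmissible

end

/-! ### Fourier inversion and decay of the Gaussian short-time Fourier transform -/

section

/-! ### Fourier inversion -/

lemma ultraFourier_eq_fourier {N : ℕ} (f : E N → ℂ) (ξ : E N) :
    ultraFourier f ξ = FourierTransform.fourier f ((2 * Real.pi)⁻¹ • ξ) := by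
  rw [Real.fourier_eq', ultraFourier]
  congr 1
  funext v
  rw [inner_smul_right, smul_eq_mul]
  congr 2
  have : (-2 * Real.pi * ((2 * Real.pi)⁻¹ * inner ℝ v ξ) : ℝ) = -inner ℝ v ξ := by
    field_simp
  rw [this]
  push_cast
  ring

lemma norm_ultraFourier_le {N : ℕ} (f : E N → ℂ) (ξ : E N) :
    ‖ultraFourier f ξ‖ ≤ ∫ x, ‖f x‖ := by
  refine (norm_integral_le_integral_norm _).trans (le_of_eq ?_)
  congr 1
  funext x
  simp [Complex.norm_exp]

lemma continuous_ultraFourier {N : ℕ} {f : E N → ℂ} (hf : Integrable f) :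
    Continuous (ultraFourier f) := by
  refine continuous_of_dominated (bound := fun x => ‖f x‖)
    (fun ξ => (ultraFourier_integrable hf ξ).aestronglyMeasurable) (fun ξ => ?_) hf.norm ?_
  · exact Filter.Eventually.of_forall fun x => by simp [Complex.norm_exp]
  · exact Filter.Eventually.of_forall fun x => by fun_prop

/-- The two normalizations of the Fourier transform differ by the dilation ξ ↦ 2πξ, whose Jacobian
is the factor (2π)^N. -/
lemma ultraFourier_inversion {N : ℕ} {f : E N → ℂ} (hc : Continuous f) (hf : Integrable f)
    (hf' : Integrable (ultraFourier f)) (x : E N) :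
    ∫ ξ, Complex.exp (Complex.I * (inner ℝ ξ x : ℝ)) * ultraFourier f ξ =
      (2 * Real.pi) ^ N * f x := by
  have h2 : ∀ v, FourierTransform.fourier f v = ultraFourier f ((2 * Real.pi) • v) := fun v => by
    rw [ultraFourier_eq_fourier, inv_smul_smul₀ (by positivity)]
  have hF : Integrable (FourierTransform.fourier f) := by
    have : FourierTransform.fourier f = fun v => ultraFourier f ((2 * Real.pi) • v) := funext h2
    rw [this]
    exact hf'.comp_smul (by positivity)
  have h3 := hf.fourierInv_fourier_eq hF (hc.continuousAt (x := x))
  rw [Real.fourierInv_eq'] at h3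
  have h4 := Measure.integral_comp_smul (volume : Measure (E N))
    (fun ξ => Complex.exp (Complex.I * (inner ℝ ξ x : ℝ)) * ultraFourier f ξ) (2 * Real.pi)
  have h5 : ∫ v, Complex.exp ((2 * Real.pi * inner ℝ v x : ℝ) * Complex.I) •
      FourierTransform.fourier f v = ∫ v : E N, (fun ξ => Complex.exp (Complex.I *
        (inner ℝ ξ x : ℝ)) * ultraFourier f ξ) ((2 * Real.pi) • v) := by
    congr 1
    funext v
    simp only [h2 v, inner_smul_left, smul_eq_mul]
    congr 2
    simp
    ring
  rw [← h3, h5, h4, finrank_euclideanSpace, Fintype.card_fin, abs_of_pos (by positivity)]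
  rw [Complex.real_smul, ← mul_assoc]
  push_cast
  rw [mul_inv_cancel₀ (by simp [Real.pi_ne_zero]), one_mul]

lemma ultraFourier_ultraFourier {N : ℕ} {f : E N → ℂ} (hc : Continuous f) (hf : Integrable f)
    (hf' : Integrable (ultraFourier f)) (x : E N) :
    ultraFourier (ultraFourier f) x = (2 * Real.pi) ^ N * f (-x) := by
  rw [← ultraFourier_inversion hc hf hf' (-x), ultraFourier]
  congr 1
  funext ξ
  rw [inner_neg_right]
  push_cast
  ring_nf

/-! ### Gaussians -/

lemma integrable_exp_neg_mul_sq_norm {N : ℕ} {b : ℝ} (hb : 0 < b) :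
    Integrable fun v : E N => Real.exp (-(b * ‖v‖ ^ 2)) := by
  have h := (GaussianFourier.integrable_cexp_neg_mul_sq_norm_add (V := E N) (b := (b : ℂ))
    (by simpa using hb) 0 0).norm
  refine h.congr (Filter.Eventually.of_forall fun v => ?_)
  have : (-(b : ℂ) * (‖v‖ : ℂ) ^ 2 + 0 * ((inner ℝ (0 : E N) v : ℝ) : ℂ)) =
      ((-(b * ‖v‖ ^ 2) : ℝ) : ℂ) := by push_cast; ring
  simp only [this, Complex.norm_exp_ofReal]

/-- The total mass of `exp (-‖v‖² / 2)`. -/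
def gaussMass (N : ℕ) : ℂ := (Real.pi / (1 / 2 : ℂ)) ^ ((N : ℂ) / 2)

lemma gaussMass_ne_zero (N : ℕ) : gaussMass N ≠ 0 := by
  simp [gaussMass, Complex.cpow_eq_zero_iff, Real.pi_ne_zero]

/-- Used for two values of c: c = i expresses the window as a Fourier transform of a Gaussian, and c
= 1 expresses the reciprocal of the window as an average of real exponentials. -/
lemma integral_gauss_mul_exp {N : ℕ} (c : ℂ) (y : E N) :
    ∫ v : E N, (Real.exp (-(1 / 2 * ‖v‖ ^ 2)) : ℂ) * Complex.exp (c * (inner ℝ y v : ℝ)) =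
      gaussMass N * Complex.exp (c ^ 2 * ‖y‖ ^ 2 / 2) := by
  have h := GaussianFourier.integral_cexp_neg_mul_sq_norm_add (V := E N) (b := (1 / 2 : ℂ))
    (by norm_num) c y
  rw [finrank_euclideanSpace, Fintype.card_fin] at h
  rw [gaussMass]
  convert h using 2
  · funext v
    rw [Complex.ofReal_exp, ← Complex.exp_add]
    congr 1
    push_cast
    ring
  · congr 1
    ring

lemma exists_gauss_exp_le (n : ℕ) (A : ℝ) :
    ∃ C : ℝ, 0 ≤ C ∧ ∀ s : ℝ, 0 ≤ s →
      (1 + s) ^ n * Real.exp (-(1 / 2 * s ^ 2) + A * s) ≤ C * Real.exp (-(1 / 4 * s ^ 2)) := by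
  -- After 1 + s ≤ e^s the linear term is (n + A)s, and (n + A)s ≤ s²/4 + (n + A)².
  refine ⟨Real.exp ((n + A) ^ 2), (Real.exp_pos _).le, fun s hs => ?_⟩
  have h1 : (1 + s) ^ n ≤ Real.exp (n * s) := by
    rw [Real.exp_nat_mul]
    gcongr
    rw [add_comm]
    exact Real.add_one_le_exp s
  calc _ ≤ Real.exp (n * s) * Real.exp (-(1 / 2 * s ^ 2) + A * s) := by gcongr
    _ = Real.exp (n * s + (-(1 / 2 * s ^ 2) + A * s)) := (Real.exp_add _ _).symm
    _ ≤ Real.exp ((n + A) ^ 2 + -(1 / 4 * s ^ 2)) := by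
      refine Real.exp_le_exp.2 ?_
      nlinarith [sq_nonneg (s / 2 - (n + A))]
    _ = _ := Real.exp_add _ _

/-! ### Functions that decay rapidly together with their Fourier transforms -/

/-- The bounds `∫ exp(l ω) |f| ≤ M` and `exp(l ω) |f̂| ≤ M`. -/
structure DecayBound {N : ℕ} (ω : ℝ → ℝ) (l M : ℝ) (f : E N → ℂ) : Prop where
  integral_le : ∫ x, Real.exp (l * ω ‖x‖) * ‖f x‖ ≤ M
  fourier_le : ∀ ξ, Real.exp (l * ω ‖ξ‖) * ‖ultraFourier f ξ‖ ≤ M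

/-- Continuous functions for which all the quantities in `DecayBound` are finite. -/
structure RapidDecay {N : ℕ} (ω : ℝ → ℝ) (f : E N → ℂ) : Prop where
  continuous : Continuous f
  integrable_exp : ∀ l : ℝ, Integrable fun x => Real.exp (l * ω ‖x‖) * ‖f x‖
  fourier_bdd : ∀ l : ℝ, ∃ M, ∀ ξ, Real.exp (l * ω ‖ξ‖) * ‖ultraFourier f ξ‖ ≤ M

variable {ω : ℝ → ℝ} {N : ℕ}

lemma RapidDecay.integrable {f : E N → ℂ} (hf : RapidDecay ω f) : Integrable f := by
  have := hf.integrable_exp 0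
  simp only [zero_mul, Real.exp_zero, one_mul] at this
  exact (integrable_norm_iff hf.continuous.aestronglyMeasurable).1 this

lemma RapidDecay.exists_decayBound {f : E N → ℂ} (hf : RapidDecay ω f) (l : ℝ) :
    ∃ M, DecayBound ω l M f := by
  obtain ⟨M, hM⟩ := hf.fourier_bdd l
  exact ⟨max (∫ x, Real.exp (l * ω ‖x‖) * ‖f x‖) M, le_max_left _ _,
    fun ξ => (hM ξ).trans (le_max_right _ _)⟩

lemma DecayBound.nonneg {f : E N → ℂ} {l M : ℝ} (h : DecayBound ω l M f) : 0 ≤ M :=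
  le_trans (by positivity) (h.fourier_le 0)

/-- Rapid decay supplies integrability. Without it the integral for the larger l' could be zero by
default and give no information about the smaller l. -/
lemma DecayBound.mono (hω : IsWeight ω) {f : E N → ℂ} (hf : RapidDecay ω f) {l l' M : ℝ}
    (h : DecayBound ω l' M f) (hl : l ≤ l') : DecayBound ω l M f := by
  have key : ∀ x : E N, Real.exp (l * ω ‖x‖) ≤ Real.exp (l' * ω ‖x‖) := fun x => by
    have := hω.nonneg ‖x‖ (norm_nonneg x)
    gcongr
  refine ⟨(integral_mono (hf.integrable_exp l) (hf.integrable_exp l') fun x => ?_).trans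
    h.integral_le, fun ξ => le_trans ?_ (h.fourier_le ξ)⟩
  · exact mul_le_mul_of_nonneg_right (key x) (norm_nonneg _)
  · exact mul_le_mul_of_nonneg_right (key ξ) (norm_nonneg _)

/-! ### The short-time Fourier transform with Gaussian window -/

/-- The Gaussian window, centred at `x`. -/
def window (x t : E N) : ℝ := Real.exp (-(1 / 2 * ‖t - x‖ ^ 2))

lemma window_pos (x t : E N) : 0 < window x t := Real.exp_pos _

lemma window_le_one (x t : E N) : window x t ≤ 1 := by
  rw [window, Real.exp_le_one_iff]
  have := sq_nonneg ‖t - x‖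
  linarith

lemma continuous_window (x : E N) : Continuous (window x) := by
  unfold window
  fun_prop

/-- The Fourier transform of `f` times the Gaussian window centred at `x`. -/
def stft (f : E N → ℂ) (x ξ : E N) : ℂ := ultraFourier (fun t => f t * window x t) ξ

lemma integrable_mul_window {f : E N → ℂ} (hf : Integrable f) (x : E N) :
    Integrable fun t => f t * window x t := by
  refine hf.mul_bdd (c := 1) (Complex.continuous_ofReal.comp
    (continuous_window x)).aestronglyMeasurable (Filter.Eventually.of_forall fun t => ?_)
  rw [Complex.norm_real, Real.norm_of_nonneg (window_pos x t).le]
  exact window_le_one x t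

/-- Write the window as a Fourier transform and apply Fubini: in ξ, the short-time transform is the
Fourier transform of f convolved with a modulated Gaussian, so it inherits the decay of the former.
-/
lemma gaussMass_mul_stft {f : E N → ℂ} (hf : Integrable f) (x ξ : E N) :
    gaussMass N * stft f x ξ = ∫ η : E N, (Real.exp (-(1 / 2 * ‖η‖ ^ 2)) : ℂ) *
      Complex.exp (-(Complex.I * (inner ℝ x η : ℝ))) * ultraFourier f (ξ - η) := by
  have h1 : ∀ t, gaussMass N * (window x t : ℂ) = ∫ η : E N, (Real.exp (-(1 / 2 * ‖η‖ ^ 2)) : ℂ) *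
      Complex.exp (Complex.I * (inner ℝ (t - x) η : ℝ)) := fun t => by
    rw [integral_gauss_mul_exp, window, Complex.I_sq]
    congr 1
    push_cast
    congr 1
    ring
  set F : E N → E N → ℂ := fun t η => (Real.exp (-(1 / 2 * ‖η‖ ^ 2)) : ℂ) *
      Complex.exp (-(Complex.I * (inner ℝ x η : ℝ))) *
      (Complex.exp (-(Complex.I * (inner ℝ t (ξ - η) : ℝ))) * f t) with hF
  have hint : Integrable (Function.uncurry F) (volume.prod volume) := by
    have hg : Integrable (fun η : E N => (Real.exp (-(1 / 2 * ‖η‖ ^ 2)) : ℂ)) :=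
      (integrable_exp_neg_mul_sq_norm (by norm_num : (0 : ℝ) < 1 / 2)).ofReal
    have h2 := hf.mul_prod hg
    have h3 : Function.uncurry F = fun z : E N × E N =>
        (Complex.exp (-(Complex.I * (inner ℝ x z.2 : ℝ))) *
          Complex.exp (-(Complex.I * (inner ℝ z.1 (ξ - z.2) : ℝ)))) *
        (f z.1 * (Real.exp (-(1 / 2 * ‖z.2‖ ^ 2)) : ℂ)) := by
      funext z
      simp only [hF, Function.uncurry]
      ring
    rw [h3]
    refine h2.bdd_mul (c := 1) (Continuous.aestronglyMeasurable (by fun_prop))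
      (Filter.Eventually.of_forall fun z => ?_)
    simp [Complex.norm_exp]
  have h4 := integral_integral_swap hint
  calc gaussMass N * stft f x ξ = ∫ t, ∫ η, F t η := by
        rw [stft, ultraFourier, ← integral_const_mul]
        congr 1
        funext t
        have : gaussMass N * (Complex.exp (-(Complex.I * (inner ℝ t ξ : ℝ))) *
            (f t * (window x t : ℂ))) = Complex.exp (-(Complex.I * (inner ℝ t ξ : ℝ))) * f t *
            (gaussMass N * (window x t : ℂ)) := by ring
        rw [this, h1 t, ← integral_const_mul]
        congr 1
        funext η
        simp only [hF]
        have h5 : Complex.exp (-(Complex.I * (inner ℝ x η : ℝ))) *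
            Complex.exp (-(Complex.I * (inner ℝ t (ξ - η) : ℝ))) =
            Complex.exp (-(Complex.I * (inner ℝ t ξ : ℝ))) *
            Complex.exp (Complex.I * (inner ℝ (t - x) η : ℝ)) := by
          rw [← Complex.exp_add, ← Complex.exp_add, inner_sub_right, inner_sub_left]
          congr 1
          push_cast
          ring
        linear_combination (-(Real.exp (-(1 / 2 * ‖η‖ ^ 2)) : ℂ) * f t) * h5
    _ = ∫ η, ∫ t, F t η := h4
    _ = _ := by
        congr 1
        funext η
        simp only [hF]
        rw [integral_const_mul]
        rfl

/-- Moving the weight from x to t costs only half of the exponent ‖t - x‖²/2 of the window. The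
other half keeps the Gaussian integrable. -/
lemma IsWeight.exists_shift_le (hω : IsWeight ω) (N : ℕ) {l₀ : ℝ} (hl₀ : 0 ≤ l₀) :
    ∃ l C : ℝ, 0 ≤ l ∧ ∀ x t : E N,
      l₀ * ω ‖x‖ ≤ l * ω ‖t‖ + 1 / 4 * ‖t - x‖ ^ 2 + C := by
  obtain ⟨K, hK, hadd⟩ := hω.exists_add_le
  obtain ⟨C, hC⟩ := hω.exists_linear_le_sq (l₀ * K) (by positivity)
    (by norm_num : (0 : ℝ) < 1 / 4) 0
  refine ⟨l₀ * K, l₀ * K + C, by positivity, fun x t => ?_⟩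
  have h1 : ω ‖x‖ ≤ K * (1 + ω ‖t‖ + ω ‖t - x‖) := by
    refine (hω.mono (norm_nonneg x) ?_).trans (hadd _ _ (norm_nonneg t) (norm_nonneg (t - x)))
    have := norm_sub_le t (t - x)
    simpa using this
  have h2 := hC ‖t - x‖ (norm_nonneg _)
  have h3 : l₀ * ω ‖x‖ ≤ l₀ * (K * (1 + ω ‖t‖ + ω ‖t - x‖)) := by gcongr
  nlinarith

/-- Decay in x comes from the weighted `L¹` bound on f, as the window forces t to be near x. Decay
in ξ comes from the sup bound on the Fourier transform through `gaussMass_mul_stft`. -/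
lemma exists_stft_le (hω : IsWeight ω) (N : ℕ) {l₀ : ℝ} (hl₀ : 0 ≤ l₀) :
    ∃ l C : ℝ, 0 ≤ C ∧ ∀ f : E N → ℂ, RapidDecay ω f → ∀ M, DecayBound ω l M f → ∀ x ξ,
      Real.exp (l₀ * ω ‖x‖) * ‖stft f x ξ‖ ≤ C * M ∧
      Real.exp (l₀ * ω ‖ξ‖) * ‖stft f x ξ‖ ≤ C * M := by
  obtain ⟨l, A, hl, hA⟩ := hω.exists_shift_le N hl₀
  set G := ∫ v : E N, Real.exp (-(1 / 4 * ‖v‖ ^ 2)) with hG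
  have hGi : Integrable fun v : E N => Real.exp (-(1 / 4 * ‖v‖ ^ 2)) :=
    integrable_exp_neg_mul_sq_norm (by norm_num)
  have hG0 : 0 ≤ G := integral_nonneg fun v => (Real.exp_pos _).le
  have hκ : 0 < ‖gaussMass N‖ := norm_pos_iff.2 (gaussMass_ne_zero N)
  refine ⟨l, Real.exp A + Real.exp A * G / ‖gaussMass N‖, by positivity,
    fun f hf M hM x ξ => ⟨?_, ?_⟩⟩
  · have hM0 := hM.nonneg
    have h1 : Real.exp (l₀ * ω ‖x‖) * ‖stft f x ξ‖ ≤ Real.exp A * M := by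
      calc Real.exp (l₀ * ω ‖x‖) * ‖stft f x ξ‖
          ≤ Real.exp (l₀ * ω ‖x‖) * ∫ t, ‖f t * window x t‖ := by
            gcongr; exact norm_ultraFourier_le _ _
        _ = ∫ t, Real.exp (l₀ * ω ‖x‖) * ‖f t * window x t‖ := (integral_const_mul _ _).symm
        _ ≤ ∫ t, Real.exp A * (Real.exp (l * ω ‖t‖) * ‖f t‖) := by
            refine integral_mono ((integrable_mul_window hf.integrable x).norm.const_mul _)
              ((hf.integrable_exp l).const_mul _) fun t => ?_
            simp only
            rw [norm_mul, Complex.norm_real, Real.norm_of_nonneg (window_pos x t).le, window]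
            have h2 : Real.exp (l₀ * ω ‖x‖) * Real.exp (-(1 / 2 * ‖t - x‖ ^ 2)) ≤
                Real.exp A * Real.exp (l * ω ‖t‖) := by
              rw [← Real.exp_add, ← Real.exp_add]
              refine Real.exp_le_exp.2 ?_
              nlinarith [hA x t, sq_nonneg ‖t - x‖]
            calc _ = (Real.exp (l₀ * ω ‖x‖) * Real.exp (-(1 / 2 * ‖t - x‖ ^ 2))) * ‖f t‖ := by ring
              _ ≤ (Real.exp A * Real.exp (l * ω ‖t‖)) * ‖f t‖ := by gcongr
              _ = _ := by ring
        _ = Real.exp A * ∫ t, Real.exp (l * ω ‖t‖) * ‖f t‖ := integral_const_mul _ _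
        _ ≤ _ := by gcongr; exact hM.integral_le
    refine h1.trans ?_
    gcongr
    have : 0 ≤ Real.exp A * G / ‖gaussMass N‖ := by positivity
    linarith
  · have hM0 := hM.nonneg
    have h1 : ‖gaussMass N‖ * (Real.exp (l₀ * ω ‖ξ‖) * ‖stft f x ξ‖) ≤ Real.exp A * M * G := by
      calc ‖gaussMass N‖ * (Real.exp (l₀ * ω ‖ξ‖) * ‖stft f x ξ‖)
          = Real.exp (l₀ * ω ‖ξ‖) * ‖gaussMass N * stft f x ξ‖ := by rw [norm_mul]; ring
        _ = ‖∫ η : E N, (Real.exp (l₀ * ω ‖ξ‖) : ℂ) * ((Real.exp (-(1 / 2 * ‖η‖ ^ 2)) : ℂ) *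
              Complex.exp (-(Complex.I * (inner ℝ x η : ℝ))) * ultraFourier f (ξ - η))‖ := by
            rw [gaussMass_mul_stft hf.integrable, integral_const_mul, norm_mul, Complex.norm_real,
              Real.norm_of_nonneg (Real.exp_pos _).le]
        _ ≤ ∫ η : E N, Real.exp A * M * Real.exp (-(1 / 4 * ‖η‖ ^ 2)) := by
            refine norm_integral_le_of_norm_le (hGi.const_mul _)
              (Filter.Eventually.of_forall fun η => ?_)
            rw [norm_mul, norm_mul, norm_mul, Complex.norm_real, Complex.norm_real,
              Real.norm_of_nonneg (Real.exp_pos _).le, Real.norm_of_nonneg (Real.exp_pos _).le]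
            have h3 : ‖Complex.exp (-(Complex.I * (inner ℝ x η : ℝ)))‖ = 1 := by
              simp [Complex.norm_exp]
            rw [h3, mul_one]
            have h2 : Real.exp (l₀ * ω ‖ξ‖) * Real.exp (-(1 / 2 * ‖η‖ ^ 2)) ≤
                Real.exp A * Real.exp (-(1 / 4 * ‖η‖ ^ 2)) * Real.exp (l * ω ‖ξ - η‖) := by
              rw [← Real.exp_add, ← Real.exp_add, ← Real.exp_add]
              refine Real.exp_le_exp.2 ?_
              have := hA ξ (ξ - η)
              rw [sub_sub_cancel_left, norm_neg] at this
              linarith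
            calc _ = (Real.exp (l₀ * ω ‖ξ‖) * Real.exp (-(1 / 2 * ‖η‖ ^ 2))) *
                    ‖ultraFourier f (ξ - η)‖ := by ring
              _ ≤ (Real.exp A * Real.exp (-(1 / 4 * ‖η‖ ^ 2)) * Real.exp (l * ω ‖ξ - η‖)) *
                    ‖ultraFourier f (ξ - η)‖ := by gcongr
              _ = Real.exp A * Real.exp (-(1 / 4 * ‖η‖ ^ 2)) *
                    (Real.exp (l * ω ‖ξ - η‖) * ‖ultraFourier f (ξ - η)‖) := by ring
              _ ≤ Real.exp A * Real.exp (-(1 / 4 * ‖η‖ ^ 2)) * M := by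
                  gcongr; exact hM.fourier_le _
              _ = _ := by ring
        _ = Real.exp A * M * G := integral_const_mul _ _
    have h4 : Real.exp (l₀ * ω ‖ξ‖) * ‖stft f x ξ‖ ≤ Real.exp A * G / ‖gaussMass N‖ * M := by
      rw [div_mul_eq_mul_div, le_div_iff₀ hκ]
      linarith
    refine h4.trans ?_
    gcongr
    have := Real.exp_pos A
    linarith

lemma exists_stft_le_mul (hω : IsWeight ω) (N : ℕ) {l₀ : ℝ} (hl₀ : 0 ≤ l₀) :
    ∃ l C : ℝ, 0 ≤ C ∧ ∀ f : E N → ℂ, RapidDecay ω f → ∀ M, DecayBound ω l M f → ∀ x ξ,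
      Real.exp (l₀ * ω ‖x‖ + l₀ * ω ‖ξ‖) * ‖stft f x ξ‖ ≤ C * M := by
  -- With 2l₀ available in each variable separately, the bound for the variable of larger weight
  -- controls the sum of both exponents.
  obtain ⟨l, C, hC, h⟩ := exists_stft_le hω N (l₀ := 2 * l₀) (by positivity)
  refine ⟨l, C, hC, fun f hf M hM x ξ => ?_⟩
  obtain ⟨h1, h2⟩ := h f hf M hM x ξ
  rcases le_total (ω ‖x‖) (ω ‖ξ‖) with hle | hle
  · refine le_trans ?_ h2
    gcongr
    nlinarith
  · refine le_trans ?_ h1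
    gcongr
    nlinarith

end

/-! ### Reconstruction as a superposition of exponentials, and bounds on all derivatives -/

section

variable {ω : ℝ → ℝ} {N : ℕ}

/-! ### Reconstruction of a function from its short-time Fourier transform -/

/-- The exponents `i ξ_j + s_j`. -/
def stftExponent (z : E N × E N) (i : Fin N) : ℂ := Complex.I * (z.1 i : ℂ) + (z.2 i : ℂ)

/-- The normalizing constant in the reconstruction of a function. -/
def stftConst (N : ℕ) : ℂ := ((2 * Real.pi) ^ N * gaussMass N)⁻¹

/-- The coefficient of the exponential with exponents `i ξ_j + s_j` in the reconstruction of `f`. -/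
def stftCoeff (f : E N → ℂ) (x : E N) (z : E N × E N) : ℂ :=
  stftConst N * (stft f x z.1 *
    (Real.exp (-(1 / 2 * ‖z.2‖ ^ 2) - inner ℝ x z.2) : ℂ))

lemma inner_eq_sum (x y : E N) : inner ℝ x y = ∑ i, x i * y i := by
  simp [PiLp.inner_apply, mul_comm]

lemma linForm_stftExponent (z : E N × E N) (t : E N) :
    linForm (stftExponent z) t = Complex.I * (inner ℝ z.1 t : ℝ) + (inner ℝ t z.2 : ℝ) := by
  rw [linForm_apply, inner_eq_sum, inner_eq_sum]
  push_cast
  rw [Finset.mul_sum, ← Finset.sum_add_distrib]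
  refine Finset.sum_congr rfl fun i _ => ?_
  simp only [stftExponent]
  ring

lemma norm_stftExponent_le (z : E N × E N) (i : Fin N) :
    ‖stftExponent z i‖ ≤ ‖z.1‖ + ‖z.2‖ := by
  refine (norm_add_le _ _).trans ?_
  rw [norm_mul, Complex.norm_I, one_mul, Complex.norm_real, Complex.norm_real]
  exact add_le_add (abs_apply_le_norm z.1 i) (abs_apply_le_norm z.2 i)

lemma norm_stftCoeff (f : E N → ℂ) (x : E N) (z : E N × E N) :
    ‖stftCoeff f x z‖ = ‖stftConst N‖ *
      (‖stft f x z.1‖ * Real.exp (-(1 / 2 * ‖z.2‖ ^ 2) - inner ℝ x z.2)) := by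
  rw [stftCoeff, norm_mul, norm_mul, Complex.norm_real, Real.norm_of_nonneg (Real.exp_pos _).le]

lemma continuous_stft {f : E N → ℂ} (hf : Integrable f) (x : E N) : Continuous (stft f x) :=
  continuous_ultraFourier (integrable_mul_window hf x)

lemma integrable_pow_mul_stft (hω : IsWeight ω) {f : E N → ℂ} (hf : RapidDecay ω f) (x : E N)
    (n : ℕ) : Integrable fun ξ => (1 + ‖ξ‖) ^ n * ‖stft f x ξ‖ := by
  obtain ⟨c, hc, hpow⟩ := hω.exists_one_add_le_exp
  obtain ⟨k, hk, hint⟩ := hω.exists_integrable_exp_neg N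
  obtain ⟨l, C, hC, h⟩ := exists_stft_le hω N (l₀ := c * n + k) (by positivity)
  obtain ⟨M, hM⟩ := hf.exists_decayBound l
  have hM0 := hM.nonneg
  refine ((hint k le_rfl).const_mul (Real.exp (c * n) * (C * M))).mono'
    (Continuous.aestronglyMeasurable ?_) (Filter.Eventually.of_forall fun ξ => ?_)
  · have := continuous_stft hf.integrable x
    fun_prop
  · rw [Real.norm_of_nonneg (by positivity)]
    have h1 := (h f hf M hM x ξ).2
    have h2 : (1 + ‖ξ‖) ^ n ≤ Real.exp (c * n) * Real.exp (-(k * ω ‖ξ‖)) *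
        Real.exp ((c * n + k) * ω ‖ξ‖) := by
      rw [← Real.exp_add, ← Real.exp_add]
      calc _ ≤ Real.exp (c * (1 + ω ‖ξ‖)) ^ n := by gcongr; exact hpow _ (norm_nonneg _)
        _ = _ := by rw [← Real.exp_nat_mul]; congr 1; ring
    calc _ ≤ (Real.exp (c * n) * Real.exp (-(k * ω ‖ξ‖)) * Real.exp ((c * n + k) * ω ‖ξ‖)) *
            ‖stft f x ξ‖ := by gcongr
      _ = Real.exp (c * n) * Real.exp (-(k * ω ‖ξ‖)) *
            (Real.exp ((c * n + k) * ω ‖ξ‖) * ‖stft f x ξ‖) := by ring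
      _ ≤ Real.exp (c * n) * Real.exp (-(k * ω ‖ξ‖)) * (C * M) := by gcongr
      _ = _ := by ring

lemma integrable_pow_mul_gauss (n : ℕ) (A : ℝ) :
    Integrable fun s : E N => (1 + ‖s‖) ^ n * Real.exp (-(1 / 2 * ‖s‖ ^ 2) + A * ‖s‖) := by
  obtain ⟨C, hC, h⟩ := exists_gauss_exp_le n A
  refine ((integrable_exp_neg_mul_sq_norm (by norm_num : (0 : ℝ) < 1 / 4)).const_mul C).mono'
    (Continuous.aestronglyMeasurable (by fun_prop)) (Filter.Eventually.of_forall fun s => ?_)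
  rw [Real.norm_of_nonneg (by positivity)]
  exact h _ (norm_nonneg s)

/-- The real parts of the exponents involve only s, so the exponential growth is absorbed by the
Gaussian in s. The frequency ξ enters only through powers, which the short-time transform absorbs.
-/
lemma expAdmissible_stft (hω : IsWeight ω) {f : E N → ℂ} (hf : RapidDecay ω f) (x : E N) :
    ExpAdmissible ((volume : Measure (E N)).prod (volume : Measure (E N))) (stftCoeff f x)
      stftExponent := by
  have hcoeff : Continuous (stftCoeff f x) := by
    have := continuous_stft hf.integrable x
    unfold stftCoeff
    fun_prop
  have hexp : ∀ i : Fin N, Continuous fun z : E N × E N => stftExponent z i := fun i => by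
    unfold stftExponent
    fun_prop
  refine ⟨hcoeff.aestronglyMeasurable, fun i => (hexp i).aestronglyMeasurable, fun R n => ?_⟩
  have hint := ((integrable_pow_mul_stft hω hf x n).mul_prod
    (integrable_pow_mul_gauss (N := N) n (‖x‖ + |R| * N))).const_mul
    (‖stftConst N‖ * N ^ n)
  refine hint.mono' (Continuous.aestronglyMeasurable ?_) (Filter.Eventually.of_forall fun z => ?_)
  · refine (hcoeff.norm.mul ((continuous_finsetSum _ fun i _ => (hexp i).norm).pow n)).mul
      (Real.continuous_exp.comp (continuous_const.mul (continuous_finsetSum _ fun i _ =>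
        (Complex.continuous_re.comp (hexp i)).abs)))
  · rw [Real.norm_of_nonneg (by positivity), norm_stftCoeff]
    have h1 : ∑ i, ‖stftExponent z i‖ ≤ N * ((1 + ‖z.1‖) * (1 + ‖z.2‖)) := by
      refine (Finset.sum_le_card_nsmul _ _ (‖z.1‖ + ‖z.2‖)
        fun i _ => norm_stftExponent_le z i).trans ?_
      rw [Finset.card_univ, Fintype.card_fin, nsmul_eq_mul]
      gcongr
      nlinarith [norm_nonneg z.1, norm_nonneg z.2]
    have h2 : ∑ i, |(stftExponent z i).re| ≤ N * ‖z.2‖ := by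
      refine (Finset.sum_le_card_nsmul _ _ ‖z.2‖ fun i _ => ?_).trans ?_
      · simpa [stftExponent] using abs_apply_le_norm z.2 i
      · rw [Finset.card_univ, Fintype.card_fin, nsmul_eq_mul]
    have h3 : R * ∑ i, |(stftExponent z i).re| ≤ |R| * N * ‖z.2‖ := by
      calc _ ≤ |R| * ∑ i, |(stftExponent z i).re| := by
            gcongr; exact le_abs_self R
        _ ≤ |R| * (N * ‖z.2‖) := by gcongr
        _ = _ := by ring
    have h4 : -inner ℝ x z.2 ≤ ‖x‖ * ‖z.2‖ :=
      (neg_le_abs _).trans (abs_real_inner_le_norm x z.2)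
    have h5 : Real.exp (-(1 / 2 * ‖z.2‖ ^ 2) - inner ℝ x z.2) *
        Real.exp (R * ∑ i, |(stftExponent z i).re|) ≤
        Real.exp (-(1 / 2 * ‖z.2‖ ^ 2) + (‖x‖ + |R| * N) * ‖z.2‖) := by
      rw [← Real.exp_add]
      refine Real.exp_le_exp.2 ?_
      linarith
    set κ := ‖stftConst N‖
    calc _ = κ * ‖stft f x z.1‖ * (∑ i, ‖stftExponent z i‖) ^ n *
          (Real.exp (-(1 / 2 * ‖z.2‖ ^ 2) - inner ℝ x z.2) *
            Real.exp (R * ∑ i, |(stftExponent z i).re|)) := by ring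
      _ ≤ κ * ‖stft f x z.1‖ * (N * ((1 + ‖z.1‖) * (1 + ‖z.2‖))) ^ n *
          Real.exp (-(1 / 2 * ‖z.2‖ ^ 2) + (‖x‖ + |R| * N) * ‖z.2‖) := by gcongr
      _ = _ := by rw [mul_pow, mul_pow]; ring

/-- Multiply and divide by the window: the product f w_x is recovered by Fourier inversion in ξ, and
1/w_x is a Gaussian integral of exp(⟨t-x,s⟩). The product of the two is an integral over pairs (ξ,
s). The centre x is arbitrary, so it can later be taken to be the point where derivatives are
evaluated. -/
lemma eq_expInt_stft (hω : IsWeight ω) {f : E N → ℂ} (hf : RapidDecay ω f) (x : E N) :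
    f = expInt ((volume : Measure (E N)).prod (volume : Measure (E N))) (stftCoeff f x)
      stftExponent := by
  funext t
  have hw : Integrable (ultraFourier fun t => f t * window x t) := by
    have h0 := integrable_pow_mul_stft hω hf x 0
    simp only [pow_zero, one_mul] at h0
    exact (integrable_norm_iff (continuous_stft hf.integrable x).aestronglyMeasurable).1 h0
  have h1 := ultraFourier_inversion (f := fun t => f t * window x t)
    (hf.continuous.mul (Complex.continuous_ofReal.comp (continuous_window x)))
    (integrable_mul_window hf.integrable x) hw t
  have h2 := integral_gauss_mul_exp 1 (t - x)
  have h3 := integral_prod_mul (μ := (volume : Measure (E N))) (ν := (volume : Measure (E N)))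
    (fun ξ => Complex.exp (Complex.I * (inner ℝ ξ t : ℝ)) * stft f x ξ)
    (fun s => (Real.exp (-(1 / 2 * ‖s‖ ^ 2)) : ℂ) *
      Complex.exp (1 * (inner ℝ (t - x) s : ℝ)))
  rw [h2] at h3
  simp only [stft] at h3
  rw [h1] at h3
  have h4 : ∀ z : E N × E N, stftCoeff f x z * Complex.exp (linForm (stftExponent z) t) =
      stftConst N *
      ((Complex.exp (Complex.I * (inner ℝ z.1 t : ℝ)) * stft f x z.1) *
      ((Real.exp (-(1 / 2 * ‖z.2‖ ^ 2)) : ℂ) * Complex.exp (1 * (inner ℝ (t - x) z.2 : ℝ)))) := by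
    intro z
    rw [stftCoeff, linForm_stftExponent, Complex.exp_add]
    have : (Real.exp (-(1 / 2 * ‖z.2‖ ^ 2) - inner ℝ x z.2) : ℂ) *
        Complex.exp (inner ℝ t z.2 : ℝ) = (Real.exp (-(1 / 2 * ‖z.2‖ ^ 2)) : ℂ) *
        Complex.exp (1 * (inner ℝ (t - x) z.2 : ℝ)) := by
      rw [Complex.ofReal_exp, Complex.ofReal_exp, ← Complex.exp_add, ← Complex.exp_add,
        inner_sub_left]
      congr 1
      push_cast
      ring
    linear_combination (stftConst N * stft f x z.1 *
      Complex.exp (Complex.I * (inner ℝ z.1 t : ℝ))) * this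
  simp only [expInt, h4]
  rw [integral_const_mul]
  simp only [stft]
  rw [h3]
  have h5 : (window x t : ℂ) * Complex.exp (1 ^ 2 * ‖t - x‖ ^ 2 / 2) = 1 := by
    rw [window, Complex.ofReal_exp, ← Complex.exp_add]
    convert Complex.exp_zero using 2
    push_cast
    ring
  have h6 : stftConst N * ((2 * Real.pi) ^ N * gaussMass N) = 1 :=
    inv_mul_cancel₀ (mul_ne_zero (by simp [Real.pi_ne_zero]) (gaussMass_ne_zero N))
  linear_combination (-(f t * ((window x t : ℂ) * Complex.exp (1 ^ 2 * ‖t - x‖ ^ 2 / 2)))) * h6 -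
    f t * h5

/-- The derivatives of a function that decays rapidly together with its Fourier transform. -/
theorem exists_mderiv_le (hω : IsWeight ω) (N : ℕ) {m m₂ : ℝ} (hm : 0 < m) (hm₂ : 0 ≤ m₂) :
    ∃ l C : ℝ, 0 ≤ C ∧ ∀ f : E N → ℂ, RapidDecay ω f → ∀ M, DecayBound ω l M f →
      ∀ (α : MultiIndex N) x, 2 ^ order α * invWeight ω m (order α) *
        (Real.exp (m₂ * ω ‖x‖) * ‖mderiv α f x‖) ≤ C * M := by
  obtain ⟨K, hK, hadd⟩ := hω.exists_add_le
  obtain ⟨K₂, hK₂, hscale⟩ := hω.exists_scale_le (zero_le_two)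
  obtain ⟨k, hk, hint⟩ := hω.exists_integrable_exp_neg N
  set A := m * K * (1 + 2 * K₂) with hA
  have hA0 : 0 ≤ A := by positivity
  -- The factor 2 inside ω is what yields the gain 2^{|α|}: Young's inequality will be used at r =
  -- 2(‖ξ‖ + ‖s‖).
  have hωA : ∀ a b, 0 ≤ a → 0 ≤ b → m * ω (2 * (a + b)) ≤ A * (1 + ω a + ω b) := by
    intro a b ha hb
    have h1 := hadd (2 * a) (2 * b) (by positivity) (by positivity)
    have h2 := hscale a ha
    have h3 := hscale b hb
    have h4 := hω.nonneg a ha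
    have h5 := hω.nonneg b hb
    rw [mul_add, hA, mul_assoc, mul_assoc]
    refine mul_le_mul_of_nonneg_left (h1.trans ?_) hm.le
    refine mul_le_mul_of_nonneg_left ?_ (by positivity)
    nlinarith
  obtain ⟨B, hB⟩ := hω.exists_linear_le_sq A hA0 (by norm_num : (0 : ℝ) < 1 / 4) 0
  -- In x the exponent m₂ is needed. In ξ, A pays for the monomial and k leaves an integrable factor
  -- exp(-kω(ξ)).
  obtain ⟨l, C, hC, h⟩ := exists_stft_le_mul hω N (l₀ := max m₂ (A + k))
    (le_max_of_le_left hm₂)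
  set κ := ‖stftConst N‖ with hκ
  set I₁ := ∫ ξ : E N, Real.exp (-(k * ω ‖ξ‖))
  set I₂ := ∫ s : E N, Real.exp (-(1 / 4 * ‖s‖ ^ 2))
  have hI₁ : 0 ≤ I₁ := integral_nonneg fun _ => (Real.exp_pos _).le
  have hI₂ : 0 ≤ I₂ := integral_nonneg fun _ => (Real.exp_pos _).le
  set D := Real.exp (m * ω 1 + A + B) with hD
  refine ⟨l, κ * C * D * (I₁ * I₂), by positivity, fun f hf M hM α x => ?_⟩
  have hM0 := hM.nonneg
  have hmd : mderiv α f x = ∫ z : E N × E N, stftCoeff f x z * (∏ i, stftExponent z i ^ α i) *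
      Complex.exp (linForm (stftExponent z) x) ∂(volume.prod volume) := by
    conv_lhs => rw [eq_expInt_stft hω hf x]
    rw [(expAdmissible_stft hω hf x).mderiv_expInt α]
    rfl
  set w := 2 ^ order α * invWeight ω m (order α) * Real.exp (m₂ * ω ‖x‖) with hw
  have hw0 : 0 ≤ w := by
    have := invWeight_nonneg (ω := ω) (m := m) (order α)
    positivity
  have hdom : ∀ z : E N × E N, ‖(w : ℂ) * (stftCoeff f x z * (∏ i, stftExponent z i ^ α i) *
      Complex.exp (linForm (stftExponent z) x))‖ ≤
      κ * C * D * M * (Real.exp (-(k * ω ‖z.1‖)) * Real.exp (-(1 / 4 * ‖z.2‖ ^ 2))) := by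
    intro z
    set ρ := ‖z.1‖ + ‖z.2‖ with hρ
    have hρ0 : 0 ≤ ρ := by positivity
    have hprod : ‖∏ i, stftExponent z i ^ α i‖ ≤ ρ ^ order α := by
      rw [norm_prod, order, ← Finset.prod_pow_eq_pow_sum]
      refine Finset.prod_le_prod (fun i _ => norm_nonneg _) fun i _ => ?_
      rw [norm_pow]
      gcongr
      exact norm_stftExponent_le z i
    -- Centre and evaluation point coincide, so exp(-⟨x,s⟩) in the coefficient cancels exp(⟨x,s⟩),
    -- and the bound is uniform in x.
    have hexp : ‖stftCoeff f x z‖ * ‖Complex.exp (linForm (stftExponent z) x)‖ =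
        κ * (‖stft f x z.1‖ * Real.exp (-(1 / 2 * ‖z.2‖ ^ 2))) := by
      rw [norm_stftCoeff, linForm_stftExponent, Complex.norm_exp]
      have h2 : (Complex.I * (inner ℝ z.1 x : ℝ) + (inner ℝ x z.2 : ℝ) : ℂ).re =
          inner ℝ x z.2 := by simp
      rw [h2, mul_assoc, mul_assoc, ← Real.exp_add]
      congr 3
      ring_nf
    -- Young's inequality is available only for r ≥ 1, hence the maximum with 1 and the extra term m
    -- ω(1).
    have hpow : 2 ^ order α * ρ ^ order α * invWeight ω m (order α) ≤
        Real.exp (m * ω 1 + A * (1 + ω ‖z.1‖ + ω ‖z.2‖)) := by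
      have h1 := pow_mul_invWeight_le (ω := ω) hm (order α) (le_max_left 1 (2 * ρ))
      have h2 : ω (max 1 (2 * ρ)) ≤ ω 1 + ω (2 * ρ) := by
        have := hω.nonneg 1 zero_le_one
        have := hω.nonneg (2 * ρ) (by positivity)
        rcases le_total 1 (2 * ρ) with h | h
        · rw [max_eq_right h]; linarith
        · rw [max_eq_left h]; linarith
      calc _ = (2 * ρ) ^ order α * invWeight ω m (order α) := by rw [mul_pow]
        _ ≤ max 1 (2 * ρ) ^ order α * invWeight ω m (order α) := by
            have := invWeight_nonneg (ω := ω) (m := m) (order α)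
            gcongr
            exact le_max_right _ _
        _ ≤ _ := h1
        _ ≤ _ := by
            refine Real.exp_le_exp.2 ?_
            have h3 := hωA ‖z.1‖ ‖z.2‖ (norm_nonneg _) (norm_nonneg _)
            have h4 : m * ω (max 1 (2 * ρ)) ≤ m * (ω 1 + ω (2 * ρ)) := by gcongr
            linarith
    have hstft := h f hf M hM x z.1
    have h0 := hω.nonneg ‖x‖ (norm_nonneg x)
    have h1 := hω.nonneg ‖z.1‖ (norm_nonneg _)
    have hwt : Real.exp (m₂ * ω ‖x‖) * Real.exp (m * ω 1 + A * (1 + ω ‖z.1‖ + ω ‖z.2‖)) *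
        Real.exp (-(1 / 2 * ‖z.2‖ ^ 2)) ≤ D * (Real.exp (-(k * ω ‖z.1‖)) *
          Real.exp (-(1 / 4 * ‖z.2‖ ^ 2))) *
          Real.exp (max m₂ (A + k) * ω ‖x‖ + max m₂ (A + k) * ω ‖z.1‖) := by
      rw [hD, ← Real.exp_add, ← Real.exp_add, ← Real.exp_add, ← Real.exp_add, ← Real.exp_add]
      refine Real.exp_le_exp.2 ?_
      have h2 : m₂ * ω ‖x‖ ≤ max m₂ (A + k) * ω ‖x‖ := by gcongr; exact le_max_left _ _
      have h3 : (A + k) * ω ‖z.1‖ ≤ max m₂ (A + k) * ω ‖z.1‖ := by gcongr; exact le_max_right _ _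
      have h4 := hB ‖z.2‖ (norm_nonneg _)
      linarith
    rw [norm_mul, norm_mul, norm_mul, Complex.norm_real, Real.norm_of_nonneg hw0]
    have hiw := invWeight_nonneg (ω := ω) (m := m) (order α)
    calc _ = w * ‖∏ i, stftExponent z i ^ α i‖ * (‖stftCoeff f x z‖ *
            ‖Complex.exp (linForm (stftExponent z) x)‖) := by ring
      _ ≤ w * ρ ^ order α * (‖stftCoeff f x z‖ *
            ‖Complex.exp (linForm (stftExponent z) x)‖) := by gcongr
      _ = (2 ^ order α * ρ ^ order α * invWeight ω m (order α)) * Real.exp (m₂ * ω ‖x‖) *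
            (κ * (‖stft f x z.1‖ * Real.exp (-(1 / 2 * ‖z.2‖ ^ 2)))) := by
          rw [hexp, hw]; ring
      _ ≤ Real.exp (m * ω 1 + A * (1 + ω ‖z.1‖ + ω ‖z.2‖)) * Real.exp (m₂ * ω ‖x‖) *
            (κ * (‖stft f x z.1‖ * Real.exp (-(1 / 2 * ‖z.2‖ ^ 2)))) := by gcongr
      _ = (Real.exp (m₂ * ω ‖x‖) * Real.exp (m * ω 1 + A * (1 + ω ‖z.1‖ + ω ‖z.2‖)) *
            Real.exp (-(1 / 2 * ‖z.2‖ ^ 2))) * (κ * ‖stft f x z.1‖) := by ring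
      _ ≤ (D * (Real.exp (-(k * ω ‖z.1‖)) * Real.exp (-(1 / 4 * ‖z.2‖ ^ 2))) *
            Real.exp (max m₂ (A + k) * ω ‖x‖ + max m₂ (A + k) * ω ‖z.1‖)) *
            (κ * ‖stft f x z.1‖) := by gcongr
      _ = κ * D * (Real.exp (-(k * ω ‖z.1‖)) * Real.exp (-(1 / 4 * ‖z.2‖ ^ 2))) *
            (Real.exp (max m₂ (A + k) * ω ‖x‖ + max m₂ (A + k) * ω ‖z.1‖) *
              ‖stft f x z.1‖) := by ring
      _ ≤ κ * D * (Real.exp (-(k * ω ‖z.1‖)) * Real.exp (-(1 / 4 * ‖z.2‖ ^ 2))) * (C * M) := by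
          gcongr
      _ = _ := by ring
  calc 2 ^ order α * invWeight ω m (order α) * (Real.exp (m₂ * ω ‖x‖) * ‖mderiv α f x‖)
      = ‖(w : ℂ) * mderiv α f x‖ := by
        rw [norm_mul, Complex.norm_real, Real.norm_of_nonneg hw0, hw]; ring
    _ ≤ ∫ z : E N × E N, κ * C * D * M * (Real.exp (-(k * ω ‖z.1‖)) *
          Real.exp (-(1 / 4 * ‖z.2‖ ^ 2))) ∂(volume.prod volume) := by
        rw [hmd, ← integral_const_mul]
        exact norm_integral_le_of_norm_le (((hint k le_rfl).mul_prod
          (integrable_exp_neg_mul_sq_norm (by norm_num))).const_mul _)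
          (Filter.Eventually.of_forall hdom)
    _ = κ * C * D * (I₁ * I₂) * M := by
        have h1 := integral_prod_mul (μ := (volume : Measure (E N))) (ν := (volume : Measure (E N)))
          (fun ξ : E N => Real.exp (-(k * ω ‖ξ‖))) (fun s : E N => Real.exp (-(1 / 4 * ‖s‖ ^ 2)))
        rw [integral_const_mul, h1]
        ring

lemma RapidDecay.contDiff (hω : IsWeight ω) {f : E N → ℂ} (hf : RapidDecay ω f) :
    ContDiff ℝ (⊤ : ℕ∞) f := by
  rw [eq_expInt_stft hω hf 0]
  exact (expAdmissible_stft hω hf 0).contDiff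

end

/-! ### From derivatives back to Fourier decay; decay bounds as a description of `S` -/

section

variable {ω : ℝ → ℝ} {N : ℕ}

/-! ### Pure derivatives, supports and integration by parts -/

lemma mderiv_zero_index (f : E N → ℂ) : mderiv (0 : MultiIndex N) f = f := by
  have : ∀ L : List (Fin N),
      L.foldr (fun i g => (pderiv i)^[(0 : MultiIndex N) i] g) f = f := by
    intro L
    induction L with
    | nil => rfl
    | cons i L ih => simp
  exact this _

lemma order_zero : order (0 : MultiIndex N) = 0 := by simp [order]

lemma order_single (j : Fin N) (k : ℕ) : order (Pi.single j k : MultiIndex N) = k := by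
  simp [order]

lemma mderiv_single (j : Fin N) (k : ℕ) (f : E N → ℂ) :
    mderiv (Pi.single j k : MultiIndex N) f = (pderiv j)^[k] f := by
  have : ∀ L : List (Fin N), L.Nodup →
      L.foldr (fun i g => (pderiv i)^[(Pi.single j k : MultiIndex N) i] g) f =
        if j ∈ L then (pderiv j)^[k] f else f := by
    intro L hL
    induction L with
    | nil => simp
    | cons i L ih =>
      rw [List.nodup_cons] at hL
      rw [List.foldr_cons, ih hL.2]
      by_cases hij : i = j
      · subst hij
        simp [hL.1]
      · have : ¬ j = i := fun h => hij h.symm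
        simp [hij, this]
  rw [mderiv, this _ (List.nodup_finRange N)]
  simp

lemma tsupport_pderiv_subset (i : Fin N) (f : E N → ℂ) : tsupport (pderiv i f) ⊆ tsupport f :=
  tsupport_fderiv_apply_subset ℝ _

lemma tsupport_iterate_pderiv_subset (i : Fin N) (k : ℕ) (f : E N → ℂ) :
    tsupport ((pderiv i)^[k] f) ⊆ tsupport f := by
  induction k with
  | zero => exact subset_rfl
  | succ k ih =>
    rw [Function.iterate_succ_apply']
    exact (tsupport_pderiv_subset i _).trans ih

lemma tsupport_mderiv_subset (α : MultiIndex N) (f : E N → ℂ) :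
    tsupport (mderiv α f) ⊆ tsupport f := by
  have : ∀ L : List (Fin N),
      tsupport (L.foldr (fun i g => (pderiv i)^[α i] g) f) ⊆ tsupport f := by
    intro L
    induction L with
    | nil => exact subset_rfl
    | cons i L ih => exact (tsupport_iterate_pderiv_subset i _ _).trans ih
  exact this _

lemma hasCompactSupport_mderiv (α : MultiIndex N) {f : E N → ℂ} (hf : HasCompactSupport f) :
    HasCompactSupport (mderiv α f) :=
  hf.of_isClosed_subset (isClosed_tsupport _) (tsupport_mderiv_subset α f)

lemma ultraFourier_pderiv {f : E N → ℂ} (hf : ContDiff ℝ (⊤ : ℕ∞) f) (hs : HasCompactSupport f)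
    (j : Fin N) (ξ : E N) :
    ultraFourier (pderiv j f) ξ = Complex.I * (ξ j : ℂ) * ultraFourier f ξ := by
  have hint : Integrable f := hf.continuous.integrable_of_hasCompactSupport hs
  have hint' : Integrable (pderiv j f) :=
    (pderiv_contDiff j hf).continuous.integrable_of_hasCompactSupport
      (hs.of_isClosed_subset (isClosed_tsupport _) (tsupport_pderiv_subset j f))
  have hd : ∀ x : E N, HasFDerivAt
      (fun x : E N => Complex.exp (-(Complex.I * (inner ℝ x ξ : ℝ))))
      (Complex.exp (-(Complex.I * (inner ℝ x ξ : ℝ))) •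
        ((-Complex.I) • (Complex.ofRealCLM.comp (innerSL ℝ ξ)))) x := by
    intro x
    have h1 : HasFDerivAt (fun x : E N => -(Complex.I * (inner ℝ x ξ : ℝ)))
        ((-Complex.I) • (Complex.ofRealCLM.comp (innerSL ℝ ξ))) x := by
      have := ((-Complex.I) • (Complex.ofRealCLM.comp (innerSL ℝ ξ))).hasFDerivAt (x := x)
      refine this.congr_of_eventuallyEq (Filter.Eventually.of_forall fun y => ?_)
      simp [real_inner_comm]
    exact h1.cexp
  have hd' : ∀ x : E N, fderiv ℝ (fun x : E N => Complex.exp (-(Complex.I * (inner ℝ x ξ : ℝ)))) x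
      (EuclideanSpace.single j 1) =
      -(Complex.I * (ξ j : ℂ)) * Complex.exp (-(Complex.I * (inner ℝ x ξ : ℝ))) := by
    intro x
    rw [(hd x).fderiv]
    simp [EuclideanSpace.inner_single_right]
    ring
  have h := integral_mul_fderiv_eq_neg_fderiv_mul_of_integrable (μ := volume)
    (f := fun x : E N => Complex.exp (-(Complex.I * (inner ℝ x ξ : ℝ)))) (g := f)
    (v := EuclideanSpace.single j 1) ?_ (ultraFourier_integrable hint' ξ)
    (ultraFourier_integrable hint ξ) (fun x _ => (hd x).differentiableAt)
    (fun x _ => hf.differentiable (by simp) x)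
  · simp only [hd'] at h
    change ultraFourier (pderiv j f) ξ = _ at h
    rw [h, ultraFourier, ← integral_const_mul, ← integral_neg]
    congr 1
    funext x
    ring
  · simp only [hd', mul_assoc]
    exact (ultraFourier_integrable hint ξ).const_mul _

lemma ultraFourier_iterate_pderiv {f : E N → ℂ} (hf : ContDiff ℝ (⊤ : ℕ∞) f)
    (hs : HasCompactSupport f) (j : Fin N) (k : ℕ) (ξ : E N) :
    ultraFourier ((pderiv j)^[k] f) ξ = (Complex.I * (ξ j : ℂ)) ^ k * ultraFourier f ξ := by
  induction k with
  | zero => simp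
  | succ k ih =>
    rw [Function.iterate_succ_apply', ultraFourier_pderiv ((pderiv_iter j k).1 f hf)
      (hs.of_isClosed_subset (isClosed_tsupport _) (tsupport_iterate_pderiv_subset j k f)), ih]
    ring

/-- Some coordinate carries a fixed fraction of the norm, for otherwise summing over coordinates
contradicts ‖ξ‖ ≤ ∑|ξ_i|. This is why pure derivatives are enough to control the Fourier transform.
-/
lemma exists_norm_le_mul_abs (hN : N ≠ 0) (ξ : E N) : ∃ j, ‖ξ‖ ≤ (N + 1) * |ξ j| := by
  by_contra hcon
  push Not at hcon
  have h1 : ‖ξ‖ ≤ ∑ i, |ξ i| := by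
    have hy : ξ = ∑ i, (ξ i) • EuclideanSpace.single i (1 : ℝ) := by
      ext j
      simp [Pi.single_apply]
    conv_lhs => rw [hy]
    refine (norm_sum_le _ _).trans (le_of_eq ?_)
    refine Finset.sum_congr rfl fun i _ => ?_
    rw [norm_smul]
    simp
  have h2 : (N + 1) * ∑ i, |ξ i| ≤ N * ‖ξ‖ := by
    rw [Finset.mul_sum]
    refine (Finset.sum_le_card_nsmul _ _ ‖ξ‖ fun i _ => (hcon i).le).trans ?_
    simp
  have h3 := hcon ⟨0, Nat.pos_of_ne_zero hN⟩
  have h4 : 0 < ‖ξ‖ := lt_of_le_of_lt (by positivity) h3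
  have h5 : ((N : ℝ) + 1) * ‖ξ‖ ≤ (N + 1) * ∑ i, |ξ i| := by gcongr
  linarith

/-- Decay of the Fourier transform from estimates of the pure derivatives. -/
theorem exists_fourier_le (hω : IsWeight ω) (N : ℕ) {l : ℝ} (hl : 0 ≤ l) :
    ∃ (m : ℕ+) (C : ℝ), 0 ≤ C ∧ ∀ f : E N → ℂ, ContDiff ℝ (⊤ : ℕ∞) f → HasCompactSupport f →
      ∀ M, ∫ x, ‖f x‖ ≤ M →
      (∀ j k, (1 / 2) ^ k * invWeight ω m k * ∫ x, ‖(pderiv j)^[k] f x‖ ≤ M) →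
      ∀ ξ, Real.exp (l * ω ‖ξ‖) * ‖ultraFourier f ξ‖ ≤ C * M := by
  -- N + 1 accounts for the choice of a coordinate, and 2 compensates the factor (1/2)^k in the
  -- hypothesis.
  set R : ℝ := 2 * (N + 1) with hR
  have hR0 : 0 < R := by positivity
  obtain ⟨K, hK, hscale⟩ := hω.exists_scale_le hR0.le
  obtain ⟨c, hc, hpow⟩ := hω.exists_one_add_le_exp
  -- lK pays for replacing ω(‖ξ‖) = ω(Rr) by ω(r), and c for the one spare power of r left by the
  -- discrete biconjugation.
  obtain ⟨n, hn⟩ := exists_nat_ge (l * K + c)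
  refine ⟨⟨n + 1, n.succ_pos⟩, Real.exp (l * ω R) + Real.exp (l * K + c), by positivity,
    fun f hf hs M hM0 hM ξ => ?_⟩
  have hMpos : 0 ≤ M := le_trans (by positivity) hM0
  have h0 : ‖ultraFourier f ξ‖ ≤ M := (norm_ultraFourier_le f ξ).trans hM0
  rcases le_total ‖ξ‖ R with hξ | hξ
  · calc _ ≤ Real.exp (l * ω R) * M := by
          gcongr
          exact hω.mono (norm_nonneg _) hξ
      _ ≤ _ := by
          gcongr
          have := Real.exp_pos (l * K + c)
          linarith
  set m : ℝ := (((⟨n + 1, n.succ_pos⟩ : ℕ+) : ℕ) : ℝ) with hm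
  have hmn : m = n + 1 := by simp [hm]
  have hm0 : 0 < m := by rw [hmn]; positivity
  set r := ‖ξ‖ / R with hr
  have hr1 : 1 ≤ r := by rwa [hr, one_le_div hR0]
  have hξr : ‖ξ‖ = R * r := by rw [hr]; field_simp
  have hN : N ≠ 0 := by
    rintro rfl
    have : ‖ξ‖ = 0 := by
      rw [Subsingleton.elim ξ 0, norm_zero]
    linarith
  obtain ⟨j, hj⟩ := exists_norm_le_mul_abs hN ξ
  have h2r : 2 * r ≤ |ξ j| := by
    rw [hξr, hR] at hj
    have : (0 : ℝ) < N + 1 := by positivity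
    nlinarith
  -- The order of differentiation is chosen according to ξ, which requires the hypothesis to be
  -- uniform in k.
  obtain ⟨k, hk⟩ := exists_one_le_pow_mul_invWeight hω hm0 hr1
  have hiw := invWeight_nonneg (ω := ω) (m := m) k
  have hr0 : 0 ≤ r := by linarith
  have h1 : (2 * r) ^ k * ‖ultraFourier f ξ‖ ≤ ∫ x, ‖(pderiv j)^[k] f x‖ := by
    calc _ ≤ |ξ j| ^ k * ‖ultraFourier f ξ‖ := by gcongr
      _ = ‖ultraFourier ((pderiv j)^[k] f) ξ‖ := by
          rw [ultraFourier_iterate_pderiv hf hs, norm_mul, norm_pow, norm_mul, Complex.norm_I,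
            one_mul, Complex.norm_real, Real.norm_eq_abs]
      _ ≤ _ := norm_ultraFourier_le _ _
  have h2 : r ^ k * invWeight ω m k * ‖ultraFourier f ξ‖ ≤ M := by
    have hMk : (1 / 2) ^ k * invWeight ω m k * ∫ x, ‖(pderiv j)^[k] f x‖ ≤ M := hM j k
    refine le_trans ?_ hMk
    calc _ = (1 / 2) ^ k * invWeight ω m k * ((2 * r) ^ k * ‖ultraFourier f ξ‖) := by
          rw [mul_pow]
          have : ((1 / 2 : ℝ)) ^ k * 2 ^ k = 1 := by rw [← mul_pow]; norm_num
          linear_combination (-(r ^ k * invWeight ω m k * ‖ultraFourier f ξ‖)) * this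
      _ ≤ _ := by gcongr
  have h3 : ‖ultraFourier f ξ‖ ≤ r * Real.exp (-(m * ω r)) * M := by
    calc ‖ultraFourier f ξ‖ = 1 * ‖ultraFourier f ξ‖ := (one_mul _).symm
      _ ≤ (r ^ (k + 1) * Real.exp (-(m * ω r)) * invWeight ω m k) * ‖ultraFourier f ξ‖ := by
          gcongr
      _ = r * Real.exp (-(m * ω r)) * (r ^ k * invWeight ω m k * ‖ultraFourier f ξ‖) := by ring
      _ ≤ _ := by gcongr
  have h4 : Real.exp (l * ω ‖ξ‖) * (r * Real.exp (-(m * ω r))) ≤ Real.exp (l * K + c) := by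
    have h5 : r ≤ Real.exp (c * (1 + ω r)) := le_trans (by linarith) (hpow r hr0)
    have h6 := hω.nonneg r hr0
    calc _ ≤ Real.exp (l * (K * (1 + ω r))) * (Real.exp (c * (1 + ω r)) *
            Real.exp (-(m * ω r))) := by
          gcongr
          rw [hξr]
          exact hscale r hr0
      _ = Real.exp (l * (K * (1 + ω r)) + (c * (1 + ω r) + -(m * ω r))) := by
          rw [Real.exp_add, Real.exp_add]
      _ ≤ _ := by
          refine Real.exp_le_exp.2 ?_
          have h7 : (l * K + c) * ω r ≤ m * ω r := by
            gcongr
            linarith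
          linarith
  calc _ ≤ Real.exp (l * ω ‖ξ‖) * (r * Real.exp (-(m * ω r)) * M) := by gcongr
    _ = Real.exp (l * ω ‖ξ‖) * (r * Real.exp (-(m * ω r))) * M := by ring
    _ ≤ Real.exp (l * K + c) * M := by gcongr
    _ ≤ _ := by
        gcongr
        have := Real.exp_pos (l * ω R)
        linarith

/-! ### Consequences for functions of rapid decay -/

/-- For a single β, take m so large that the weight at order |β| is positive, and divide
`exists_mderiv_le` by it. -/
lemma exists_wsup_le (hω : IsWeight ω) {l : ℝ} (hl : 0 ≤ l) (β : MultiIndex N) :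
    ∃ l' C : ℝ, 0 ≤ C ∧ ∀ f : E N → ℂ, RapidDecay ω f → ∀ M, DecayBound ω l' M f →
      wsup ω l β f ≤ ENNReal.ofReal (C * M) := by
  obtain ⟨m, hm, hpos⟩ := exists_invWeight_pos hω (order β)
  obtain ⟨l', C, hC, h⟩ := exists_mderiv_le hω N hm hl
  have h0 := hpos m le_rfl
  refine ⟨l', C / (2 ^ order β * invWeight ω m (order β)), by positivity,
    fun f hf M hM => iSup_le fun x => ?_⟩
  rw [← ofReal_norm, ← ENNReal.ofReal_mul (norm_nonneg _)]
  refine ENNReal.ofReal_le_ofReal ?_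
  have h1 := h f hf M hM β x
  rw [div_mul_eq_mul_div, le_div_iff₀ (by positivity)]
  linarith

lemma norm_le_of_wsup_le {l M : ℝ} (hM : 0 ≤ M) {β : MultiIndex N} {f : E N → ℂ}
    (h : wsup ω l β f ≤ ENNReal.ofReal M) (x : E N) :
    Real.exp (l * ω ‖x‖) * ‖mderiv β f x‖ ≤ M := by
  have h1 := (le_iSup (fun x => ‖mderiv β f x‖ₑ * ENNReal.ofReal (Real.exp (l * ω ‖x‖))) x).trans h
  rw [← ofReal_norm, ← ENNReal.ofReal_mul (norm_nonneg _),
    ENNReal.ofReal_le_ofReal_iff hM] at h1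
  linarith

/-- Weighted `L¹`-bounds from weighted sup-bounds. -/
lemma exists_integral_exp_le (hω : IsWeight ω) (N : ℕ) :
    ∃ k C : ℝ, 0 < k ∧ 0 ≤ C ∧ ∀ (f : E N → ℂ), Continuous f → ∀ l M : ℝ,
      (∀ x, Real.exp ((l + k) * ω ‖x‖) * ‖f x‖ ≤ M) →
      Integrable (fun x => Real.exp (l * ω ‖x‖) * ‖f x‖) ∧
        ∫ x, Real.exp (l * ω ‖x‖) * ‖f x‖ ≤ C * M := by
  obtain ⟨k, hk, hint⟩ := hω.exists_integrable_exp_neg N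
  refine ⟨k, ∫ x : E N, Real.exp (-(k * ω ‖x‖)), hk,
    integral_nonneg fun _ => (Real.exp_pos _).le, fun f hf l M hM => ?_⟩
  have hle : ∀ x, Real.exp (l * ω ‖x‖) * ‖f x‖ ≤ Real.exp (-(k * ω ‖x‖)) * M := fun x => by
    calc _ = Real.exp (-(k * ω ‖x‖)) * (Real.exp ((l + k) * ω ‖x‖) * ‖f x‖) := by
          rw [← mul_assoc, ← Real.exp_add]
          congr 2
          ring
      _ ≤ _ := by gcongr; exact hM x
  have h1 : Integrable (fun x => Real.exp (l * ω ‖x‖) * ‖f x‖) := by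
    refine ((hint k le_rfl).mul_const M).mono' (Continuous.aestronglyMeasurable ?_)
      (Filter.Eventually.of_forall fun x => ?_)
    · have := hω.continuous_norm (E N)
      exact (Real.continuous_exp.comp (continuous_const.mul this)).mul hf.norm
    · rw [Real.norm_of_nonneg (by positivity)]
      exact hle x
  exact ⟨h1, (integral_mono h1 ((hint k le_rfl).mul_const M) hle).trans
    (le_of_eq (integral_mul_const _ _))⟩

lemma RapidDecay.integrable_ultraFourier (hω : IsWeight ω) {f : E N → ℂ} (hf : RapidDecay ω f) :
    Integrable (ultraFourier f) := by
  obtain ⟨k, C, hk, hC, h⟩ := exists_integral_exp_le hω N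
  obtain ⟨M, hM⟩ := hf.fourier_bdd (0 + k)
  have hc := continuous_ultraFourier hf.integrable
  have h1 := (h _ hc 0 M hM).1
  simp only [zero_mul, Real.exp_zero, one_mul] at h1
  exact (integrable_norm_iff hc.aestronglyMeasurable).1 h1

lemma norm_ultraFourier_ultraFourier (hω : IsWeight ω) {f : E N → ℂ} (hf : RapidDecay ω f)
    (x : E N) : ‖ultraFourier (ultraFourier f) x‖ = (2 * Real.pi) ^ N * ‖f (-x)‖ := by
  rw [ultraFourier_ultraFourier hf.continuous hf.integrable (hf.integrable_ultraFourier hω)]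
  simp [abs_of_pos Real.pi_pos]

/-- Two Fourier transforms give a reflection, so the sup bound needed for the transform of f̂ is a
pointwise bound on f. The `L¹` bound on f̂ follows from its sup bound with a larger exponent. Hence
results for f pass to f̂ without further work. -/
lemma exists_decayBound_ultraFourier (hω : IsWeight ω) (N : ℕ) {l : ℝ} (hl : 0 ≤ l) :
    ∃ l' C : ℝ, 0 ≤ C ∧ ∀ f : E N → ℂ, RapidDecay ω f → ∀ M, DecayBound ω l' M f →
      DecayBound ω l (C * M) (ultraFourier f) := by
  obtain ⟨l₁, C₁, hC₁, h₁⟩ := exists_wsup_le hω hl (0 : MultiIndex N)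
  obtain ⟨k, C₂, hk, hC₂, h₂⟩ := exists_integral_exp_le hω N
  refine ⟨max l₁ (l + k), C₂ + (2 * Real.pi) ^ N * C₁, by positivity, fun f hf M hM => ?_⟩
  have hM0 := hM.nonneg
  refine ⟨?_, fun x => ?_⟩
  · have h := (h₂ _ (continuous_ultraFourier hf.integrable) l M
      (hM.mono hω hf (le_max_right _ _)).fourier_le).2
    refine h.trans ?_
    gcongr
    have : 0 ≤ (2 * Real.pi) ^ N * C₁ := by positivity
    linarith
  · have h := norm_le_of_wsup_le (by positivity)
      (h₁ f hf M (hM.mono hω hf (le_max_left _ _))) (-x)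
    rw [mderiv_zero_index, norm_neg] at h
    rw [norm_ultraFourier_ultraFourier hω hf]
    calc _ = (2 * Real.pi) ^ N * (Real.exp (l * ω ‖x‖) * ‖f (-x)‖) := by ring
      _ ≤ (2 * Real.pi) ^ N * (C₁ * M) := by gcongr
      _ = (2 * Real.pi) ^ N * C₁ * M := by ring
      _ ≤ _ := by
        gcongr
        linarith

lemma RapidDecay.ultraFourier (hω : IsWeight ω) {f : E N → ℂ} (hf : RapidDecay ω f) :
    RapidDecay ω (ultraFourier f) := by
  obtain ⟨k, C, hk, hC, h⟩ := exists_integral_exp_le hω N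
  have hc := continuous_ultraFourier hf.integrable
  refine ⟨hc, fun l => ?_, fun l => ?_⟩
  · obtain ⟨M, hM⟩ := hf.fourier_bdd (l + k)
    exact (h _ hc l M hM).1
  · obtain ⟨l', C, -, h'⟩ := exists_decayBound_ultraFourier hω N (abs_nonneg l)
    obtain ⟨M, hM⟩ := hf.exists_decayBound l'
    refine ⟨C * M, fun ξ => le_trans ?_ ((h' f hf M hM).fourier_le ξ)⟩
    have := hω.nonneg ‖ξ‖ (norm_nonneg _)
    gcongr
    exact le_abs_self l

/-- Every seminorm of `𝒮_ω` is controlled by a decay bound. -/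
lemma exists_wsup_ultraFourier_le (hω : IsWeight ω) {l : ℝ} (hl : 0 ≤ l) (β : MultiIndex N) :
    ∃ l' C : ℝ, 0 ≤ C ∧ ∀ f : E N → ℂ, RapidDecay ω f → ∀ M, DecayBound ω l' M f →
      wsup ω l β (ultraFourier f) ≤ ENNReal.ofReal (C * M) := by
  obtain ⟨l₁, C₁, hC₁, h₁⟩ := exists_wsup_le hω hl β
  obtain ⟨l₂, C₂, hC₂, h₂⟩ := exists_decayBound_ultraFourier hω N (abs_nonneg l₁)
  refine ⟨l₂, C₁ * C₂, by positivity, fun f hf M hM => ?_⟩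
  rw [mul_assoc]
  have hF := hf.ultraFourier hω
  exact h₁ _ hF _ ((h₂ f hf M hM).mono hω hF (le_abs_self _))

/-- Together with `rapidDecay_of_mem_SSub`, this identifies `SSub` with the functions of rapid
decay: smoothness and the conditions on derivatives are automatic. -/
lemma RapidDecay.mem_SSub (hω : IsWeight ω) {f : E N → ℂ} (hf : RapidDecay ω f) :
    f ∈ SSub ω N := by
  refine ⟨hf.integrable, hf.contDiff hω, (hf.ultraFourier hω).contDiff hω, fun l α => ⟨?_, ?_⟩⟩
  · obtain ⟨l', C, -, h⟩ := exists_wsup_le hω (le_of_lt l.2) α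
    obtain ⟨M, hM⟩ := hf.exists_decayBound l'
    exact (h f hf M hM).trans_lt ENNReal.ofReal_lt_top
  · obtain ⟨l', C, -, h⟩ := exists_wsup_ultraFourier_le hω (le_of_lt l.2) α
    obtain ⟨M, hM⟩ := hf.exists_decayBound l'
    exact (h f hf M hM).trans_lt ENNReal.ofReal_lt_top

/-- A decay bound is controlled by two seminorms of `𝒮_ω`. -/
lemma exists_decayBound_of_wsup (hω : IsWeight ω) (N : ℕ) {l : ℝ} (hl : 0 < l) :
    ∃ (l' : Set.Ioi (0 : ℝ)) (C : ℝ), 0 ≤ C ∧ ∀ f : E N → ℂ, Continuous f → ∀ M, 0 ≤ M →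
      wsup ω l' 0 f ≤ ENNReal.ofReal M → wsup ω l' 0 (ultraFourier f) ≤ ENNReal.ofReal M →
      Integrable (fun x => Real.exp (l * ω ‖x‖) * ‖f x‖) ∧ DecayBound ω l (C * M) f := by
  obtain ⟨k, C, hk, hC, h⟩ := exists_integral_exp_le hω N
  refine ⟨⟨l + k, (by positivity : 0 < l + k)⟩, C + 1, by positivity,
    fun f hf M hM h1 h2 => ?_⟩
  have h3 := norm_le_of_wsup_le hM h1
  have h4 := norm_le_of_wsup_le hM h2
  simp only [mderiv_zero_index] at h3 h4
  obtain ⟨h5, h6⟩ := h f hf l M h3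
  refine ⟨h5, h6.trans (by gcongr; linarith), fun ξ => ?_⟩
  calc Real.exp (l * ω ‖ξ‖) * ‖ultraFourier f ξ‖
      ≤ Real.exp ((l + k) * ω ‖ξ‖) * ‖ultraFourier f ξ‖ := by
        have := hω.nonneg ‖ξ‖ (norm_nonneg _)
        gcongr
        linarith
    _ ≤ M := h4 ξ
    _ ≤ (C + 1) * M := by nlinarith

lemma rapidDecay_of_mem_SSub (hω : IsWeight ω) {f : E N → ℂ} (hf : f ∈ SSub ω N) :
    RapidDecay ω f := by
  have key : ∀ l : ℝ, ∃ M, Integrable (fun x => Real.exp (l * ω ‖x‖) * ‖f x‖) ∧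
      ∀ ξ, Real.exp (l * ω ‖ξ‖) * ‖ultraFourier f ξ‖ ≤ M := by
    intro l
    -- Rapid decay allows every real l, while the seminorms exist only for positive exponents.
    obtain ⟨l', C, hC, h⟩ := exists_decayBound_of_wsup hω N (by positivity : 0 < |l| + 1)
    obtain ⟨h1, h2⟩ := hf.2.2.2 l' 0
    set M := (wsup ω l' 0 f + wsup ω l' 0 (ultraFourier f)).toReal
    have hfin : wsup ω l' 0 f + wsup ω l' 0 (ultraFourier f) ≠ ∞ :=
      (ENNReal.add_lt_top.2 ⟨h1, h2⟩).ne
    have hM : ENNReal.ofReal M = wsup ω l' 0 f + wsup ω l' 0 (ultraFourier f) :=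
      ENNReal.ofReal_toReal hfin
    obtain ⟨h3, h4⟩ := h f hf.2.1.continuous M ENNReal.toReal_nonneg
      (hM ▸ le_self_add) (hM ▸ le_add_self)
    have hexp : ∀ x : E N, Real.exp (l * ω ‖x‖) ≤ Real.exp ((|l| + 1) * ω ‖x‖) := fun x => by
      have := hω.nonneg ‖x‖ (norm_nonneg _)
      gcongr
      linarith [le_abs_self l]
    refine ⟨C * M, h3.mono' (Continuous.aestronglyMeasurable ?_)
      (Filter.Eventually.of_forall fun x => ?_), fun ξ => le_trans ?_ (h4.fourier_le ξ)⟩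
    · exact (Real.continuous_exp.comp (continuous_const.mul (hω.continuous_norm (E N)))).mul
        hf.2.1.continuous.norm
    · rw [Real.norm_of_nonneg (by positivity)]
      exact mul_le_mul_of_nonneg_right (hexp x) (norm_nonneg _)
    · exact mul_le_mul_of_nonneg_right (hexp ξ) (norm_nonneg _)
  exact ⟨hf.2.1.continuous, fun l => (key l).choose_spec.1,
    fun l => ⟨_, (key l).choose_spec.2⟩⟩

/-! ### Test functions -/

lemma exists_norm_mderiv_mul_invWeight_le {φ : E N → ℂ} (hφ : φ ∈ DSub ω N) (m : ℕ+) :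
    ∃ A : ℝ, 0 ≤ A ∧ ∀ α x, ‖mderiv α φ x‖ * invWeight ω m (order α) ≤ A := by
  have hm : (0 : ℝ) < (m : ℕ) := by exact_mod_cast m.pos
  have hfin := hφ.1.2 (tsupport φ) hφ.2 m
  refine ⟨(pK ω (tsupport φ) m φ).toReal, ENNReal.toReal_nonneg, fun α x => ?_⟩
  by_cases hx : x ∈ tsupport φ
  · have h1 : ‖mderiv α φ x‖ₑ * EReal.exp (-expo ω m (order α)) ≤ pK ω (tsupport φ) m φ :=
      le_iSup₂_of_le x hx (le_iSup (fun α : MultiIndex N =>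
        ‖mderiv α φ x‖ₑ * EReal.exp (-expo ω m (order α))) α)
    rw [exp_neg_expo hm, ← ofReal_norm, ← ENNReal.ofReal_mul (norm_nonneg _)] at h1
    exact (ENNReal.ofReal_le_iff_le_toReal hfin.ne).1 h1
  · have : mderiv α φ x = 0 := image_eq_zero_of_notMem_tsupport
      fun h => hx (tsupport_mderiv_subset α φ h)
    rw [this]
    simp

lemma integrable_mderiv {φ : E N → ℂ} (hφ : φ ∈ DSub ω N) (α : MultiIndex N) :
    Integrable (mderiv α φ) :=
  (mderiv_contDiff α hφ.1.1).continuous.integrable_of_hasCompactSupport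
    (hasCompactSupport_mderiv α hφ.2)

/-- The `L¹` conditions are trivial by compact support. The norms p_{K,m} on the support bound the
pure derivatives, and `exists_fourier_le` turns this into decay of the transform. -/
lemma rapidDecay_of_mem_DSub (hω : IsWeight ω) {φ : E N → ℂ} (hφ : φ ∈ DSub ω N) :
    RapidDecay ω φ := by
  have hc : Continuous φ := hφ.1.1.continuous
  refine ⟨hc, fun l => ?_, fun l => ?_⟩
  · refine Continuous.integrable_of_hasCompactSupport
      ((Real.continuous_exp.comp (continuous_const.mul (hω.continuous_norm (E N)))).mul hc.norm) ?_
    exact hφ.2.norm.mul_left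
  · obtain ⟨m, C, hC, h⟩ := exists_fourier_le hω N (abs_nonneg l)
    obtain ⟨A, hA, hAb⟩ := exists_norm_mderiv_mul_invWeight_le hφ m
    set v := (volume : Measure (E N)).real (tsupport φ)
    have hbound : ∀ j k, (1 / 2) ^ k * invWeight ω m k * ∫ x, ‖(pderiv j)^[k] φ x‖ ≤ A * v := by
      intro j k
      have hiw := invWeight_nonneg (ω := ω) (m := m) k
      have h1 : ∫ x, invWeight ω m k * ‖(pderiv j)^[k] φ x‖ ≤ A * v := by
        rw [← setIntegral_eq_integral_of_forall_compl_eq_zero (s := tsupport φ)]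
        · refine (setIntegral_mono_on (g := fun _ => A) ?_ ?_ (isClosed_tsupport φ).measurableSet
            fun x _ => ?_).trans (le_of_eq ?_)
          · rw [← mderiv_single]
            exact ((integrable_mderiv hφ _).norm.const_mul _).integrableOn
          · exact integrableOn_const hφ.2.measure_lt_top.ne
          · have := hAb (Pi.single j k) x
            rw [mderiv_single, order_single] at this
            linarith
          · rw [setIntegral_const, smul_eq_mul, mul_comm]
        · intro x hx
          rw [image_eq_zero_of_notMem_tsupport
            fun h => hx (tsupport_iterate_pderiv_subset j k φ h)]
          simp
      rw [integral_const_mul] at h1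
      have h2 : ((1 : ℝ) / 2) ^ k ≤ 1 := pow_le_one₀ (by norm_num) (by norm_num)
      have h3 : 0 ≤ invWeight ω m k * ∫ x, ‖(pderiv j)^[k] φ x‖ := by positivity
      rw [mul_assoc]
      nlinarith
    refine ⟨C * (max (∫ x, ‖φ x‖) (A * v)), fun ξ => le_trans ?_ (h φ hφ.1.1 hφ.2 _
      (le_max_left _ _) (fun j k => (hbound j k).trans (le_max_right _ _)) ξ)⟩
    have := hω.nonneg ‖ξ‖ (norm_nonneg _)
    gcongr
    exact le_abs_self l

end

/-! ### Bounded densities: Hahn–Banach in `L¹`, Riesz in `L²` -/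

section

/-! ### Functionals dominated by an `L¹`-norm over a finite measure -/

section Duality

variable {X : Type*} [MeasurableSpace X] {ν : Measure X}

/-- A linear functional dominated by an `L¹`-norm factors through a continuous functional on
`L¹`. -/
lemma exists_functional_on_L1 {V : Type*} [AddCommGroup V] [Module ℂ V] (J : V →ₗ[ℂ] X → ℂ)
    (hJ : ∀ v, MemLp (J v) 1 ν) (T : V →ₗ[ℂ] ℂ) {C : ℝ} (hC : 0 ≤ C)
    (hT : ∀ v, ‖T v‖ ≤ C * ∫ x, ‖J v x‖ ∂ν) :
    ∃ F : Lp ℂ 1 ν →L[ℂ] ℂ, ‖F‖ ≤ C ∧ ∀ v, F ((hJ v).toLp (J v)) = T v := by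
  let j : V →ₗ[ℂ] Lp ℂ 1 ν :=
    { toFun := fun v => (hJ v).toLp (J v)
      map_add' := fun v w => by
        rw [← MemLp.toLp_add]
        exact MemLp.toLp_congr _ _ (by rw [map_add])
      map_smul' := fun c v => by
        rw [RingHom.id_apply, ← MemLp.toLp_const_smul]
        exact MemLp.toLp_congr _ _ (by rw [map_smul]) }
  have hnorm : ∀ v, ‖j v‖ = ∫ x, ‖J v x‖ ∂ν := fun v => by
    rw [L1.norm_eq_integral_norm]
    refine integral_congr_ae ?_
    filter_upwards [(hJ v).coeFn_toLp] with x hx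
    change ‖((hJ v).toLp (J v) : X → ℂ) x‖ = _
    rw [hx]
  have hT' : ∀ v, ‖T v‖ ≤ C * ‖j v‖ := fun v => (hnorm v).symm ▸ hT v
  -- T factors through the range of j, because the bound on T makes it vanish on the kernel of j. A
  -- linear section realizes this factorization before Hahn–Banach extends it.
  obtain ⟨s, hs⟩ := j.rangeRestrict.exists_rightInverse_of_surjective
    (LinearMap.range_eq_top.2 j.surjective_rangeRestrict)
  have hs' : ∀ w, j (s w) = w := fun w => by
    have := LinearMap.congr_fun hs w
    exact congrArg Subtype.val this
  let F₀ : LinearMap.range j →L[ℂ] ℂ := (T ∘ₗ s).mkContinuous C fun w => by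
    have := hT' (s w)
    rw [hs' w] at this
    exact this
  obtain ⟨F, hF, hFn⟩ := exists_extension_norm_eq (LinearMap.range j) F₀
  refine ⟨F, hFn ▸ LinearMap.mkContinuous_norm_le _ hC _, fun v => ?_⟩
  have h1 : F (j v) = T (s (j.rangeRestrict v)) := hF (j.rangeRestrict v)
  have h2 : T (s (j.rangeRestrict v) - v) = 0 := by
    have h3 : j (s (j.rangeRestrict v) - v) = 0 := by
      rw [map_sub, hs' (j.rangeRestrict v)]
      exact sub_self _
    have h4 := hT' (s (j.rangeRestrict v) - v)
    rw [h3, norm_zero, mul_zero] at h4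
    exact norm_le_zero_iff.1 h4
  rw [map_sub, sub_eq_zero] at h2
  exact h1.trans h2

/-- A continuous functional on `L¹` of a finite measure is represented on `L²` by an
`L²`-function. -/
lemma exists_representation_on_L2 [IsFiniteMeasure ν] (F : Lp ℂ 1 ν →L[ℂ] ℂ) :
    ∃ g : X → ℂ, StronglyMeasurable g ∧ MemLp g 2 ν ∧
      ∀ (u : X → ℂ) (_ : MemLp u 2 ν) (hu' : MemLp u 1 ν), F (hu'.toLp u) = ∫ x, g x * u x ∂ν := by
  have h12 : (1 : ℝ≥0∞) ≤ 2 := by norm_num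
  have hL : ∀ u : Lp ℂ 2 ν, MemLp u 1 ν := fun u => (Lp.memLp u).mono_exponent h12
  let i : Lp ℂ 2 ν →ₗ[ℂ] Lp ℂ 1 ν :=
    { toFun := fun u => (hL u).toLp u
      map_add' := fun u w => by
        rw [← MemLp.toLp_add]
        exact MemLp.toLp_congr _ _ (Lp.coeFn_add u w)
      map_smul' := fun c u => by
        rw [RingHom.id_apply, ← MemLp.toLp_const_smul]
        exact MemLp.toLp_congr _ _ (Lp.coeFn_smul c u) }
  set B : ℝ≥0∞ := ν Set.univ ^ (1 / (1 : ℝ≥0∞).toReal - 1 / (2 : ℝ≥0∞).toReal) with hB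
  have hBfin : B ≠ ∞ := (ENNReal.rpow_lt_top_of_nonneg (by norm_num) (measure_ne_top _ _)).ne
  have hi : ∀ u, ‖i u‖ ≤ B.toReal * ‖u‖ := fun u => by
    change ‖(hL u).toLp u‖ ≤ _
    rw [Lp.norm_toLp, Lp.norm_def, ← ENNReal.toReal_mul]
    refine ENNReal.toReal_mono (ENNReal.mul_ne_top hBfin (Lp.eLpNorm_ne_top u)) ?_
    rw [mul_comm]
    exact eLpNorm_le_eLpNorm_mul_rpow_measure_univ h12 (Lp.aestronglyMeasurable u)
  -- On a finite measure space `L²` embeds continuously in `L¹`, so F restricts to `L²` and the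
  -- Riesz theorem gives the density.
  let G : Lp ℂ 2 ν →L[ℂ] ℂ := F.comp (i.mkContinuous _ hi)
  set g₀ : Lp ℂ 2 ν := (InnerProductSpace.toDual ℂ (Lp ℂ 2 ν)).symm G with hg₀
  have hg : ∀ u, inner ℂ g₀ u = G u := fun u => by
    rw [hg₀, InnerProductSpace.toDual_symm_apply]
  refine ⟨fun x => star (g₀ x), (Lp.stronglyMeasurable g₀).star, (Lp.memLp g₀).star,
    fun u hu hu' => ?_⟩
  have h1 : i (hu.toLp u) = hu'.toLp u := MemLp.toLp_congr (hL _) _ hu.coeFn_toLp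
  have h2 := hg (hu.toLp u)
  change _ = F (i (hu.toLp u)) at h2
  rw [h1, L2.inner_def] at h2
  rw [← h2]
  refine integral_congr_ae ?_
  filter_upwards [hu.coeFn_toLp] with x hx
  rw [hx, RCLike.inner_apply, mul_comm]
  rfl

/-- A linear functional dominated by the `L¹`-norm over a finite measure has a bounded density. -/
theorem exists_bounded_density [IsFiniteMeasure ν] {V : Type*} [AddCommGroup V] [Module ℂ V]
    (J : V →ₗ[ℂ] X → ℂ) (hJ : ∀ v, MemLp (J v) ∞ ν) (T : V →ₗ[ℂ] ℂ) {C : ℝ} (hC : 0 ≤ C)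
    (hT : ∀ v, ‖T v‖ ≤ C * ∫ x, ‖J v x‖ ∂ν) :
    ∃ g : X → ℂ, StronglyMeasurable g ∧ (∀ x, ‖g x‖ ≤ C) ∧ ∀ v, T v = ∫ x, g x * J v x ∂ν := by
  have hJ1 : ∀ v, MemLp (J v) 1 ν := fun v => (hJ v).mono_exponent le_top
  obtain ⟨F, hF, hFT⟩ := exists_functional_on_L1 J hJ1 T hC hT
  obtain ⟨g, hgm, hg2, hg⟩ := exists_representation_on_L2 F
  have hbound : ∀ᵐ x ∂ν, ‖g x‖ ≤ C := by
    refine ae_le_of_forall_setIntegral_le (hg2.integrable (by norm_num)).norm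
      (integrable_const C) fun A hA _ => ?_
    -- Testing with the conjugate phase of g on A gives ∫_A |g| ≤ C ν(A) for all measurable A, hence
    -- |g| ≤ C almost everywhere. Where g vanishes the quotient is 0, which is harmless.
    set u : X → ℂ := A.indicator fun x => star (g x) / (‖g x‖ : ℂ) with hu
    have hum : StronglyMeasurable u :=
      (hgm.star.measurable.div (Complex.measurable_ofReal.comp
        hgm.norm.measurable)).stronglyMeasurable.indicator hA
    have hu1 : ∀ x, ‖u x‖ ≤ A.indicator (fun _ => (1 : ℝ)) x := fun x => by
      by_cases hx : x ∈ A
      · simp only [hu, Set.indicator_of_mem hx]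
        rw [norm_div, norm_star, Complex.norm_real, norm_norm]
        exact div_self_le_one _
      · simp [hu, hx]
    have hu1' : ∀ x, ‖u x‖ ≤ 1 := fun x => (hu1 x).trans (Set.indicator_le_self' (by simp) x)
    have hutop : MemLp u ∞ ν := memLp_top_of_bound hum.aestronglyMeasurable 1
      (Filter.Eventually.of_forall hu1')
    have hu2 : MemLp u 2 ν := hutop.mono_exponent le_top
    have hu3 : MemLp u 1 ν := hutop.mono_exponent le_top
    have h1 := hg u hu2 hu3
    have h2 : ∀ x, g x * u x = ((A.indicator (fun x => ‖g x‖) x : ℝ) : ℂ) := fun x => by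
      by_cases hx : x ∈ A
      · simp only [hu, Set.indicator_of_mem hx]
        by_cases h0 : g x = 0
        · simp [h0]
        · have h3 : (‖g x‖ : ℂ) ≠ 0 := by simpa using h0
          rw [mul_div_assoc', div_eq_iff h3]
          have := Complex.mul_conj (g x)
          rw [Complex.normSq_eq_norm_sq] at this
          change g x * (starRingEnd ℂ) (g x) = _
          rw [this]
          push_cast
          ring
      · simp [hu, hx]
    simp only [h2] at h1
    rw [integral_complex_ofReal, integral_indicator hA] at h1
    have h3 : ‖F (hu3.toLp u)‖ ≤ C * ∫ x, ‖u x‖ ∂ν := by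
      refine (F.le_opNorm _).trans ?_
      have h4 : ‖hu3.toLp u‖ = ∫ x, ‖u x‖ ∂ν := by
        rw [L1.norm_eq_integral_norm]
        refine integral_congr_ae ?_
        filter_upwards [hu3.coeFn_toLp] with x hx
        rw [hx]
      rw [h4]
      gcongr
    rw [h1, Complex.norm_real, Real.norm_of_nonneg (by positivity)] at h3
    refine h3.trans ?_
    rw [setIntegral_const, smul_eq_mul, mul_comm]
    refine mul_le_mul_of_nonneg_right ?_ hC
    calc ∫ x, ‖u x‖ ∂ν ≤ ∫ x, A.indicator (fun _ => (1 : ℝ)) x ∂ν :=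
          integral_mono (hu3.integrable le_rfl).norm ((integrable_const _).indicator hA) hu1
      _ = ν.real A := by rw [integral_indicator hA]; simp
  -- Changing g on a null set makes the bound hold at every point, as is needed later on the
  -- individual slices in α.
  refine ⟨{x | ‖g x‖ ≤ C}.indicator g,
    hgm.indicator (measurableSet_le hgm.norm.measurable measurable_const), fun x => ?_,
    fun v => ?_⟩
  · by_cases hx : ‖g x‖ ≤ C
    · rwa [Set.indicator_of_mem (show x ∈ {x | ‖g x‖ ≤ C} from hx)]
    · rwa [Set.indicator_of_notMem (show x ∉ {x | ‖g x‖ ≤ C} from hx), norm_zero]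
  · rw [← hFT v, hg _ ((hJ v).mono_exponent le_top) (hJ1 v)]
    refine integral_congr_ae ?_
    filter_upwards [hbound] with x hx
    rw [Set.indicator_of_mem (show x ∈ {x | ‖g x‖ ≤ C} from hx)]

end Duality

end

/-! ### Series of derivatives are continuous on `S` -/

section

variable {ω : ℝ → ℝ} {N : ℕ}

/-! ### Sums of derivatives define functionals on `𝒮_ω` -/

lemma summable_half_pow_order (N : ℕ) :
    Summable fun α : MultiIndex N => ((1 : ℝ) / 2) ^ order α := by
  induction N with
  | zero => exact Summable.of_finite
  | succ n ih =>
    have h1 : Summable fun k : ℕ => ((1 : ℝ) / 2) ^ k :=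
      summable_geometric_of_lt_one (by norm_num) (by norm_num)
    have h2 := h1.mul_of_nonneg ih (fun k => by positivity) (fun α => by positivity)
    rw [← (Fin.consEquiv fun _ => ℕ).summable_iff]
    refine h2.congr fun x => ?_
    simp [order, Fin.consEquiv, Fin.sum_univ_succ, pow_add]

lemma exists_memLp_exp_neg (hω : IsWeight ω) (N : ℕ) :
    ∃ k : ℝ, 0 < k ∧ ∀ q : ℝ≥0∞, 1 ≤ q → MemLp (fun x : E N => Real.exp (-(k * ω ‖x‖))) q := by
  obtain ⟨k, hk, hint⟩ := hω.exists_integrable_exp_neg N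
  refine ⟨k, hk, fun q hq => ?_⟩
  have hm : AEStronglyMeasurable (fun x : E N => Real.exp (-(k * ω ‖x‖))) :=
    (hint k le_rfl).aestronglyMeasurable
  by_cases hq' : q = ∞
  · subst hq'
    refine memLp_top_of_bound hm 1 (Filter.Eventually.of_forall fun x => ?_)
    rw [Real.norm_of_nonneg (Real.exp_pos _).le, Real.exp_le_one_iff]
    have := hω.nonneg ‖x‖ (norm_nonneg x)
    have : 0 ≤ k * ω ‖x‖ := by positivity
    linarith
  · rw [← integrable_norm_rpow_iff hm (by positivity) hq']
    have hq1 : 1 ≤ q.toReal := by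
      rw [← ENNReal.toReal_one]
      exact ENNReal.toReal_mono hq' hq
    refine (hint (k * q.toReal) (by nlinarith)).congr (Filter.Eventually.of_forall fun x => ?_)
    simp only
    rw [Real.norm_of_nonneg (Real.exp_pos _).le, ← Real.exp_mul]
    congr 1
    ring

/-- Each term is at most the whole sum or supremum, so q < ∞ and q = ∞ lead to the same bound. Where
φ* is infinite, finiteness forces the norm of f_α to vanish, in agreement with `invWeight` being 0.
-/
lemma exists_eLpNorm_le_of_memSum {m : ℕ+} {n : ℤ} {q : ℝ≥0∞} (hq : 1 ≤ q)
    {f : MultiIndex N → E N → ℂ} (hf : MemSum ω m n q f) :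
    ∃ A : ℝ, 0 ≤ A ∧ ∀ α, eLpNorm (fun x => Real.exp (n * ω ‖x‖) • f α x) q volume ≤
      ENNReal.ofReal A * ENNReal.ofReal (invWeight ω m (order α)) := by
  have hm : (0 : ℝ) < (m : ℕ) := by exact_mod_cast m.pos
  suffices h : ∃ B : ℝ≥0∞, B ≠ ∞ ∧ ∀ α, eLpNorm (fun x => Real.exp (n * ω ‖x‖) • f α x) q volume *
      EReal.exp (expo ω m (order α)) ≤ B by
    obtain ⟨B, hB, h⟩ := h
    refine ⟨B.toReal, ENNReal.toReal_nonneg, fun α => ?_⟩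
    have h1 := h α
    rw [exp_expo hm, ← div_eq_mul_inv, ENNReal.div_le_iff_le_mul (Or.inr hB)
      (Or.inl ENNReal.ofReal_ne_top)] at h1
    rwa [ENNReal.ofReal_toReal hB]
  have hfin := hf.2
  rw [sumNorm] at hfin
  split_ifs at hfin with hq'
  · subst hq'
    exact ⟨_, hfin.ne, fun α => le_iSup (fun α => eLpNorm (fun x => Real.exp (n * ω ‖x‖) • f α x)
      ∞ volume * EReal.exp (expo ω m (order α))) α⟩
  · have hq0 : 0 < q.toReal := ENNReal.toReal_pos (by positivity) hq'
    refine ⟨_, (ENNReal.rpow_lt_top_of_nonneg (y := q.toReal⁻¹) (by positivity) hfin.ne).ne,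
      fun α => ?_⟩
    rw [ENNReal.le_rpow_inv_iff hq0, ENNReal.mul_rpow_of_nonneg _ _ hq0.le, ← EReal.exp_mul,
      mul_comm (expo _ _ _)]
    exact ENNReal.le_tsum (f := fun α => eLpNorm (fun x => Real.exp (n * ω ‖x‖) • f α x) q volume ^
      q.toReal * EReal.exp ((q.toReal : EReal) * expo ω m (order α))) α

/-- The terms of the series `∑ ∂^α f_α`, tested against a function of rapid decay. -/
lemma exists_eLpNorm_mul_mderiv_le (hω : IsWeight ω) {m : ℕ+} {p q : ℝ≥0∞} (hp1 : 1 ≤ p)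
    (hpq : p.HolderConjugate q) {f : MultiIndex N → E N → ℂ} (hf : MemSum ω m (-(m : ℤ)) q f) :
    ∃ l C : ℝ, 0 < l ∧ 0 ≤ C ∧ ∀ φ : E N → ℂ, RapidDecay ω φ → ∀ M, DecayBound ω l M φ →
      ∀ α, Integrable (fun x => f α x * mderiv α φ x) ∧
        ‖∫ x, f α x * mderiv α φ x‖ ≤ C * M * (1 / 2) ^ order α := by
  have hm : (0 : ℝ) < (m : ℕ) := by exact_mod_cast m.pos
  obtain ⟨A, hA, hfA⟩ := exists_eLpNorm_le_of_memSum hpq.symm.one_le hf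
  obtain ⟨k, hk, hLp⟩ := exists_memLp_exp_neg hω N
  -- The exponent m cancels the weight exp(-mω) on f_α, and k supplies a factor exp(-kω) in `L^p`.
  obtain ⟨l, C, hC, h⟩ := exists_mderiv_le hω N hm (m₂ := m + k) (by positivity)
  set P := eLpNorm (fun x : E N => Real.exp (-(k * ω ‖x‖))) p volume with hP
  have hPfin : P ≠ ∞ := (hLp p hp1).2.ne
  refine ⟨|l| + 1, A * (C * P.toReal), by positivity, by positivity, fun φ hφ M hM α => ?_⟩
  have hM0 := hM.nonneg
  have hM' : DecayBound ω l M φ := hM.mono hω hφ (by linarith [le_abs_self l])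
  set u : E N → ℂ := fun x => Real.exp ((-(m : ℤ) : ℤ) * ω ‖x‖) • f α x with hu
  set v : E N → ℂ := fun x => Real.exp (m * ω ‖x‖) • mderiv α φ x with hv
  have huv : (fun x => f α x * mderiv α φ x) = u • v := by
    funext x
    simp only [hu, hv, Pi.smul_apply', smul_eq_mul, Complex.real_smul]
    have : (Real.exp ((-(m : ℤ) : ℤ) * ω ‖x‖) : ℂ) * (Real.exp (m * ω ‖x‖) : ℂ) = 1 := by
      rw [← Complex.ofReal_mul, ← Real.exp_add]
      push_cast
      simp
    linear_combination (-(f α x * mderiv α φ x)) * this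
  have hexp : ∀ c : ℝ, Continuous fun x : E N => Real.exp (c * ω ‖x‖) := fun c =>
    Real.continuous_exp.comp (continuous_const.mul (hω.continuous_norm (E N)))
  have hum : AEStronglyMeasurable u :=
    (hexp _).aestronglyMeasurable.smul (hf.1 α)
  have hvm : AEStronglyMeasurable v := ((hexp _).smul
    (mderiv_contDiff α (hφ.contDiff hω)).continuous).aestronglyMeasurable
  have hiw := invWeight_nonneg (ω := ω) (m := m) (order α)
  -- The factor `invWeight` from the bound on f_α is moved to the derivative of φ, where it is
  -- exactly what `exists_mderiv_le` requires. The summable factor 2^{-|α|} comes from the same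
  -- estimate.
  have hv1 : ENNReal.ofReal (invWeight ω m (order α)) * eLpNorm v p volume ≤
      ENNReal.ofReal (C * M * (1 / 2) ^ order α) * P := by
    have h1 : ENNReal.ofReal (invWeight ω m (order α)) * eLpNorm v p volume =
        eLpNorm (invWeight ω m (order α) • v) p volume := by
      rw [eLpNorm_const_smul, Real.enorm_eq_ofReal hiw]
    rw [h1]
    refine eLpNorm_le_mul_eLpNorm_of_ae_le_mul (Filter.Eventually.of_forall fun x => ?_) p
    have h2 := h φ hφ M hM' α x
    have h3 : (2 : ℝ) ^ order α * (1 / 2) ^ order α = 1 := by rw [← mul_pow]; norm_num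
    rw [Pi.smul_apply, norm_smul, norm_smul, Real.norm_of_nonneg hiw,
      Real.norm_of_nonneg (Real.exp_pos _).le, Real.norm_of_nonneg (Real.exp_pos _).le]
    have h4 : Real.exp ((m + k) * ω ‖x‖) * Real.exp (-(k * ω ‖x‖)) = Real.exp (m * ω ‖x‖) := by
      rw [← Real.exp_add]
      congr 1
      ring
    calc invWeight ω m (order α) * (Real.exp (m * ω ‖x‖) * ‖mderiv α φ x‖)
        = (2 ^ order α * invWeight ω m (order α) * (Real.exp ((m + k) * ω ‖x‖) *
            ‖mderiv α φ x‖)) * ((1 / 2) ^ order α * Real.exp (-(k * ω ‖x‖))) := by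
          rw [← h4]
          linear_combination (-(invWeight ω m (order α) * (Real.exp ((m + k) * ω ‖x‖) *
            Real.exp (-(k * ω ‖x‖)) * ‖mderiv α φ x‖))) * h3
      _ ≤ (C * M) * ((1 / 2) ^ order α * Real.exp (-(k * ω ‖x‖))) := by gcongr
      _ = _ := by ring
  have hnorm : eLpNorm (u • v) 1 volume ≤ ENNReal.ofReal (A * (C * P.toReal) * M *
      (1 / 2) ^ order α) := by
    have : ENNReal.HolderTriple q p 1 := hpq.symm
    calc eLpNorm (u • v) 1 volume ≤ eLpNorm u q volume * eLpNorm v p volume :=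
          eLpNorm_smul_le_mul_eLpNorm hvm hum
      _ ≤ ENNReal.ofReal A * ENNReal.ofReal (invWeight ω m (order α)) * eLpNorm v p volume := by
          gcongr
          exact hfA α
      _ = ENNReal.ofReal A * (ENNReal.ofReal (invWeight ω m (order α)) * eLpNorm v p volume) :=
          mul_assoc _ _ _
      _ ≤ ENNReal.ofReal A * (ENNReal.ofReal (C * M * (1 / 2) ^ order α) * P) := by gcongr
      _ = ENNReal.ofReal A * (ENNReal.ofReal (C * M * (1 / 2) ^ order α) *
            ENNReal.ofReal P.toReal) := by rw [ENNReal.ofReal_toReal hPfin]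
      _ = _ := by
          rw [← ENNReal.ofReal_mul (by positivity), ← ENNReal.ofReal_mul hA]
          congr 1
          ring
  rw [huv]
  have hint : Integrable (u • v) :=
    memLp_one_iff_integrable.1 ⟨hum.smul hvm, hnorm.trans_lt ENNReal.ofReal_lt_top⟩
  refine ⟨hint, ?_⟩
  have h1 := (enorm_integral_le_lintegral_enorm (u • v)).trans
    (eLpNorm_one_eq_lintegral_enorm.symm.trans_le hnorm)
  rw [← ofReal_norm] at h1
  exact (ENNReal.ofReal_le_ofReal_iff (by positivity)).1 h1

lemma withSeminorms_S (ω : ℝ → ℝ) (N : ℕ) : WithSeminorms (S.seminorms ω N) := ⟨rfl⟩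

lemma wsup_le_ofReal_sup {φ : S ω N} {l : Set.Ioi (0 : ℝ)} {β : MultiIndex N}
    {s : Finset ((Set.Ioi (0 : ℝ) × MultiIndex N) ⊕ (Set.Ioi (0 : ℝ) × MultiIndex N))} :
    (.inl (l, β) ∈ s → wsup ω l β φ.1 ≤ ENNReal.ofReal (s.sup (S.seminorms ω N) φ)) ∧
    (.inr (l, β) ∈ s →
      wsup ω l β (ultraFourier φ.1) ≤ ENNReal.ofReal (s.sup (S.seminorms ω N) φ)) := by
  obtain ⟨h1, h2⟩ := φ.2.2.2.2 l β
  refine ⟨fun h => ?_, fun h => ?_⟩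
  · rw [← ENNReal.ofReal_toReal h1.ne]
    exact ENNReal.ofReal_le_ofReal (Seminorm.le_finset_sup_apply (p := S.seminorms ω N) h)
  · rw [← ENNReal.ofReal_toReal h2.ne]
    exact ENNReal.ofReal_le_ofReal (Seminorm.le_finset_sup_apply (p := S.seminorms ω N) h)

/-- The sum of the derivatives of a family in the weighted sequence space lies in `𝒮'_ω`. -/
theorem memSDual_of_isSumDeriv (hω : IsWeight ω) {m : ℕ+} {p q : ℝ≥0∞} (hp1 : 1 ≤ p)
    (hpq : p.HolderConjugate q) {f : MultiIndex N → E N → ℂ} (hf : MemSum ω m (-(m : ℤ)) q f)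
    {T : DDual ω N} (hT : IsSumDeriv T f) : MemSDual T := by
  obtain ⟨l, C, hl, hC, h⟩ := exists_eLpNorm_mul_mderiv_le hω hp1 hpq hf
  obtain ⟨l', C', hC', h'⟩ := exists_decayBound_of_wsup hω N hl
  have hR : ∀ φ : S ω N, RapidDecay ω φ.1 := fun φ => rapidDecay_of_mem_SSub hω φ.2
  have hsum := summable_half_pow_order N
  set term : S ω N → MultiIndex N → ℂ := fun φ α =>
    (-1 : ℂ) ^ order α * ∫ x, f α x * mderiv α φ.1 x with hterm
  have hint : ∀ (φ : S ω N) α, Integrable fun x => f α x * mderiv α φ.1 x := fun φ α => by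
    obtain ⟨M, hM⟩ := (hR φ).exists_decayBound l
    exact (h φ.1 (hR φ) M hM α).1
  have hle : ∀ (φ : S ω N) (M : ℝ), DecayBound ω l M φ.1 →
      ∀ α, ‖term φ α‖ ≤ C * M * (1 / 2) ^ order α := fun φ M hM α => by
    rw [hterm, norm_mul, norm_pow, norm_neg, norm_one, one_pow, one_mul]
    exact (h φ.1 (hR φ) M hM α).2
  have hterm_sum : ∀ φ : S ω N, Summable (term φ) := fun φ => by
    obtain ⟨M, hM⟩ := (hR φ).exists_decayBound l
    exact Summable.of_norm_bounded (hsum.mul_left _) (hle φ M hM)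
  have hcd : ∀ φ : S ω N, ContDiff ℝ (⊤ : ℕ∞) φ.1 := fun φ => φ.2.2.1
  let U : S ω N →ₗ[ℂ] ℂ :=
    { toFun := fun φ => ∑' α, term φ α
      map_add' := fun φ ψ => by
        rw [← (hterm_sum φ).tsum_add (hterm_sum ψ)]
        refine tsum_congr fun α => ?_
        simp only [hterm]
        rw [← mul_add, ← integral_add (hint φ α) (hint ψ α)]
        congr 2
        funext x
        have : mderiv α (φ + ψ).1 = mderiv α φ.1 + mderiv α ψ.1 :=
          mderiv_add α (hcd φ) (hcd ψ)
        rw [this, Pi.add_apply, mul_add]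
      map_smul' := fun c φ => by
        rw [RingHom.id_apply, smul_eq_mul, ← tsum_mul_left]
        refine tsum_congr fun α => ?_
        simp only [hterm]
        rw [mul_left_comm, ← integral_const_mul c]
        congr 2
        funext x
        have : mderiv α (c • φ).1 = c • mderiv α φ.1 := mderiv_smul α c (hcd φ)
        rw [this, Pi.smul_apply, smul_eq_mul]
        ring }
  have hUc : Continuous U := by
    -- Two seminorms of order zero suffice for continuity, since they control a decay bound.
    set s : Finset ((Set.Ioi (0 : ℝ) × MultiIndex N) ⊕ (Set.Ioi (0 : ℝ) × MultiIndex N)) :=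
      {.inl (l', 0), .inr (l', 0)} with hs
    set D := C * C' * ∑' α : MultiIndex N, (1 / 2 : ℝ) ^ order α with hD
    have hD0 : 0 ≤ D := mul_nonneg (by positivity) (tsum_nonneg fun α => by positivity)
    refine (withSeminorms_S ω N).continuous_normedSpace_rng ℂ U ⟨s, ⟨D, hD0⟩, fun φ => ?_⟩
    have h1 : wsup ω l' 0 φ.1 ≤ ENNReal.ofReal (s.sup (S.seminorms ω N) φ) :=
      wsup_le_ofReal_sup.1 (by simp [hs])
    have h2 : wsup ω l' 0 (ultraFourier φ.1) ≤ ENNReal.ofReal (s.sup (S.seminorms ω N) φ) :=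
      wsup_le_ofReal_sup.2 (by simp [hs])
    have h3 := (h' φ.1 (hR φ).continuous _ (apply_nonneg _ _) h1 h2).2
    have h4 := tsum_of_norm_bounded (hsum.mul_left _).hasSum (hle φ _ h3)
    change ‖∑' α, term φ α‖ ≤ D * s.sup (S.seminorms ω N) φ
    refine h4.trans (le_of_eq ?_)
    rw [tsum_mul_left, hD]
    ring
  refine ⟨⟨U, hUc⟩, fun φ => ⟨(rapidDecay_of_mem_DSub hω φ.2).mem_SSub hω, ?_⟩⟩
  exact (hT φ).tsum_eq

end

/-! ### Functionals on `S` as series of derivatives -/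

section

variable {ω : ℝ → ℝ} {N : ℕ}

/-! ### Representation of the elements of `𝒮'_ω` -/

/-- Continuity involves finitely many seminorms. Each is controlled by some decay bound, and decay
bounds with larger l are stronger, so the largest l serves for all. -/
lemma exists_bound_of_SDual (hω : IsWeight ω) (U : SDual ω N) :
    ∃ l C : ℝ, 0 ≤ l ∧ 0 ≤ C ∧ ∀ (φ : S ω N) (M : ℝ), DecayBound ω l M φ.1 → ‖U φ‖ ≤ C * M := by
  obtain ⟨s, B, -, hB⟩ := Seminorm.bound_of_continuous (withSeminorms_S ω N)
    ((normSeminorm ℂ ℂ).comp U.toLinearMap) (continuous_norm.comp U.continuous)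
  have key : ∀ i, ∃ l C : ℝ, 0 ≤ C ∧ ∀ (φ : S ω N) (M : ℝ), DecayBound ω l M φ.1 →
      S.seminorms ω N i φ ≤ C * M := by
    rintro (⟨l, β⟩ | ⟨l, β⟩)
    · obtain ⟨l', C, hC, h⟩ := exists_wsup_le hω (le_of_lt l.2) β
      refine ⟨l', C, hC, fun φ M hM => ?_⟩
      exact ENNReal.toReal_le_of_le_ofReal (mul_nonneg hC hM.nonneg)
        (h φ.1 (rapidDecay_of_mem_SSub hω φ.2) M hM)
    · obtain ⟨l', C, hC, h⟩ := exists_wsup_ultraFourier_le hω (le_of_lt l.2) β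
      refine ⟨l', C, hC, fun φ M hM => ?_⟩
      exact ENNReal.toReal_le_of_le_ofReal (mul_nonneg hC hM.nonneg)
        (h φ.1 (rapidDecay_of_mem_SSub hω φ.2) M hM)
  choose l C hC h using key
  obtain ⟨L, hL⟩ := (s.image l).exists_le
  refine ⟨max L 0, B * ∑ i ∈ s, C i, le_max_right _ _,
    mul_nonneg B.2 (Finset.sum_nonneg fun i _ => hC i), fun φ M hM => ?_⟩
  have h1 : s.sup (S.seminorms ω N) φ ≤ (∑ i ∈ s, C i) * M := by
    refine Seminorm.finset_sup_apply_le
      (mul_nonneg (Finset.sum_nonneg fun i _ => hC i) hM.nonneg) fun i hi => ?_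
    refine (h i φ M (hM.mono hω (rapidDecay_of_mem_SSub hω φ.2)
      ((hL _ (Finset.mem_image_of_mem l hi)).trans (le_max_left _ _)))).trans ?_
    exact mul_le_mul_of_nonneg_right
      (Finset.single_le_sum (f := C) (fun i _ => hC i) hi) hM.nonneg
  calc ‖U φ‖ ≤ B * s.sup (S.seminorms ω N) φ := hB φ
    _ ≤ B * ((∑ i ∈ s, C i) * M) := by gcongr
    _ = _ := by ring

/-- The finite measure on multi-indices with mass `2^{-|α|}` at `α`. -/
def orderMeasure (N : ℕ) : Measure (MultiIndex N) :=
  Measure.count.withDensity fun α => ENNReal.ofReal ((1 / 2) ^ order α)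

lemma orderMeasure_real_singleton (α : MultiIndex N) :
    (orderMeasure N).real {α} = (1 / 2) ^ order α := by
  rw [Measure.real, orderMeasure, withDensity_apply _ (measurableSet_singleton α),
    lintegral_singleton, Measure.count_singleton, mul_one, ENNReal.toReal_ofReal (by positivity)]

instance : IsFiniteMeasure (orderMeasure N) := by
  refine isFiniteMeasure_withDensity ?_
  rw [lintegral_count]
  exact (summable_half_pow_order N).tsum_ofReal_ne_top

/-- The measure `exp(-k ω(x)) dx`. -/
def weightMeasure (ω : ℝ → ℝ) (k : ℝ) (N : ℕ) : Measure (E N) :=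
  volume.withDensity fun x => ENNReal.ofReal (Real.exp (-(k * ω ‖x‖)))

lemma isFiniteMeasure_weightMeasure {k : ℝ}
    (hk : Integrable fun x : E N => Real.exp (-(k * ω ‖x‖))) :
    IsFiniteMeasure (weightMeasure ω k N) :=
  isFiniteMeasure_withDensity_ofReal hk.2

lemma integral_weightMeasure (hω : IsWeight ω) (k : ℝ) {F : Type*} [NormedAddCommGroup F]
    [NormedSpace ℝ F] (f : E N → F) :
    ∫ x, f x ∂weightMeasure ω k N = ∫ x, Real.exp (-(k * ω ‖x‖)) • f x := by
  have hc : Continuous fun x : E N => Real.exp (-(k * ω ‖x‖)) :=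
    Real.continuous_exp.comp (continuous_const.mul (hω.continuous_norm (E N))).neg
  have hmeas : Measurable fun x : E N => ENNReal.ofReal (Real.exp (-(k * ω ‖x‖))) :=
    hc.measurable.ennreal_ofReal
  rw [weightMeasure, integral_withDensity_eq_integral_toReal_smul hmeas (by simp)]
  congr 1
  funext x
  rw [ENNReal.toReal_ofReal (Real.exp_pos _).le]

/-- The functions `exp((l + k) ω(x)) exp(-m φ*(|α| / m)) ∂^α φ(x)` of the pair `(α, x)`. -/
def weightedDeriv (ω : ℝ → ℝ) (N : ℕ) (a m : ℝ) : D ω N →ₗ[ℂ] MultiIndex N × E N → ℂ where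
  toFun φ z := ((Real.exp (a * ω ‖z.2‖) * invWeight ω m (order z.1) : ℝ) : ℂ) * mderiv z.1 φ.1 z.2
  map_add' φ ψ := by
    funext z
    have : mderiv z.1 (φ + ψ).1 = mderiv z.1 φ.1 + mderiv z.1 ψ.1 :=
      mderiv_add z.1 φ.2.1.1 ψ.2.1.1
    rw [this, Pi.add_apply, Pi.add_apply, mul_add]
  map_smul' c φ := by
    funext z
    have : mderiv z.1 (c • φ).1 = c • mderiv z.1 φ.1 := mderiv_smul z.1 c φ.2.1.1
    rw [this, Pi.smul_apply, Pi.smul_apply, smul_eq_mul, smul_eq_mul, RingHom.id_apply]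
    ring

lemma weightedDeriv_apply (a m : ℝ) (φ : D ω N) (z : MultiIndex N × E N) :
    weightedDeriv ω N a m φ z =
      ((Real.exp (a * ω ‖z.2‖) * invWeight ω m (order z.1) : ℝ) : ℂ) * mderiv z.1 φ.1 z.2 := rfl

lemma norm_weightedDeriv (a m : ℝ) (φ : D ω N) (z : MultiIndex N × E N) :
    ‖weightedDeriv ω N a m φ z‖ =
      Real.exp (a * ω ‖z.2‖) * (invWeight ω m (order z.1) * ‖mderiv z.1 φ.1 z.2‖) := by
  rw [weightedDeriv_apply, norm_mul, Complex.norm_real, Real.norm_of_nonneg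
    (mul_nonneg (Real.exp_pos _).le (invWeight_nonneg _)), mul_assoc]

lemma measurable_weightedDeriv (hω : IsWeight ω) (a m : ℝ) (φ : D ω N) :
    Measurable (weightedDeriv ω N a m φ) := by
  refine measurable_from_prod_countable_right fun α => Continuous.measurable ?_
  have h1 : Continuous fun x : E N => Real.exp (a * ω ‖x‖) :=
    Real.continuous_exp.comp (continuous_const.mul (hω.continuous_norm (E N)))
  exact (Complex.continuous_ofReal.comp
    (h1.mul (continuous_const (y := invWeight ω m (order α))))).mul
    (mderiv_contDiff α φ.2.1.1).continuous

lemma exists_norm_weightedDeriv_le (hω : IsWeight ω) (a : ℝ) (m : ℕ+) (φ : D ω N) :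
    ∃ B : ℝ, 0 ≤ B ∧ ∀ z, ‖weightedDeriv ω N a m φ z‖ ≤ B := by
  obtain ⟨A, hA, h⟩ := exists_norm_mderiv_mul_invWeight_le φ.2 m
  have h1 : Continuous fun x : E N => Real.exp (a * ω ‖x‖) :=
    Real.continuous_exp.comp (continuous_const.mul (hω.continuous_norm (E N)))
  obtain ⟨B, hB⟩ := φ.2.2.exists_bound_of_continuousOn h1.continuousOn
  refine ⟨|B| * A, by positivity, fun z => ?_⟩
  rw [norm_weightedDeriv]
  by_cases hz : z.2 ∈ tsupport φ.1
  · have h2 := hB z.2 hz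
    rw [Real.norm_of_nonneg (Real.exp_pos _).le] at h2
    have hiw := invWeight_nonneg (ω := ω) (m := m) (order z.1)
    gcongr
    · exact h2.trans (le_abs_self B)
    · rw [mul_comm]; exact h z.1 z.2
  · have : mderiv z.1 φ.1 z.2 = 0 := image_eq_zero_of_notMem_tsupport
      fun h => hz (tsupport_mderiv_subset z.1 φ.1 h)
    rw [this]
    simp only [norm_zero, mul_zero]
    positivity

lemma memLp_weightedDeriv (hω : IsWeight ω) (a : ℝ) (m : ℕ+) (φ : D ω N)
    (ν : Measure (MultiIndex N × E N)) : MemLp (weightedDeriv ω N a m φ) ∞ ν := by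
  obtain ⟨B, -, hB⟩ := exists_norm_weightedDeriv_le hω a m φ
  exact memLp_top_of_bound (measurable_weightedDeriv hω a m φ).aestronglyMeasurable B
    (Filter.Eventually.of_forall hB)

/-- The single derivatives are controlled by the `L¹`-norm of `weightedDeriv`. -/
lemma integral_mderiv_le (hω : IsWeight ω) {k : ℝ}
    (hk : Integrable fun x : E N => Real.exp (-(k * ω ‖x‖))) (l : ℝ) (m : ℕ+) (φ : D ω N)
    (α : MultiIndex N) :
    (1 / 2) ^ order α * invWeight ω m (order α) * ∫ x, Real.exp (l * ω ‖x‖) * ‖mderiv α φ.1 x‖ ≤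
      ∫ z, ‖weightedDeriv ω N (l + k) m φ z‖ ∂(orderMeasure N).prod (weightMeasure ω k N) := by
  have := isFiniteMeasure_weightMeasure hk
  have hint : Integrable (fun z => ‖weightedDeriv ω N (l + k) m φ z‖)
      ((orderMeasure N).prod (weightMeasure ω k N)) :=
    ((memLp_weightedDeriv hω (l + k) m φ _).integrable le_top).norm
  -- Keep only the slice over α, whose mass 2^{-|α|} is the factor (1/2)^{|α|} on the left.
  have h1 := setIntegral_le_integral (s := {α} ×ˢ Set.univ) hint
    (Filter.Eventually.of_forall fun z => norm_nonneg _)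
  refine le_trans (le_of_eq ?_) h1
  rw [setIntegral_prod _ hint.integrableOn, integral_singleton, orderMeasure_real_singleton,
    setIntegral_univ, integral_weightMeasure hω, smul_eq_mul, mul_assoc, ← integral_const_mul]
  congr 2
  funext x
  simp only [norm_weightedDeriv, smul_eq_mul]
  have : Real.exp (l * ω ‖x‖) = Real.exp (-(k * ω ‖x‖)) * Real.exp ((l + k) * ω ‖x‖) := by
    rw [← Real.exp_add]
    congr 1
    ring
  rw [this]
  ring

/-- The weighted `L¹` norm of φ is read off the slice α = 0. The slices of the pure derivatives feed
`exists_fourier_le`, whose hypothesis tolerates the factor (1/2)^k. -/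
lemma exists_decayBound_of_integral (hω : IsWeight ω) {k : ℝ}
    (hk : Integrable fun x : E N => Real.exp (-(k * ω ‖x‖))) {l : ℝ} (hl : 0 ≤ l) :
    ∃ (m : ℕ+) (C : ℝ), 0 ≤ C ∧ ∀ φ : D ω N, DecayBound ω l
      (C * ∫ z, ‖weightedDeriv ω N (l + k) m φ z‖ ∂(orderMeasure N).prod (weightMeasure ω k N))
      φ.1 := by
  obtain ⟨m, C, hC, h⟩ := exists_fourier_le hω N hl
  have hm : (0 : ℝ) < (m : ℕ) := by exact_mod_cast m.pos
  refine ⟨m, C + 1, by positivity, fun φ => ?_⟩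
  set M := ∫ z, ‖weightedDeriv ω N (l + k) m φ z‖ ∂(orderMeasure N).prod (weightMeasure ω k N)
  have hM0 : 0 ≤ M := by positivity
  have hφ := rapidDecay_of_mem_DSub hω φ.2
  have key : ∀ α, (1 / 2) ^ order α * invWeight ω m (order α) *
      ∫ x, Real.exp (l * ω ‖x‖) * ‖mderiv α φ.1 x‖ ≤ M := integral_mderiv_le hω hk l m φ
  have hexp : ∀ α, ∫ x, ‖mderiv α φ.1 x‖ ≤ ∫ x, Real.exp (l * ω ‖x‖) * ‖mderiv α φ.1 x‖ := by
    intro α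
    have h1 := integrable_mderiv φ.2 α
    refine integral_mono h1.norm (Continuous.integrable_of_hasCompactSupport
      ((Real.continuous_exp.comp (continuous_const.mul (hω.continuous_norm (E N)))).mul
        (mderiv_contDiff α φ.2.1.1).continuous.norm)
      (hasCompactSupport_mderiv α φ.2.2).norm.mul_left) fun x => ?_
    have := hω.nonneg ‖x‖ (norm_nonneg x)
    exact le_mul_of_one_le_left (norm_nonneg _) (Real.one_le_exp (by positivity))
  have h0 : ∫ x, Real.exp (l * ω ‖x‖) * ‖φ.1 x‖ ≤ M := by
    have h1 := key 0
    rw [order_zero, mderiv_zero_index, pow_zero, one_mul] at h1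
    -- Since ω ≥ 0 one has φ*(0) ≤ 0, so the weight at order zero is at least 1.
    have h2 : 1 ≤ 1 * invWeight ω m 0 := le_mul_invWeight hm one_pos fun r hr => by
      have := hω.nonneg r (by linarith)
      rw [pow_zero, one_mul]
      exact Real.one_le_exp (by positivity)
    rw [one_mul] at h2
    have h3 : 0 ≤ ∫ x, Real.exp (l * ω ‖x‖) * ‖φ.1 x‖ := by positivity
    nlinarith
  refine ⟨h0.trans (by nlinarith), fun ξ => (h φ.1 φ.2.1.1 φ.2.2 M ?_ (fun j i => ?_) ξ).trans
    (by nlinarith)⟩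
  · have := hexp 0
    rw [mderiv_zero_index] at this
    exact this.trans h0
  · have h1 := key (Pi.single j i)
    have h2 := hexp (Pi.single j i)
    rw [order_single] at h1
    rw [mderiv_single] at h1 h2
    have hiw := invWeight_nonneg (ω := ω) (m := m) i
    refine le_trans ?_ h1
    gcongr

/-- The family `(-1)^{|α|} 2^{-|α|} exp(l ω) exp(-m φ*(|α| / m)) g(α, ·)`. -/
def densityFamily (ω : ℝ → ℝ) (l m : ℝ) (g : MultiIndex N × E N → ℂ) (α : MultiIndex N) (x : E N) :
    ℂ :=
  (((-1) ^ order α * ((1 / 2) ^ order α * invWeight ω m (order α) * Real.exp (l * ω ‖x‖)) : ℝ) :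
    ℂ) * g (α, x)

lemma norm_densityFamily_le {l m C : ℝ} {g : MultiIndex N × E N → ℂ} (hg : ∀ z, ‖g z‖ ≤ C)
    (α : MultiIndex N) (x : E N) : ‖densityFamily ω l m g α x‖ ≤
      (1 / 2) ^ order α * invWeight ω m (order α) * Real.exp (l * ω ‖x‖) * C := by
  have hiw := invWeight_nonneg (ω := ω) (m := m) (order α)
  rw [densityFamily, norm_mul, Complex.norm_real, norm_mul, norm_pow, norm_neg, norm_one, one_pow,
    one_mul, Real.norm_of_nonneg (by positivity)]
  gcongr
  exact hg _

/-- Enlarging m to m' serves twice: exp((l - m')ω) ≤ exp(-kω) lies in every `L^q`, and the weight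
exp(m' φ*(|α|/m')) is offset by `invWeight` for m. The factor 2^{-|α|} makes the sum over α
converge. -/
lemma memSum_densityFamily (hω : IsWeight ω) {l C : ℝ} {m m' : ℕ+} (hmm : m ≤ m') {k : ℝ}
    (hk : ∀ q : ℝ≥0∞, 1 ≤ q → MemLp (fun x : E N => Real.exp (-(k * ω ‖x‖))) q)
    (hlk : l + k ≤ m') {g : MultiIndex N × E N → ℂ} (hgm : StronglyMeasurable g)
    (hC : 0 ≤ C) (hg : ∀ z, ‖g z‖ ≤ C) {q : ℝ≥0∞} (hq : 1 ≤ q) :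
    MemSum ω m' (-(m' : ℤ)) q (densityFamily ω l m g) := by
  have hm : (0 : ℝ) < (m : ℕ) := by exact_mod_cast m.pos
  have hm' : (0 : ℝ) < (m' : ℕ) := by exact_mod_cast m'.pos
  have hmmR : ((m : ℕ) : ℝ) ≤ (m' : ℕ) := by exact_mod_cast hmm
  set Q := eLpNorm (fun x : E N => Real.exp (-(k * ω ‖x‖))) q volume with hQ
  have hQfin : Q ≠ ∞ := (hk q hq).2.ne
  set B := ENNReal.ofReal C * Q with hB
  have hBfin : B ≠ ∞ := ENNReal.mul_ne_top ENNReal.ofReal_ne_top hQfin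
  have hterm : ∀ α, eLpNorm (fun x => Real.exp ((-(m' : ℤ) : ℤ) * ω ‖x‖) •
      densityFamily ω l m g α x) q volume * EReal.exp (expo ω m' (order α)) ≤
      ENNReal.ofReal ((1 / 2) ^ order α) * B := by
    intro α
    have hiw := invWeight_nonneg (ω := ω) (m := m) (order α)
    have h1 : eLpNorm (fun x => Real.exp ((-(m' : ℤ) : ℤ) * ω ‖x‖) •
        densityFamily ω l m g α x) q volume ≤
        ENNReal.ofReal ((1 / 2) ^ order α * C * invWeight ω m (order α)) * Q := by
      refine eLpNorm_le_mul_eLpNorm_of_ae_le_mul (Filter.Eventually.of_forall fun x => ?_) q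
      rw [norm_smul, Real.norm_of_nonneg (Real.exp_pos _).le,
        Real.norm_of_nonneg (Real.exp_pos _).le]
      have h0 := hω.nonneg ‖x‖ (norm_nonneg x)
      have h2 : Real.exp ((-(m' : ℤ) : ℤ) * ω ‖x‖) * Real.exp (l * ω ‖x‖) ≤
          Real.exp (-(k * ω ‖x‖)) := by
        rw [← Real.exp_add]
        refine Real.exp_le_exp.2 ?_
        push_cast
        nlinarith
      calc _ ≤ Real.exp ((-(m' : ℤ) : ℤ) * ω ‖x‖) * ((1 / 2) ^ order α *
              invWeight ω m (order α) * Real.exp (l * ω ‖x‖) * C) := by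
            gcongr
            exact norm_densityFamily_le hg α x
        _ = (1 / 2) ^ order α * C * invWeight ω m (order α) *
              (Real.exp ((-(m' : ℤ) : ℤ) * ω ‖x‖) * Real.exp (l * ω ‖x‖)) := by ring
        _ ≤ _ := by gcongr
    have h3 : ENNReal.ofReal (invWeight ω m (order α)) * EReal.exp (expo ω m' (order α)) ≤ 1 := by
      rw [exp_expo hm']
      calc _ ≤ ENNReal.ofReal (invWeight ω m' (order α)) *
            (ENNReal.ofReal (invWeight ω m' (order α)))⁻¹ := by
            gcongr
            exact invWeight_mono hω hm hmmR _
        _ ≤ 1 := ENNReal.mul_inv_le_one _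
    calc _ ≤ ENNReal.ofReal ((1 / 2) ^ order α * C * invWeight ω m (order α)) * Q *
          EReal.exp (expo ω m' (order α)) := by gcongr
      _ = ENNReal.ofReal ((1 / 2) ^ order α) * B * (ENNReal.ofReal (invWeight ω m (order α)) *
          EReal.exp (expo ω m' (order α))) := by
          rw [ENNReal.ofReal_mul (by positivity), ENNReal.ofReal_mul (by positivity), hB]
          ring
      _ ≤ _ := mul_le_of_le_one_right' h3
  have hle1 : ∀ α : MultiIndex N, ENNReal.ofReal ((1 / 2) ^ order α) ≤ 1 := fun α => by
    rw [ENNReal.ofReal_le_one]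
    exact pow_le_one₀ (by norm_num) (by norm_num)
  refine ⟨fun α => ?_, ?_⟩
  · have h1 : Continuous fun x : E N => Real.exp (l * ω ‖x‖) :=
      Real.continuous_exp.comp (continuous_const.mul (hω.continuous_norm (E N)))
    refine AEStronglyMeasurable.mul (Complex.continuous_ofReal.comp
      (continuous_const.mul (continuous_const.mul h1))).aestronglyMeasurable ?_
    exact (hgm.comp_measurable measurable_prodMk_left).aestronglyMeasurable
  · rw [sumNorm]
    split_ifs with hq'
    · subst hq'
      refine lt_of_le_of_lt (iSup_le fun α => ?_) hBfin.lt_top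
      exact (hterm α).trans (mul_le_of_le_one_left' (hle1 α))
    · have hq1 : 1 ≤ q.toReal := by
        rw [← ENNReal.toReal_one]
        exact ENNReal.toReal_mono hq' hq
      have hq0 : 0 ≤ q.toReal := by linarith
      have h2 : ∀ α : MultiIndex N, eLpNorm (fun x => Real.exp ((-(m' : ℤ) : ℤ) * ω ‖x‖) •
          densityFamily ω l m g α x) q volume ^ q.toReal *
          EReal.exp ((q.toReal : EReal) * expo ω m' (order α)) ≤
          ENNReal.ofReal ((1 / 2) ^ order α) * B ^ q.toReal := fun α => by
        rw [mul_comm (q.toReal : EReal), EReal.exp_mul, ← ENNReal.mul_rpow_of_nonneg _ _ hq0]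
        refine (ENNReal.rpow_le_rpow (hterm α) hq0).trans ?_
        rw [ENNReal.mul_rpow_of_nonneg _ _ hq0]
        gcongr
        calc _ ≤ ENNReal.ofReal ((1 / 2) ^ order α) ^ (1 : ℝ) :=
              ENNReal.rpow_le_rpow_of_exponent_ge (hle1 α) hq1
          _ = _ := ENNReal.rpow_one _
      refine lt_of_le_of_lt (ENNReal.tsum_le_tsum h2) ?_
      rw [ENNReal.tsum_mul_right]
      exact ENNReal.mul_lt_top (summable_half_pow_order N).tsum_ofReal_ne_top.lt_top
        (ENNReal.rpow_lt_top_of_nonneg hq0 hBfin)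

/-- Fubini over the atoms α: the masses 2^{-|α|} and the density exp(-kω) are already built into the
family, and its sign cancels that of the integration by parts. -/
lemma hasSum_densityFamily (hω : IsWeight ω) {k : ℝ}
    (hk : Integrable fun x : E N => Real.exp (-(k * ω ‖x‖))) (l : ℝ) (m : ℕ+)
    {g : MultiIndex N × E N → ℂ} (hgm : StronglyMeasurable g) {C : ℝ} (hg : ∀ z, ‖g z‖ ≤ C)
    (φ : D ω N) :
    HasSum (fun α => (-1 : ℂ) ^ order α * ∫ x, densityFamily ω l m g α x * mderiv α φ.1 x)
      (∫ z, g z * weightedDeriv ω N (l + k) m φ z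
        ∂(orderMeasure N).prod (weightMeasure ω k N)) := by
  have := isFiniteMeasure_weightMeasure hk
  obtain ⟨B, hB0, hB⟩ := exists_norm_weightedDeriv_le hω (l + k) m φ
  have hbd : ∀ z, ‖g z * weightedDeriv ω N (l + k) m φ z‖ ≤ C * B := fun z => by
    rw [norm_mul]
    exact mul_le_mul (hg z) (hB z) (norm_nonneg _) ((norm_nonneg _).trans (hg z))
  have hint : Integrable (fun z => g z * weightedDeriv ω N (l + k) m φ z)
      ((orderMeasure N).prod (weightMeasure ω k N)) :=
    Integrable.of_bound (hgm.mul
      (measurable_weightedDeriv hω (l + k) m φ).stronglyMeasurable).aestronglyMeasurable (C * B)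
      (Filter.Eventually.of_forall hbd)
  have hterm : ∀ α : MultiIndex N,
      (-1 : ℂ) ^ order α * ∫ x, densityFamily ω l m g α x * mderiv α φ.1 x =
      (orderMeasure N).real {α} •
        ∫ x, g (α, x) * weightedDeriv ω N (l + k) m φ (α, x) ∂weightMeasure ω k N := fun α => by
    rw [orderMeasure_real_singleton, integral_weightMeasure hω, Complex.real_smul,
      ← integral_const_mul, ← integral_const_mul]
    congr 1
    funext x
    rw [densityFamily, weightedDeriv_apply, Complex.real_smul]
    have h1 : Real.exp (l * ω ‖x‖) = Real.exp (-(k * ω ‖x‖)) * Real.exp ((l + k) * ω ‖x‖) := by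
      rw [← Real.exp_add]
      congr 1
      ring
    have h2 : (-1 : ℂ) ^ order α * (-1) ^ order α = 1 := by rw [← mul_pow]; simp
    rw [h1]
    push_cast
    linear_combination (((1 / 2 : ℂ) ^ order α * invWeight ω m (order α) *
      (Complex.exp (-(k * ω ‖x‖)) * Complex.exp ((l + k) * ω ‖x‖))) * g (α, x) *
      mderiv α φ.1 x) * h2
  have hsum : Summable fun α : MultiIndex N => (orderMeasure N).real {α} •
      ∫ x, g (α, x) * weightedDeriv ω N (l + k) m φ (α, x) ∂weightMeasure ω k N := by
    refine Summable.of_norm_bounded ((summable_half_pow_order N).mul_right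
      (C * B * (weightMeasure ω k N).real Set.univ)) fun α => ?_
    rw [norm_smul, orderMeasure_real_singleton, Real.norm_of_nonneg (by positivity)]
    gcongr
    exact norm_integral_le_of_norm_le_const (Filter.Eventually.of_forall fun x => hbd (α, x))
  simp only [hterm]
  rw [integral_prod _ hint, integral_countable hint.integral_prod_left]
  exact hsum.hasSum

/-- Every element of `𝒮'_ω` is a sum of derivatives of a family in the weighted sequence space. -/
theorem exists_isSumDeriv_of_memSDual (hω : IsWeight ω) {T : DDual ω N} (hT : MemSDual T)
    {q : ℝ≥0∞} (hq : 1 ≤ q) :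
    ∃ (m : ℕ+) (f : MultiIndex N → E N → ℂ), MemSum ω m (-(m : ℤ)) q f ∧ IsSumDeriv T f := by
  obtain ⟨U, hU⟩ := hT
  obtain ⟨l, C, hl, hC, hUb⟩ := exists_bound_of_SDual hω U
  obtain ⟨k, hk, hLp⟩ := exists_memLp_exp_neg hω N
  have hint : Integrable fun x : E N => Real.exp (-(k * ω ‖x‖)) :=
    memLp_one_iff_integrable.1 (hLp 1 le_rfl)
  obtain ⟨m, C', hC', hdb⟩ := exists_decayBound_of_integral hω hint hl
  have := isFiniteMeasure_weightMeasure hint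
  -- On test functions T equals U, so it is bounded by C times the decay bound, which in turn is C'
  -- times the `L¹` norm of the weighted derivatives.
  obtain ⟨g, hgm, hg, hTg⟩ := exists_bounded_density (weightedDeriv ω N (l + k) m)
    (ν := (orderMeasure N).prod (weightMeasure ω k N))
    (memLp_weightedDeriv hω (l + k) m · _) T.toLinearMap (C := C * C') (by positivity) fun φ => by
      obtain ⟨hφ, h1⟩ := hU φ
      have h2 := hUb ⟨φ.1, hφ⟩ _ (hdb φ)
      rw [h1] at h2
      rw [mul_assoc]
      exact h2
  obtain ⟨n, hn⟩ := exists_nat_ge (l + k)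
  -- The final index must exceed m and be at least l + k; m + (n + 1) does both.
  refine ⟨m + n.succPNat, densityFamily ω l m g,
    memSum_densityFamily hω (PNat.lt_add_right _ _).le hLp ?_ hgm (by positivity) hg hq,
    fun φ => ?_⟩
  · rw [PNat.add_coe, Nat.succPNat_coe]
    push_cast
    have : (0 : ℝ) ≤ (m : ℕ) := by positivity
    linarith
  · have h1 := hasSum_densityFamily hω hint l m hgm hg φ
    rw [← hTg φ] at h1
    exact h1

end

end Ultra

end

theorem theorem3p15 (N : ℕ) (ω : ℝ → ℝ) (hω : Ultra.IsWeight ω) (p p' : ℝ≥0∞)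
    (hp1 : 1 ≤ p) (hp : p ≠ ∞) (hpp' : p.HolderConjugate p') (T : Ultra.DDual ω N) :
    Ultra.MemSDual T ↔
      ∃ (m : ℕ+) (f : Ultra.MultiIndex N → Ultra.E N → ℂ),
        Ultra.MemSum ω m (-(m : ℤ)) p' f ∧ Ultra.IsSumDeriv T f :=
  ⟨fun hT => Ultra.exists_isSumDeriv_of_memSDual hω hT hpp'.symm.one_le,
    fun ⟨_, _, hf, hT⟩ => Ultra.memSDual_of_isSumDeriv hω hp1 hpp' hf hT⟩
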